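/- Let $T\in(0,\infty)$, let $d\ge 1$ be an integer, and let $X=(X_t)_{t\in[0,T]}$ be an $\mathbb R^d$-valued stochastic process with almost surely continuous paths on a probability space $(\Omega,\mathcal F,\mathbb P)$. Let $\|\cdot\|$ and $\langle\cdot,\cdot\rangle$ be the Euclidean norm and scalar product on $\mathbb R^d$, let $\lambda$ be Lebesgue measure on $[0,T]$ and $\lambda_d$ Lebesgue measure on $\mathbb R^d$. For Borel sets $A\subseteq\mathbb R^d$ and $B\subseteq[0,T]$ put $\tau_X(A,B)=\lambda(\{t\in B: X_t\in A\})$. A local time of (a path of) $X$ is a family $L(x,B)\in[0,\infty]$, $x\in\mathbb R^d$, $B\subseteq[0,T]$ Borel, which is measurable in $x$ and a measure in $B$, such that for every $B$ the function $x\mapsto L(x,B)$ is a density of $A\mapsto\tau_X(A,B)$ with respect to $\lambda_d$, i.e. $\tau_X(A,B)=\int_A L(x,B)\,dx$ for all Borel $A$. Let $\alpha\in(0,1/d)$ and $\theta\ge 0$, and assume the following. (A1) There is a constant $C>0$ such that for every integer $m\ge1$, all times $0=t_0<t_1<\dots<t_m<T$, all $\xi_1,\dots,\xi_m\in(\mathbb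 R\setminus\{0\})^d$, $\xi_j=(\xi_{j,1},\dots,\xi_{j,d})$, and every choice of exponents $k_{j,l}\in\{0,4\}$ ($1\le j\le m$, $1\le l\le d$), $$\Big|\mathbb E\Big[\exp\Big(i\sum_{j=1}^m\langle\xi_j,X_{t_j}-X_{t_{j-1}}\rangle\Big)\Big]\Big|\le C^m m^{\alpha\theta m}\prod_{j=1}^m\prod_{l=1}^d\frac{1}{|\xi_{j,l}|^{k_{j,l}}(t_j-t_{j-1})^{\alpha k_{j,l}}}.$$ (A2) There are constants $C>0$ and $\iota\in[0,1]$ such that for all real $p\ge1$ and all $0\le s\le t\le T$, $$\mathbb E\big[\|X_t-X_s\|^p\big]\le C^p p^{p\iota}|t-s|^{p\alpha}.$$ Then, almost surely, $X$ has a local time $L$ for which $(x,t)\mapsto L(x,[0,t])$ is finite and jointly continuous on $\mathbb R^d\times[0,T]$. Moreover, there are deterministic finite constants $C_1$ and $C_2$ (with $C_1$ independent of $s$) such that, writing $[s-r,s+r]$ for its intersection with $[0,T]$, 1. for every $s\in[0,T]$, almost surely, $$\limsup_{r\downarrow0}\frac{\sup_{x\in\mathbb R^d}L(x,[s-r,s+r])}{r^{1-\alpha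 d}(\log\log r^{-1})^{\alpha(d+\theta)}}\le C_1;$$ 2. almost surely, $$\limsup_{r\downarrow0}\ \sup_{s\in[0,T]}\ \sup_{x\in\mathbb R^d}\frac{L(x,[s-r,s+r])}{r^{1-\alpha d}(\log r^{-1})^{\alpha(d+\theta)}}\le C_2 .$$ -/

import Mathlib

open MeasureTheory ProbabilityTheory Filter Set Topology
open scoped ENNReal NNReal

/-- The bound (A1) on the characteristic function of arbitrary combinations of increments.
The constant `C` does not depend on the number `m` of increments, on the times `t`, on the
frequencies `ξ`, nor on the choice of the exponents `k j l ∈ {0, 4}`. -/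
def CharFunIncrementBound {Ω : Type*} [MeasurableSpace Ω] (P : Measure Ω) {d : ℕ} (T : ℝ)
    (X : ℝ → Ω → EuclideanSpace ℝ (Fin d)) (α θ : ℝ) : Prop :=
  ∃ C : ℝ, 0 < C ∧
    ∀ m : ℕ, 1 ≤ m →
    ∀ t : Fin (m + 1) → ℝ, t 0 = 0 → StrictMono t → t (Fin.last m) < T →
    ∀ ξ : Fin m → EuclideanSpace ℝ (Fin d), (∀ j l, ξ j l ≠ 0) →
    ∀ k : Fin m → Fin d → ℕ, (∀ j l, k j l = 0 ∨ k j l = 4) →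
      ‖∫ ω, Complex.exp (Complex.I *
          ((∑ j : Fin m, inner ℝ (ξ j) (X (t j.succ) ω - X (t j.castSucc) ω) : ℝ) : ℂ)) ∂P‖
        ≤ C ^ m * (m : ℝ) ^ (α * θ * m) *
          ∏ j : Fin m, ∏ l : Fin d,
            1 / (|ξ j l| ^ (k j l) * (t j.succ - t j.castSucc) ^ (α * (k j l : ℝ)))

/-- The bound (A2) on the moments of the increments. The expectation is a `[0, ∞]`-valued
integral, so the bound includes the finiteness of the moments. -/
def MomentIncrementBound {Ω : Type*} [MeasurableSpace Ω] (P : Measure Ω) {d : ℕ} (T : ℝ)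
    (X : ℝ → Ω → EuclideanSpace ℝ (Fin d)) (α : ℝ) : Prop :=
  ∃ C : ℝ, 0 < C ∧ ∃ ι : ℝ, 0 ≤ ι ∧ ι ≤ 1 ∧
    ∀ p : ℝ, 1 ≤ p → ∀ s t : ℝ, 0 ≤ s → s ≤ t → t ≤ T →
      ∫⁻ ω, ENNReal.ofReal (‖X t ω - X s ω‖ ^ p) ∂P
        ≤ ENNReal.ofReal (C ^ p * p ^ (p * ι) * |t - s| ^ (p * α))

/-- The occupation measure `τ_f(A, B)`: the time in `B` that the path `f` spends in `A`. -/
noncomputable def occupationTime {E : Type*} (f : ℝ → E) (A : Set E) (B : Set ℝ) : ℝ≥0∞ :=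
  volume (B ∩ f ⁻¹' A)

/-- `L` is a local time (occupation density) on `[0, T]` of the path `f`: for every Borel set
`B ⊆ [0, T]`, the function `x ↦ L(x, B)` is a density of `A ↦ τ_f(A, B)` with respect to
Lebesgue measure. The versions of these densities are chosen so that `B ↦ L(x, B)` is a measure
for every `x`. -/
def IsLocalTime {E : Type*} [MeasureSpace E] (T : ℝ) (f : ℝ → E) (L : Kernel E ℝ) : Prop :=
  ∀ B : Set ℝ, MeasurableSet B → B ⊆ Icc 0 T → ∀ A : Set E, MeasurableSet A →
    occupationTime f A B = ∫⁻ x in A, L x B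

/-- `(x, t) ↦ L(x, [0, t])` is finite and continuous on `E × [0, T]`. -/
def IsJointlyContinuousLocalTime {E : Type*} [MeasurableSpace E] [TopologicalSpace E] (T : ℝ)
    (L : Kernel E ℝ) : Prop :=
  (∀ x, L x (Icc 0 T) < ∞) ∧
    ContinuousOn (fun q : E × ℝ => (L q.1 (Icc 0 q.2)).toReal) (univ ×ˢ Icc 0 T)

/-!
The local time is the limit, as `ε → 0`, of the smoothed occupation densities
`x ↦ ∫ s in Icc a b, heatKernel ε (x - X s)`, and everything rests on a bound for the moments of
their supremum over `x`. Since the bound must hold for all exponents `m` with the right growth in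
`m`, the order of operations matters.

*Moments.* The `m`-th power of a smoothed density is an integral over `m`-tuples of times. It is
integrated over the space variable as well (`lintegral_occupationConv_pow_le`): translating by the
position at the earliest time removes that position, so only increments after a positive time
remain. Writing the kernels as Fourier integrals, the expectation becomes an integral of the joint
characteristic function of consecutive increments, to which the hypothesis applies
(`CharFunIncrementBound.exists_incrementBound`). The frequencies are related by a triangular
unimodular substitution (`lintegral_prod_tailSum`), the frequency integrals factorise, and the time
integral over ordered tuples is bounded by an exponential tilt (`lintegral_symmetric_le`). A kernel
whose Fourier transform is small against a power of the frequency gains a power of its scale, which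
applies to differences of heat kernels (`fourierKernel_heatKernel_sub`).

*Suprema.* By the semigroup property a smoothed density is a heat kernel average of a less smoothed
one, so its supremum is bounded by an `L^m` norm (`enorm_integral_heatKernel_mul_pow_le`). Starting
at the scale `h ^ (2α) m ^ (-8αd)` for an interval of length `h`, and summing over dyadic scales,
gives `exists_moment_densitySup_le`: the `m`-th moment of the supremum over space and over all
scales, `densitySup`, is at most `(K m ^ (α (d + θ)) h ^ (1 - α d)) ^ m`. The loss of a power of `m`
in the increments between scales is compensated by the choice of the first scale, and the power of
`1 / h` lost there is exactly the one gained by integrating over space.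

*Almost sure bounds.* Optimising over `m` gives exponential tails (`exists_tail_densitySup_le`).
The Borel-Cantelli lemma with tails of order `log n` along the intervals `[s - 2⁻ⁿ, s + 2⁻ⁿ]` gives
the local modulus, and with tails of order `n` along all dyadic intervals of length of order `2⁻ⁿ`
the uniform modulus.

*The local time.* The smoothed densities of `[0, t]` converge uniformly in space for `t` in a
countable dense set, and by the uniform modulus then uniformly in `(x, t)`. The limit is jointly
continuous and increasing in `t`, hence the distribution function of a kernel
(`exists_kernel_of_monotoneOn`), which is an occupation density because heat kernels are an
approximate identity (`exists_isLocalTime`). Its values on intervals are at most `densitySup`, so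
the moduli carry over.
-/

/-! ### The heat kernel -/

section HeatKernel

variable {V : Type*} [NormedAddCommGroup V] [InnerProductSpace ℝ V]

/-- The centred Gaussian density on `V`, normalised so that its Fourier transform (with the
character `exp (2πi⟪u, z⟫)`) is `u ↦ exp (-π a ‖u‖²)`. -/
noncomputable def heatKernel (a : ℝ) (z : V) : ℝ :=
  a ^ (-(Module.finrank ℝ V / 2 : ℝ)) * Real.exp (-(Real.pi / a) * ‖z‖ ^ 2)

lemma heatKernel_nonneg {a : ℝ} (ha : 0 < a) (z : V) : 0 ≤ heatKernel a z := by
  unfold heatKernel; positivity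

lemma heatKernel_le {a : ℝ} (ha : 0 < a) (z : V) :
    heatKernel a z ≤ a ^ (-(Module.finrank ℝ V / 2 : ℝ)) := by
  unfold heatKernel
  refine mul_le_of_le_one_right (by positivity) ?_
  rw [Real.exp_le_one_iff]
  have : 0 ≤ Real.pi / a * ‖z‖ ^ 2 := by positivity
  linarith

lemma continuous_heatKernel (a : ℝ) : Continuous (heatKernel a : V → ℝ) := by
  unfold heatKernel; fun_prop

lemma heatKernel_neg (a : ℝ) (z : V) : heatKernel a (-z) = heatKernel a z := by
  simp [heatKernel]

variable [FiniteDimensional ℝ V] [MeasurableSpace V] [BorelSpace V]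

lemma integrable_exp_neg_mul_sq_norm {b : ℝ} (hb : 0 < b) :
    Integrable (fun z : V => Real.exp (-b * ‖z‖ ^ 2)) := by
  have h := (GaussianFourier.integrable_cexp_neg_mul_sq_norm_add (V := V) (b := (b : ℂ))
    (by simpa using hb) 0 0).norm
  refine h.congr (ae_of_all _ fun z => ?_)
  simp only [Complex.norm_exp]
  congr 1
  simp [← Complex.ofReal_pow, ← Complex.ofReal_mul, ← Complex.ofReal_neg]

lemma integrable_heatKernel {a : ℝ} (ha : 0 < a) : Integrable (heatKernel a : V → ℝ) :=
  (integrable_exp_neg_mul_sq_norm (V := V) (b := Real.pi / a) (by positivity)).const_mul _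

lemma integral_heatKernel {a : ℝ} (ha : 0 < a) : ∫ z : V, heatKernel a z = 1 := by
  unfold heatKernel
  rw [integral_const_mul, GaussianFourier.integral_rexp_neg_mul_sq_norm (by positivity)]
  rw [show Real.pi / (Real.pi / a) = a by field_simp, ← Real.rpow_add ha]
  simp

lemma lintegral_heatKernel {a : ℝ} (ha : 0 < a) (x : V) :
    ∫⁻ z : V, ENNReal.ofReal (heatKernel a (x - z)) = 1 := by
  rw [lintegral_sub_left_eq_self (fun z : V => ENNReal.ofReal (heatKernel a z)) x,
    ← ofReal_integral_eq_lintegral_ofReal (integrable_heatKernel ha)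
      (ae_of_all _ (heatKernel_nonneg ha)), integral_heatKernel ha, ENNReal.ofReal_one]

/-- Fourier inversion for the heat kernel. -/
lemma heatKernel_eq_integral {a : ℝ} (ha : 0 < a) (z : V) :
    (heatKernel a z : ℂ) = ∫ u : V, (Real.exp (-(Real.pi * a) * ‖u‖ ^ 2) : ℂ) *
      Complex.exp (2 * Real.pi * Complex.I * (inner ℝ z u : ℝ)) := by
  have hpa : 0 < Real.pi * a := by positivity
  have h := GaussianFourier.integral_cexp_neg_mul_sq_norm_add (V := V)
    (b := ((Real.pi * a : ℝ) : ℂ)) (by simpa using hpa) (2 * Real.pi * Complex.I) z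
  have hpi : (Real.pi : ℂ) ≠ 0 := by exact_mod_cast Real.pi_ne_zero
  have ha' : (a : ℂ) ≠ 0 := by exact_mod_cast ha.ne'
  simp_rw [Complex.ofReal_exp, ← Complex.exp_add]
  push_cast at h ⊢
  rw [h, heatKernel]
  push_cast
  congr 1
  · rw [show (Real.pi : ℂ) / (Real.pi * a) = ((a⁻¹ : ℝ) : ℂ) by push_cast; field_simp,
      Real.rpow_neg ha.le, ← Real.inv_rpow ha.le, Complex.ofReal_cpow (by positivity)]
    push_cast; rfl
  · congr 1
    field_simp
    rw [Complex.I_sq]; ring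

/-- The semigroup property of the heat kernel. -/
lemma integral_heatKernel_mul_heatKernel {a b : ℝ} (ha : 0 < a) (hb : 0 < b) (x y : V) :
    ∫ z : V, heatKernel b (x - z) * heatKernel a (z - y) = heatKernel (a + b) (x - y) := by
  rw [← integral_add_right_eq_self _ y]
  set w := x - y with hw
  have hc : 0 < Real.pi / a + Real.pi / b := by positivity
  have h := GaussianFourier.integral_cexp_neg_mul_sq_norm_add (V := V)
    (b := ((Real.pi / a + Real.pi / b : ℝ) : ℂ)) (by simpa using hc)
    ((2 * Real.pi / b : ℝ) : ℂ) w
  have h2 : ∀ z : V, Complex.exp (-((Real.pi / a + Real.pi / b : ℝ) : ℂ) * ‖z‖ ^ 2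
      + ((2 * Real.pi / b : ℝ) : ℂ) * (inner ℝ w z : ℝ)) =
      ((Real.exp (-(Real.pi / a + Real.pi / b) * ‖z‖ ^ 2
      + (2 * Real.pi / b) * inner ℝ w z) : ℝ) : ℂ) := by
    intro z; push_cast; rfl
  simp_rw [h2] at h
  rw [integral_complex_ofReal, show ((2 * Real.pi / b : ℝ) : ℂ) ^ 2 * ‖w‖ ^ 2 /
      (4 * ((Real.pi / a + Real.pi / b : ℝ) : ℂ)) = (((2 * Real.pi / b) ^ 2 * ‖w‖ ^ 2 /
      (4 * (Real.pi / a + Real.pi / b)) : ℝ) : ℂ) by push_cast; rfl,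
    show (Real.pi : ℂ) / ((Real.pi / a + Real.pi / b : ℝ) : ℂ) =
      ((Real.pi / (Real.pi / a + Real.pi / b) : ℝ) : ℂ) by push_cast; rfl,
    show (Module.finrank ℝ V / 2 : ℂ) = ((Module.finrank ℝ V / 2 : ℝ) : ℂ) by push_cast; rfl,
    ← Complex.ofReal_cpow (by positivity), ← Complex.ofReal_exp, ← Complex.ofReal_mul,
    Complex.ofReal_inj] at h
  have h3 : ∀ z : V, heatKernel b (x - (z + y)) * heatKernel a (z + y - y) =
      (b ^ (-(Module.finrank ℝ V / 2 : ℝ)) * a ^ (-(Module.finrank ℝ V / 2 : ℝ)) *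
        Real.exp (-(Real.pi / b) * ‖w‖ ^ 2)) *
      Real.exp (-(Real.pi / a + Real.pi / b) * ‖z‖ ^ 2 + (2 * Real.pi / b) * inner ℝ w z) := by
    intro z
    rw [show x - (z + y) = w - z by rw [hw]; abel, add_sub_cancel_right]
    unfold heatKernel
    rw [norm_sub_sq_real]
    have : Real.exp (-(Real.pi / b) * (‖w‖ ^ 2 - 2 * inner ℝ w z + ‖z‖ ^ 2)) *
        Real.exp (-(Real.pi / a) * ‖z‖ ^ 2) = Real.exp (-(Real.pi / b) * ‖w‖ ^ 2) *
        Real.exp (-(Real.pi / a + Real.pi / b) * ‖z‖ ^ 2 + (2 * Real.pi / b) * inner ℝ w z) := by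
      rw [← Real.exp_add, ← Real.exp_add]; congr 1; ring
    linear_combination b ^ (-(Module.finrank ℝ V / 2 : ℝ)) *
      a ^ (-(Module.finrank ℝ V / 2 : ℝ)) * this
  simp_rw [h3]
  rw [integral_const_mul, h]
  unfold heatKernel
  have e1 : Real.pi / (Real.pi / a + Real.pi / b) = (a * b) * (a + b)⁻¹ := by
    have := ha.ne'; have := hb.ne'; have := (add_pos ha hb).ne'; have := (add_pos hb ha).ne'
    field_simp
    rw [add_comm]
  have e2 : Real.exp (-(Real.pi / b) * ‖w‖ ^ 2) * Real.exp ((2 * Real.pi / b) ^ 2 * ‖w‖ ^ 2 /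
      (4 * (Real.pi / a + Real.pi / b))) = Real.exp (-(Real.pi / (a + b)) * ‖w‖ ^ 2) := by
    rw [← Real.exp_add]; congr 1
    have := ha.ne'; have := hb.ne'; have := (add_pos ha hb).ne'; have := (add_pos hb ha).ne'
    field_simp
    ring
  rw [e1, Real.mul_rpow (by positivity) (by positivity), Real.mul_rpow ha.le hb.le,
    Real.inv_rpow (by positivity), ← Real.rpow_neg (by positivity : 0 ≤ a + b), ← e2]
  have e3 : a ^ (-(Module.finrank ℝ V / 2 : ℝ)) * a ^ (Module.finrank ℝ V / 2 : ℝ) = 1 := by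
    rw [← Real.rpow_add ha]; simp
  have e4 : b ^ (-(Module.finrank ℝ V / 2 : ℝ)) * b ^ (Module.finrank ℝ V / 2 : ℝ) = 1 := by
    rw [← Real.rpow_add hb]; simp
  linear_combination (b ^ (-(Module.finrank ℝ V / 2 : ℝ)) * b ^ (Module.finrank ℝ V / 2 : ℝ) *
    (a + b) ^ (-(Module.finrank ℝ V / 2 : ℝ)) * (Real.exp (-(Real.pi / b) * ‖w‖ ^ 2) *
    Real.exp ((2 * Real.pi / b) ^ 2 * ‖w‖ ^ 2 / (4 * (Real.pi / a + Real.pi / b))))) * e3 +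
    ((a + b) ^ (-(Module.finrank ℝ V / 2 : ℝ)) * (Real.exp (-(Real.pi / b) * ‖w‖ ^ 2) *
    Real.exp ((2 * Real.pi / b) ^ 2 * ‖w‖ ^ 2 / (4 * (Real.pi / a + Real.pi / b))))) * e4

end HeatKernel

/-! ### Iterated integrals over tuples -/

section Tuples

/-- Fubini's theorem for a tuple, splitting off its first entry. -/
lemma lintegral_pi_fin_succ {β : Type*} [MeasurableSpace β] (μ : Measure β) [SigmaFinite μ] {n : ℕ}
    {f : (Fin (n + 1) → β) → ℝ≥0∞} (hf : Measurable f) :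
    ∫⁻ x, f x ∂(Measure.pi fun _ => μ) =
      ∫⁻ a, ∫⁻ y : Fin n → β, f (Fin.cons a y) ∂(Measure.pi fun _ => μ) ∂μ := by
  have h := (measurePreserving_piFinSuccAbove (fun _ : Fin (n + 1) => μ) 0).symm
  rw [← h.lintegral_comp hf, lintegral_prod _ (by fun_prop)]
  refine lintegral_congr fun a => lintegral_congr fun y => ?_
  exact congrArg f (Fin.insertNth_zero' a y)

lemma measurable_fin_cons {β : Type*} [MeasurableSpace β] {n : ℕ} :
    Measurable (fun q : β × (Fin n → β) => (Fin.cons q.1 q.2 : Fin (n + 1) → β)) := by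
  refine measurable_pi_lambda _ fun i => ?_
  refine Fin.cases ?_ (fun j => ?_) i
  · simpa using measurable_fst
  · simpa using! (measurable_pi_apply j).comp measurable_snd

/-- The partial sum `u j + u (j + 1) + ⋯` of the entries of a tuple from the index `j` on. -/
def tailSum {V : Type*} [AddCommMonoid V] {n : ℕ} (u : Fin n → V) (j : ℕ) : V :=
  ∑ i : Fin n, if j ≤ (i : ℕ) then u i else 0

lemma tailSum_self {V : Type*} [AddCommMonoid V] {n : ℕ} (u : Fin n → V) : tailSum u n = 0 := by
  refine Finset.sum_eq_zero fun i _ => if_neg (by omega)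

lemma tailSum_cons_zero {V : Type*} [AddCommMonoid V] {n : ℕ} (a : V) (u : Fin n → V) :
    tailSum (Fin.cons a u : Fin (n + 1) → V) 0 = a + tailSum u 0 := by
  simp [tailSum, Fin.sum_univ_succ]

lemma tailSum_cons_succ {V : Type*} [AddCommMonoid V] {n : ℕ} (a : V) (u : Fin n → V) (j : ℕ) :
    tailSum (Fin.cons a u : Fin (n + 1) → V) (j + 1) = tailSum u j := by
  simp [tailSum, Fin.sum_univ_succ]

lemma tailSum_sub_tailSum_succ {V : Type*} [AddCommGroup V] {n : ℕ} (u : Fin n → V) (j : Fin n) :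
    tailSum u j - tailSum u (j + 1) = u j := by
  unfold tailSum
  rw [← Finset.sum_sub_distrib, Finset.sum_eq_single j]
  · simp
  · intro i _ hij
    have : (i : ℕ) ≠ j := fun h => hij (Fin.ext h)
    by_cases h1 : (j : ℕ) ≤ i
    · rw [if_pos h1, if_pos (by omega), sub_self]
    · rw [if_neg h1, if_neg (by omega), sub_self]
  · simp

@[fun_prop]
lemma measurable_tailSum {V : Type*} [AddCommMonoid V] [MeasurableSpace V] [MeasurableAdd₂ V]
    {n : ℕ} (j : ℕ) : Measurable (fun u : Fin n → V => tailSum u j) := by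
  unfold tailSum
  refine Finset.measurable_sum _ fun i _ => ?_
  by_cases h : j ≤ (i : ℕ) <;> simp only [h, if_true, if_false] <;> fun_prop

/-- Summation by parts for a bilinear pairing of a tuple with the increments of a path. -/
lemma sum_inner_sub_zero {V : Type*} [NormedAddCommGroup V] [InnerProductSpace ℝ V] {n : ℕ}
    (u : Fin n → V) (y : Fin (n + 1) → V) :
    ∑ i : Fin n, inner ℝ (u i) (y i.succ - y 0) =
      ∑ j : Fin n, inner ℝ (tailSum u j) (y j.succ - y j.castSucc) := by
  induction n with
  | zero => simp
  | succ n ih =>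
    have h := ih (fun i => u i.succ) (fun i => y i.succ)
    have hu : u = Fin.cons (u 0) (fun i => u i.succ) := (Fin.cons_self_tail u).symm
    rw [Fin.sum_univ_succ (n := n), Fin.sum_univ_succ (n := n)]
    have h1 : ∀ j : Fin n, tailSum u ((j.succ : Fin (n + 1)) : ℕ) =
        tailSum (fun i => u i.succ) j := by
      intro j
      rw [Fin.val_succ]
      conv_lhs => rw [hu]
      exact tailSum_cons_succ _ _ _
    have h0 : tailSum u ((0 : Fin (n + 1)) : ℕ) = u 0 + ∑ i : Fin n, u i.succ := by
      simp [tailSum, Fin.sum_univ_succ]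
    simp_rw [h1, h0]
    have h2 : ∀ i : Fin n, inner ℝ (u i.succ) (y i.succ.succ - y 0) =
        inner ℝ (u i.succ) (y i.succ.succ - y (0 : Fin (n + 1)).succ) +
        inner ℝ (u i.succ) (y (0 : Fin (n + 1)).succ - y 0) := by
      intro i; rw [← inner_add_right]; congr 1; abel
    simp_rw [h2, Finset.sum_add_distrib]
    rw [h, inner_add_left, sum_inner]
    simp only [Fin.castSucc_zero, Fin.succ_castSucc]
    ring

/-- The substitution `ξ j = u j + u (j + 1) + ⋯` is triangular and unimodular. -/
lemma lintegral_prod_tailSum {V : Type*} [AddCommGroup V] [MeasurableSpace V] [MeasurableAdd₂ V]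
    (μ : Measure V) [SigmaFinite μ] [μ.IsAddRightInvariant] {n : ℕ} (F : Fin n → V → ℝ≥0∞)
    (hF : ∀ j, Measurable (F j)) :
    ∫⁻ u : Fin n → V, ∏ j : Fin n, F j (tailSum u j) ∂(Measure.pi fun _ => μ) =
      ∏ j, ∫⁻ v, F j v ∂μ := by
  induction n with
  | zero => simp
  | succ n ih =>
    have hmeas : ∀ (m : ℕ) (F : Fin m → V → ℝ≥0∞), (∀ j, Measurable (F j)) →
        Measurable fun u : Fin m → V => ∏ j : Fin m, F j (tailSum u j) := fun m F hF =>
      Finset.measurable_prod _ fun j _ => (hF j).comp (measurable_tailSum _)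
    have hm := hmeas _ F hF
    have hswap : AEMeasurable (Function.uncurry fun (a : V) (y : Fin n → V) =>
        ∏ j : Fin (n + 1), F j (tailSum (Fin.cons a y : Fin (n + 1) → V) j))
        (μ.prod (Measure.pi fun _ => μ)) := (hm.comp measurable_fin_cons).aemeasurable
    rw [lintegral_pi_fin_succ μ hm, lintegral_lintegral_swap hswap]
    simp_rw [Fin.prod_univ_succ (n := n), Fin.val_succ, Fin.val_zero, tailSum_cons_zero,
      tailSum_cons_succ]
    have h1 : ∀ y : Fin n → V, ∫⁻ a, F 0 (a + tailSum y 0) *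
        ∏ i : Fin n, F i.succ (tailSum y i) ∂μ =
        (∫⁻ v, F 0 v ∂μ) * ∏ i : Fin n, F i.succ (tailSum y i) := by
      intro y
      have hy : Measurable fun a => F 0 (a + tailSum y 0) :=
        (hF 0).comp (measurable_id.add_const _)
      rw [lintegral_mul_const _ hy,
        lintegral_add_right_eq_self (fun v => F 0 v)]
    simp_rw [h1]
    rw [lintegral_const_mul _ (hmeas _ _ fun j => hF j.succ), ih _ fun j => hF j.succ]

/-- The integral of a product over the successive differences of a tuple. -/
lemma lintegral_prod_sub {K K₀ : ℝ → ℝ≥0∞} (hK : Measurable K) (hK₀ : Measurable K₀) (n : ℕ) :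
    ∫⁻ s : Fin (n + 1) → ℝ, K₀ (s 0) * ∏ j : Fin n, K (s j.succ - s j.castSucc)
        ∂(Measure.pi fun _ => volume) = (∫⁻ r, K₀ r) * (∫⁻ r, K r) ^ n := by
  have hm : ∀ (n : ℕ) (L : ℝ → ℝ≥0∞), Measurable L → Measurable fun s : Fin (n + 1) → ℝ =>
      L (s 0) * ∏ j : Fin n, K (s j.succ - s j.castSucc) := by
    intro n L hL
    refine (hL.comp (measurable_pi_apply 0)).mul (Finset.measurable_prod _ fun j _ => ?_)
    exact hK.comp ((measurable_pi_apply _).sub (measurable_pi_apply _))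
  induction n generalizing K₀ with
  | zero =>
    rw [lintegral_pi_fin_succ _ (hm 0 K₀ hK₀)]
    simp
  | succ n ih =>
    rw [lintegral_pi_fin_succ _ (hm (n + 1) K₀ hK₀)]
    have h1 : ∀ a : ℝ, ∫⁻ y : Fin (n + 1) → ℝ, K₀ ((Fin.cons a y : Fin (n + 2) → ℝ) 0) *
        ∏ j : Fin (n + 1), K ((Fin.cons a y : Fin (n + 2) → ℝ) j.succ -
          (Fin.cons a y : Fin (n + 2) → ℝ) j.castSucc) ∂(Measure.pi fun _ => volume) =
        K₀ a * ((∫⁻ r, K r) * (∫⁻ r, K r) ^ n) := by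
      intro a
      have hKa : Measurable fun r => K (r - a) := hK.comp (measurable_id.sub_const a)
      have := ih (K₀ := fun r => K (r - a)) hKa
      rw [lintegral_sub_right_eq_self (fun r => K r) a] at this
      rw [← this, ← lintegral_const_mul _ (hm n _ hKa)]
      refine lintegral_congr fun y => ?_
      rw [Fin.prod_univ_succ (n := n)]
      simp only [Fin.cons_zero, Fin.cons_succ, Fin.castSucc_zero, ← Fin.succ_castSucc]
    simp_rw [h1]
    rw [lintegral_mul_const _ hK₀, pow_succ']

lemma lintegral_euclideanSpace_prod {d : ℕ} {f : ℝ → ℝ≥0∞} (hf : Measurable f) :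
    ∫⁻ ξ : EuclideanSpace ℝ (Fin d), ∏ l, f (ξ l) = (∫⁻ r, f r) ^ d := by
  have hm : ∀ n : ℕ, Measurable fun y : Fin n → ℝ => ∏ l, f (y l) := fun n =>
    Finset.measurable_prod _ fun j _ => hf.comp (measurable_pi_apply j)
  have h := (EuclideanSpace.volume_preserving_symm_measurableEquiv_toLp (Fin d)).lintegral_comp
    (hm d)
  have h2 : ∀ n : ℕ, ∫⁻ y : Fin n → ℝ, ∏ l, f (y l) ∂(Measure.pi fun _ => volume) =
      (∫⁻ r, f r) ^ n := by
    intro n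
    induction n with
    | zero => simp
    | succ n ih =>
      rw [lintegral_pi_fin_succ _ (hm (n + 1))]
      simp_rw [Fin.prod_univ_succ, Fin.cons_zero, Fin.cons_succ]
      simp_rw [lintegral_const_mul _ (hm n), ih]
      rw [lintegral_mul_const _ hf, pow_succ']
  rw [← h2 d]
  exact h

end Tuples

section OneDimensional

/-- The Gamma integral, as a Lebesgue integral. -/
lemma lintegral_rpow_mul_exp {κ r : ℝ} (hκ : κ < 1) (hr : 0 < r) :
    ∫⁻ t in Ioi (0 : ℝ), ENNReal.ofReal (t ^ (-κ) * Real.exp (-(r * t))) =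
      ENNReal.ofReal (Real.Gamma (1 - κ) * r ^ (κ - 1)) := by
  have h := Real.integral_rpow_mul_exp_neg_mul_Ioi (a := 1 - κ) (r := r) (by linarith) hr
  rw [show 1 - κ - 1 = -κ by ring] at h
  have hpos : 0 < (1 / r) ^ (1 - κ) * Real.Gamma (1 - κ) :=
    mul_pos (by positivity) (Real.Gamma_pos_of_pos (by linarith))
  have hint : Integrable (fun t : ℝ => t ^ (-κ) * Real.exp (-(r * t)))
      (volume.restrict (Ioi 0)) := by
    by_contra hc
    rw [integral_undef hc] at h
    exact hpos.ne h
  rw [← ofReal_integral_eq_lintegral_ofReal hint, h]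
  · rw [one_div, Real.inv_rpow hr.le, ← Real.rpow_neg hr.le, mul_comm, neg_sub]
  · filter_upwards [ae_restrict_mem measurableSet_Ioi] with t ht
    have : (0 : ℝ) < t := ht
    positivity

lemma integrable_one_add_abs : Integrable fun v : ℝ => ((1 + |v|) ^ 2)⁻¹ := by
  have h := integrable_one_add_norm (E := ℝ) (μ := volume) (r := 2) (by simp)
  refine h.congr (ae_of_all _ fun v => ?_)
  simp only [Real.norm_eq_abs]
  rw [Real.rpow_neg (by positivity)]
  norm_cast

lemma lintegral_one_add_mul_abs {c : ℝ} (hc : 0 < c) :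
    ∫⁻ v : ℝ, ENNReal.ofReal ((1 + c * |v|) ^ 2)⁻¹ =
      ENNReal.ofReal (c⁻¹ * ∫ v : ℝ, ((1 + |v|) ^ 2)⁻¹) := by
  have h1 : ∀ v : ℝ, ((1 + c * |v|) ^ 2)⁻¹ = ((1 + |c * v|) ^ 2)⁻¹ := by
    intro v; rw [abs_mul, abs_of_pos hc]
  simp_rw [h1]
  have hint : Integrable fun v : ℝ => ((1 + |c * v|) ^ 2)⁻¹ :=
    integrable_one_add_abs.comp_mul_left' hc.ne'
  rw [← ofReal_integral_eq_lintegral_ofReal hint (ae_of_all _ fun v => by positivity),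
    Measure.integral_comp_mul_left (fun v : ℝ => ((1 + |v|) ^ 2)⁻¹) c, abs_of_pos (by positivity),
    smul_eq_mul]

end OneDimensional

/-! ### The characteristic function of increments after a positive time -/

/-- The bound on characteristic functions of increments in the form in which it is used:
no restriction on the frequencies, no increment from time `0`, and one decaying weight in place of
the choice between the exponents `0` and `4`. -/
def IncrementBound {Ω : Type*} [MeasurableSpace Ω] {d : ℕ} (P : Measure Ω) (T : ℝ)
    (Y : ℝ → Ω → EuclideanSpace ℝ (Fin d)) (α θ C : ℝ) : Prop :=
  ∀ (n : ℕ) (s : Fin (n + 1) → ℝ), StrictMono s → 0 < s 0 →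
      s (Fin.last n) < T → ∀ ξ : Fin n → EuclideanSpace ℝ (Fin d),
      ‖∫ ω, Complex.exp (Complex.I *
          ((∑ j : Fin n, inner ℝ (ξ j) (Y (s j.succ) ω - Y (s j.castSucc) ω) : ℝ) : ℂ)) ∂P‖
        ≤ C ^ (n + 1) * ((n + 1 : ℕ) : ℝ) ^ (α * θ * (n + 1 : ℕ)) *
          ∏ j : Fin n, ∏ l : Fin d,
            (16 * ((1 + |ξ j l| * (s j.succ - s j.castSucc) ^ α) ^ 4)⁻¹)

section CharFun

variable {Ω : Type*} [MeasurableSpace Ω] {P : Measure Ω}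
  {d : ℕ} {T : ℝ} {Y : ℝ → Ω → EuclideanSpace ℝ (Fin d)} {α θ : ℝ}

/-- The two choices of the exponent, `0` and `4`, combine into one smooth decaying weight. -/
lemma exists_exponent_bound (α : ℝ) {x r : ℝ} (hx : x ≠ 0) (hr : 0 < r) :
    ∃ k : ℕ, (k = 0 ∨ k = 4) ∧
      1 / (|x| ^ k * r ^ (α * (k : ℝ))) ≤ 16 * ((1 + |x| * r ^ α) ^ 4)⁻¹ := by
  have hv : 0 < |x| * r ^ α := mul_pos (abs_pos.2 hx) (Real.rpow_pos_of_pos hr _)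
  rcases le_total (|x| * r ^ α) 1 with h | h
  · refine ⟨0, Or.inl rfl, ?_⟩
    have h1 : (1 + |x| * r ^ α) ^ 4 ≤ 2 ^ 4 := pow_le_pow_left₀ (by positivity) (by linarith) 4
    rw [← div_eq_mul_inv, le_div_iff₀ (by positivity)]
    norm_num at h1 ⊢
    exact h1
  · refine ⟨4, Or.inr rfl, ?_⟩
    have h1 : (1 + |x| * r ^ α) ^ 4 ≤ (2 * (|x| * r ^ α)) ^ 4 :=
      pow_le_pow_left₀ (by positivity) (by linarith) 4
    have h2 : |x| ^ 4 * r ^ (α * ((4 : ℕ) : ℝ)) = (|x| * r ^ α) ^ 4 := by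
      rw [mul_pow, Real.rpow_mul hr.le, Real.rpow_natCast]
    rw [h2, ← div_eq_mul_inv, div_le_div_iff₀ (by positivity) (by positivity)]
    rw [mul_pow] at h1
    norm_num at h1 ⊢
    exact h1

/-- The first increment, from time `0`, receives the exponents `0`, so that its frequency `ζ` does
not appear in the bound. -/
lemma norm_charFun_increment_le_of_ne_zero {C : ℝ}
    (hC : ∀ m : ℕ, 1 ≤ m →
      ∀ t : Fin (m + 1) → ℝ, t 0 = 0 → StrictMono t → t (Fin.last m) < T →
      ∀ ξ : Fin m → EuclideanSpace ℝ (Fin d), (∀ j l, ξ j l ≠ 0) →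
      ∀ k : Fin m → Fin d → ℕ, (∀ j l, k j l = 0 ∨ k j l = 4) →
      ‖∫ ω, Complex.exp (Complex.I *
          ((∑ j : Fin m, inner ℝ (ξ j) (Y (t j.succ) ω - Y (t j.castSucc) ω) : ℝ) : ℂ)) ∂P‖
        ≤ C ^ m * (m : ℝ) ^ (α * θ * m) *
          ∏ j : Fin m, ∏ l : Fin d,
            1 / (|ξ j l| ^ (k j l) * (t j.succ - t j.castSucc) ^ (α * (k j l : ℝ))))
    (hC0 : 0 < C) {n : ℕ} {s : Fin (n + 1) → ℝ} (hs : StrictMono s) (hs0 : 0 < s 0)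
    (hsT : s (Fin.last n) < T) (ζ : EuclideanSpace ℝ (Fin d)) (hζ : ∀ l, ζ l ≠ 0)
    (ξ : Fin n → EuclideanSpace ℝ (Fin d)) (hξ : ∀ j l, ξ j l ≠ 0) :
    ‖∫ ω, Complex.exp (Complex.I * ((inner ℝ ζ (Y (s 0) ω - Y 0 ω) +
          ∑ j : Fin n, inner ℝ (ξ j) (Y (s j.succ) ω - Y (s j.castSucc) ω) : ℝ) : ℂ)) ∂P‖
      ≤ C ^ (n + 1) * ((n + 1 : ℕ) : ℝ) ^ (α * θ * (n + 1 : ℕ)) *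
        ∏ j : Fin n, ∏ l : Fin d,
          (16 * ((1 + |ξ j l| * (s j.succ - s j.castSucc) ^ α) ^ 4)⁻¹) := by
  have hpos : ∀ j : Fin n, 0 < s j.succ - s j.castSucc := fun j =>
    sub_pos.2 (hs Fin.castSucc_lt_succ)
  choose k hk hkb using fun (j : Fin n) (l : Fin d) =>
    exists_exponent_bound α (hξ j l) (hpos j)
  have h := hC (n + 1) (by omega) (Fin.cons 0 s) (by simp) (by
      intro i
      refine Fin.cases (fun j hij => ?_) (fun i' j hij => ?_) i
      · obtain ⟨j', rfl⟩ := Fin.exists_succ_eq.2 hij.ne'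
        simpa using hs0.trans_le (hs.monotone (Fin.zero_le j'))
      · obtain ⟨j', rfl⟩ := Fin.exists_succ_eq.2 ((Fin.zero_le _).trans_lt hij).ne'
        simpa using hs (Fin.succ_lt_succ_iff.1 hij))
    (by rw [← Fin.succ_last, Fin.cons_succ]; exact hsT)
    (Fin.cons ζ ξ) (by
      intro j; refine Fin.cases ?_ (fun j' => ?_) j
      · simpa using hζ
      · simpa using hξ j')
    (Fin.cons (fun _ => 0) k) (by
      intro j; refine Fin.cases ?_ (fun j' => ?_) j
      · simp
      · simpa using hk j')
  simp only [Fin.sum_univ_succ (n := n), Fin.prod_univ_succ (n := n), Fin.cons_zero, Fin.cons_succ,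
    Fin.castSucc_zero, ← Fin.succ_castSucc] at h
  refine h.trans ?_
  simp only [pow_zero, CharP.cast_eq_zero, mul_zero, Real.rpow_zero, mul_one, div_one,
    Finset.prod_const_one, one_mul]
  refine mul_le_mul_of_nonneg_left ?_ (by positivity)
  refine Finset.prod_le_prod (fun j _ => Finset.prod_nonneg fun l _ => ?_) fun j _ =>
    Finset.prod_le_prod (fun l _ => ?_) fun l _ => hkb j l
  all_goals
    have := hpos j
    positivity

/-- The bound on the characteristic function extends, by continuity, to all frequencies of the
increments after the first time, and the increment from time `0` to the first time may be
ignored. -/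
lemma CharFunIncrementBound.exists_incrementBound [IsProbabilityMeasure P]
    (hYm : ∀ t, Measurable (Y t))
    (h : CharFunIncrementBound P T Y α θ) :
    ∃ C : ℝ, 0 < C ∧ IncrementBound P T Y α θ C := by
  obtain ⟨C, hC0, hC⟩ := h
  refine ⟨C, hC0, fun n s hs hs0 hsT ξ => ?_⟩
  -- Perturb all frequencies by `ε • (1, …, 1)`, which makes every coordinate nonzero for small `ε`.
  set e : EuclideanSpace ℝ (Fin d) := WithLp.toLp 2 (fun _ => 1) with he
  have hel : ∀ l, e l = 1 := fun l => rfl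
  set Ψ : ℝ → Ω → ℂ := fun ε ω => Complex.exp (Complex.I *
    ((inner ℝ (ε • e) (Y (s 0) ω - Y 0 ω) +
      ∑ j : Fin n, inner ℝ (ξ j + ε • e) (Y (s j.succ) ω - Y (s j.castSucc) ω) : ℝ) : ℂ)) with hΨ
  have hcont : Continuous fun ε => ∫ ω, Ψ ε ω ∂P := by
    refine continuous_of_dominated (bound := fun _ => 1) (fun ε => ?_) (fun ε => ?_)
      (integrable_const _) (ae_of_all _ fun ω => ?_)
    · have : Measurable (Ψ ε) := by
        simp only [hΨ]
        refine Complex.measurable_exp.comp (measurable_const.mul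
          (Complex.measurable_ofReal.comp
            (Measurable.add ?_ (Finset.measurable_sum _ fun j _ => ?_))))
        · exact measurable_const.inner ((hYm _).sub (hYm _))
        · exact measurable_const.inner ((hYm _).sub (hYm _))
      exact this.aestronglyMeasurable
    · refine ae_of_all _ fun ω => ?_
      simp only [hΨ]
      rw [mul_comm, Complex.norm_exp_ofReal_mul_I]
    · simp only [hΨ]; fun_prop
  have hcont2 : Continuous fun ε : ℝ => C ^ (n + 1) *
      ((n + 1 : ℕ) : ℝ) ^ (α * θ * (n + 1 : ℕ)) * ∏ j : Fin n, ∏ l : Fin d,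
        (16 * ((1 + |(ξ j + ε • e) l| * (s j.succ - s j.castSucc) ^ α) ^ 4)⁻¹) := by
    refine continuous_const.mul (continuous_finsetProd _ fun j _ =>
      continuous_finsetProd _ fun l _ => continuous_const.mul (Continuous.inv₀ ?_ fun ε => ?_))
    · simp only [PiLp.add_apply, PiLp.smul_apply, smul_eq_mul]; fun_prop
    · have : 0 < s j.succ - s j.castSucc := sub_pos.2 (hs Fin.castSucc_lt_succ)
      positivity
  have hne : ∀ c : ℝ, ∀ᶠ ε in 𝓝[≠] (0 : ℝ), c + ε ≠ 0 := by
    intro c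
    by_cases hc : c = 0
    · filter_upwards [self_mem_nhdsWithin] with ε hε
      simpa [hc] using hε
    · have : Tendsto (fun ε : ℝ => c + ε) (𝓝[≠] 0) (𝓝 c) := by
        have : Tendsto (fun ε : ℝ => c + ε) (𝓝 0) (𝓝 (c + 0)) :=
          (continuous_const.add continuous_id).tendsto 0
        rw [add_zero] at this
        exact this.mono_left nhdsWithin_le_nhds
      exact this.eventually_ne hc
  have key := le_of_tendsto_of_tendsto
    ((hcont.norm.tendsto 0).mono_left (nhdsWithin_le_nhds (s := {0}ᶜ)))
    ((hcont2.tendsto 0).mono_left (nhdsWithin_le_nhds (s := {0}ᶜ))) (by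
      have hall : ∀ᶠ ε in 𝓝[≠] (0 : ℝ), ∀ j l, ξ j l + ε ≠ 0 :=
        eventually_all.2 fun j => eventually_all.2 fun l => hne _
      filter_upwards [hall, self_mem_nhdsWithin] with ε hε hε0
      refine norm_charFun_increment_le_of_ne_zero hC hC0 hs hs0 hsT (ε • e) (fun l => ?_)
        (fun j => ξ j + ε • e) (fun j l => ?_)
      · simpa [hel] using hε0
      · simpa [hel] using hε j l)
  simpa [hΨ] using key

end CharFun

/-! ### Fourier bound for products of a kernel along increments -/

section Fourier

variable {Ω : Type*} [MeasurableSpace Ω] {P : Measure Ω} [IsProbabilityMeasure P] {d : ℕ}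

/-- Writing each factor as a Fourier integral bounds the expectation of a product of kernels by an
integral of a joint characteristic function. -/
lemma enorm_integral_prod_le_of_fourier {V : Type*} [NormedAddCommGroup V] [InnerProductSpace ℝ V]
    [FiniteDimensional ℝ V] [MeasurableSpace V] [BorelSpace V] {ψ G : V → ℝ} (hψ : Integrable ψ)
    (hG : ∀ z, (G z : ℂ) = ∫ u : V, (ψ u : ℂ) *
      Complex.exp (2 * Real.pi * Complex.I * (inner ℝ z u : ℝ)))
    {n : ℕ} (Z : Fin n → Ω → V) (hZ : ∀ i, Measurable (Z i)) (z : V) :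
    ‖∫ ω, ∏ i, G (z - Z i ω) ∂P‖ₑ ≤
      ∫⁻ u : Fin n → V, (∏ i, ‖ψ (u i)‖ₑ) * ‖∫ ω, Complex.exp (Complex.I *
        ((∑ i, inner ℝ (-(2 * Real.pi) • u i) (Z i ω) : ℝ) : ℂ)) ∂P‖ₑ := by
  set f : Ω → (Fin n → V) → ℂ := fun ω u =>
    ((∏ i, (ψ (u i) : ℂ)) *
      Complex.exp (Complex.I * ((∑ i, 2 * Real.pi * inner ℝ z (u i) : ℝ) : ℂ))) *
        Complex.exp (Complex.I * ((∑ i, inner ℝ (-(2 * Real.pi) • u i) (Z i ω) : ℝ) : ℂ)) with hf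
  have h1 : ∀ ω, ((∏ i, G (z - Z i ω) : ℝ) : ℂ) = ∫ u : Fin n → V, f ω u := by
    intro ω
    push_cast
    simp_rw [hG]
    rw [← integral_fintype_prod_volume_eq_prod (fun i u => (ψ u : ℂ) *
      Complex.exp (2 * Real.pi * Complex.I * (inner ℝ (z - Z i ω) u : ℝ)))]
    refine integral_congr_ae (ae_of_all _ fun u => ?_)
    simp only [hf]
    rw [Finset.prod_mul_distrib, mul_assoc (∏ i, (ψ (u i) : ℂ)), ← Complex.exp_add,
      ← Complex.exp_sum, ← mul_add, ← Complex.ofReal_add, ← Finset.sum_add_distrib]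
    congr 2
    push_cast
    rw [Finset.mul_sum]
    refine Finset.sum_congr rfl fun i _ => ?_
    rw [inner_sub_left, inner_smul_left, real_inner_comm (u i) (Z i ω)]
    simp only [conj_trivial]
    push_cast
    ring
  have hψC : Integrable (fun u : Fin n → V => ∏ i, (ψ (u i) : ℂ)) :=
    Integrable.fintype_prod (f := fun _ u => (ψ u : ℂ)) fun _ => hψ.ofReal
  have hint : Integrable (Function.uncurry f) (P.prod volume) := by
    have h2 : Integrable (fun q : Ω × (Fin n → V) => ∏ i, (ψ (q.2 i) : ℂ)) (P.prod volume) :=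
      hψC.comp_snd P
    have hm1 : Measurable fun q : Ω × (Fin n → V) =>
        Complex.exp (Complex.I * ((∑ i, 2 * Real.pi * inner ℝ z (q.2 i) : ℝ) : ℂ)) := by
      refine Complex.measurable_exp.comp (measurable_const.mul (Complex.measurable_ofReal.comp
        (Finset.measurable_sum _ fun i _ => measurable_const.mul (measurable_const.inner ?_))))
      exact (measurable_pi_apply i).comp measurable_snd
    have hm2 : Measurable fun q : Ω × (Fin n → V) =>
        Complex.exp (Complex.I * ((∑ i, inner ℝ (-(2 * Real.pi) • q.2 i) (Z i q.1) : ℝ) : ℂ)) := by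
      refine Complex.measurable_exp.comp (measurable_const.mul (Complex.measurable_ofReal.comp
        (Finset.measurable_sum _ fun i _ => Measurable.inner ?_ ?_)))
      · exact ((measurable_pi_apply i).comp measurable_snd).const_smul _
      · exact (hZ i).comp measurable_fst
    refine h2.mono ((h2.aestronglyMeasurable.mul hm1.aestronglyMeasurable).mul
      hm2.aestronglyMeasurable) (ae_of_all _ fun q => le_of_eq ?_)
    simp only [Function.uncurry, hf]
    rw [norm_mul, norm_mul, mul_comm Complex.I, Complex.norm_exp_ofReal_mul_I, mul_comm Complex.I,
      Complex.norm_exp_ofReal_mul_I, mul_one, mul_one]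
  have h3 : ((∫ ω, ∏ i, G (z - Z i ω) ∂P : ℝ) : ℂ) = ∫ u : Fin n → V, ∫ ω, f ω u ∂P := by
    rw [← integral_complex_ofReal]
    simp_rw [h1]
    exact integral_integral_swap hint
  have h4 : ‖∫ ω, ∏ i, G (z - Z i ω) ∂P‖ₑ = ‖((∫ ω, ∏ i, G (z - Z i ω) ∂P : ℝ) : ℂ)‖ₑ := by
    rw [← ofReal_norm, ← ofReal_norm, Complex.norm_real]
  rw [h4, h3]
  refine (enorm_integral_le_lintegral_enorm _).trans (lintegral_mono fun u => le_of_eq ?_)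
  simp only [hf]
  rw [integral_const_mul, enorm_mul, enorm_mul]
  congr 1
  have h5 : ‖Complex.exp (Complex.I * ((∑ i, 2 * Real.pi * inner ℝ z (u i) : ℝ) : ℂ))‖ₑ = 1 := by
    rw [← ofReal_norm, mul_comm, Complex.norm_exp_ofReal_mul_I, ENNReal.ofReal_one]
  rw [h5, mul_one, ← ofReal_norm, norm_prod, ENNReal.ofReal_prod_of_nonneg fun _ _ =>
    norm_nonneg _]
  refine Finset.prod_congr rfl fun i _ => ?_
  rw [Complex.norm_real, ofReal_norm]

/-- The weight `∏ₗ (1 + c |uₗ|) ^ γ`, a submultiplicative substitute for `(c ‖u‖) ^ γ` with product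
structure. -/
noncomputable def prodWeight (c γ : ℝ) (u : EuclideanSpace ℝ (Fin d)) : ℝ :=
  ∏ l, (1 + c * |u l|) ^ γ

variable {c γ : ℝ}

lemma one_le_prodWeight (hc : 0 ≤ c) (hγ : 0 ≤ γ) (u : EuclideanSpace ℝ (Fin d)) :
    1 ≤ prodWeight c γ u := by
  unfold prodWeight
  refine Finset.one_le_prod fun l _ => Real.one_le_rpow ?_ hγ
  have : 0 ≤ c * |u l| := by positivity
  linarith

lemma prodWeight_sub_le (hc : 0 ≤ c) (hγ : 0 ≤ γ) (u v : EuclideanSpace ℝ (Fin d)) :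
    prodWeight c γ (u - v) ≤ prodWeight c γ u * prodWeight c γ v := by
  unfold prodWeight
  rw [← Finset.prod_mul_distrib]
  refine Finset.prod_le_prod (fun l _ => by positivity) fun l _ => ?_
  rw [← Real.mul_rpow (by positivity) (by positivity)]
  refine Real.rpow_le_rpow (by positivity) ?_ hγ
  have h1 : |(u - v) l| ≤ |u l| + |v l| := abs_sub _ _
  have h2 : 0 ≤ c * |u l| * (c * |v l|) := by positivity
  nlinarith [mul_le_mul_of_nonneg_left h1 hc]

lemma mul_norm_le_prod_one_add (hc : 0 ≤ c) (u : EuclideanSpace ℝ (Fin d)) :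
    c * ‖u‖ ≤ ∏ l, (1 + c * |u l|) := by
  have h1 : ‖u‖ ≤ ∑ l, |u l| := by
    rw [EuclideanSpace.norm_eq]
    refine Real.sqrt_le_iff.2 ⟨Finset.sum_nonneg fun _ _ => abs_nonneg _, ?_⟩
    simpa using Finset.sum_sq_le_sq_sum_of_nonneg (s := Finset.univ) (f := fun l => |u l|)
      fun _ _ => abs_nonneg _
  have h2 : 1 + ∑ l, c * |u l| ≤ ∏ l, (1 + c * |u l|) := by
    refine Finset.induction_on (Finset.univ : Finset (Fin d)) (by simp) fun l s hl ih => ?_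
    rw [Finset.sum_insert hl, Finset.prod_insert hl]
    have h3 : 0 ≤ c * |u l| := by positivity
    have h4 : 0 ≤ ∑ l ∈ s, c * |u l| := Finset.sum_nonneg fun _ _ => by positivity
    nlinarith [mul_le_mul_of_nonneg_left ih h3, mul_nonneg h3 h4]
  rw [← Finset.mul_sum] at h2
  nlinarith [mul_le_mul_of_nonneg_left h1 hc]

/-- After the substitution `u j = ξ j - ξ (j + 1)`, each new frequency `ξ j` enters two of the
weights. -/
lemma prod_prodWeight_le (hc : 0 ≤ c) (hγ : 0 ≤ γ) {n : ℕ} (u : Fin n → EuclideanSpace ℝ (Fin d)) :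
    ∏ j : Fin n, prodWeight c γ (u j) ≤ ∏ j : Fin n, prodWeight c γ (tailSum u j) ^ 2 := by
  have hpos : ∀ v : EuclideanSpace ℝ (Fin d), 0 ≤ prodWeight c γ v := fun v =>
    zero_le_one.trans (one_le_prodWeight hc hγ v)
  have h1 : ∏ j : Fin n, prodWeight c γ (u j) ≤
      (∏ j : Fin n, prodWeight c γ (tailSum u j)) *
        ∏ j : Fin n, prodWeight c γ (tailSum u (j + 1)) := by
    rw [← Finset.prod_mul_distrib]
    refine Finset.prod_le_prod (fun j _ => hpos _) fun j _ => ?_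
    conv_lhs => rw [← tailSum_sub_tailSum_succ u j]
    exact prodWeight_sub_le hc hγ _ _
  have h2 : ∏ j : Fin n, prodWeight c γ (tailSum u (j + 1)) ≤
      ∏ j : Fin n, prodWeight c γ (tailSum u j) := by
    rw [Fin.prod_univ_eq_prod_range (fun j => prodWeight c γ (tailSum u (j + 1))) n,
      Fin.prod_univ_eq_prod_range (fun j => prodWeight c γ (tailSum u j)) n]
    have h3 := (Finset.prod_range_succ' (fun j => prodWeight c γ (tailSum u j)) n).symm.trans
      (Finset.prod_range_succ _ n)
    rw [tailSum_self, show prodWeight c γ (0 : EuclideanSpace ℝ (Fin d)) = 1 by simp [prodWeight],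
      mul_one] at h3
    rw [← h3]
    exact le_mul_of_one_le_right (Finset.prod_nonneg fun _ _ => hpos _) (one_le_prodWeight hc hγ _)
  rw [Finset.prod_pow, pow_two]
  exact h1.trans (mul_le_mul_of_nonneg_left h2 (Finset.prod_nonneg fun _ _ => hpos _))

/-- The integral over one frequency, for a time increment `r` that is at most `h`. -/
lemma lintegral_prodWeight_sq_mul_le {α h r : ℝ} (hα : 0 < α) (hr : 0 < r) (hrh : r ≤ h)
    (hγ : 0 ≤ γ) (hγ1 : γ ≤ 1) :
    ∫⁻ ξ : EuclideanSpace ℝ (Fin d), ENNReal.ofReal (prodWeight (h ^ α) γ ξ ^ 2 *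
        ∏ l, (16 * ((1 + |ξ l| * r ^ α) ^ 4)⁻¹)) ≤
      ENNReal.ofReal ((16 * ∫ v : ℝ, ((1 + |v|) ^ 2)⁻¹) ^ d * h ^ (2 * α * γ * d) *
        r ^ (-(α * d * (1 + 2 * γ)))) := by
  have hh : 0 < h := hr.trans_le hrh
  have hra : 0 < r ^ α := Real.rpow_pos_of_pos hr α
  have hha : 0 < h ^ α := Real.rpow_pos_of_pos hh α
  have hq : 1 ≤ h ^ α / r ^ α := by
    rw [one_le_div hra]; exact Real.rpow_le_rpow hr.le hrh hα.le
  set J := ∫ v : ℝ, ((1 + |v|) ^ 2)⁻¹ with hJ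
  have hJ0 : 0 ≤ J := integral_nonneg fun v => by positivity
  -- One coordinate: trade `(1 + h ^ α |x|) ^ (2γ)` for `(h / r) ^ (2αγ) (1 + r ^ α |x|) ^ 2`.
  have h1 : ∀ x : ℝ, ((1 + h ^ α * |x|) ^ γ) ^ 2 * (16 * ((1 + |x| * r ^ α) ^ 4)⁻¹) ≤
      (16 * ((h ^ α / r ^ α) ^ γ) ^ 2) * ((1 + r ^ α * |x|) ^ 2)⁻¹ := by
    intro x
    have hx := abs_nonneg x
    set v := 1 + r ^ α * |x| with hv
    have hv1 : 1 ≤ v := by rw [hv]; have : 0 ≤ r ^ α * |x| := by positivity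
                           linarith
    have h2 : 1 + h ^ α * |x| ≤ h ^ α / r ^ α * v := by
      have : h ^ α / r ^ α * v = h ^ α / r ^ α + h ^ α * |x| := by rw [hv]; field_simp
      linarith
    have h3 : (1 + h ^ α * |x|) ^ γ ≤ (h ^ α / r ^ α) ^ γ * v := by
      refine (Real.rpow_le_rpow (by positivity) h2 hγ).trans ?_
      rw [Real.mul_rpow (by positivity) (by positivity)]
      refine mul_le_mul_of_nonneg_left ?_ (by positivity)
      exact (Real.rpow_le_rpow_of_exponent_le hv1 hγ1).trans (by rw [Real.rpow_one])
    have h4 : ((1 + h ^ α * |x|) ^ γ) ^ 2 ≤ ((h ^ α / r ^ α) ^ γ * v) ^ 2 :=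
      pow_le_pow_left₀ (by positivity) h3 2
    rw [mul_comm |x|, ← hv]
    have hv0 : v ≠ 0 := by positivity
    calc _ ≤ ((h ^ α / r ^ α) ^ γ * v) ^ 2 * (16 * (v ^ 4)⁻¹) :=
          mul_le_mul_of_nonneg_right h4 (by positivity)
      _ = _ := by field_simp
  have h2 : ∀ ξ : EuclideanSpace ℝ (Fin d), ENNReal.ofReal (prodWeight (h ^ α) γ ξ ^ 2 *
        ∏ l, (16 * ((1 + |ξ l| * r ^ α) ^ 4)⁻¹)) ≤
      ∏ l, ENNReal.ofReal ((16 * ((h ^ α / r ^ α) ^ γ) ^ 2) * ((1 + r ^ α * |ξ l|) ^ 2)⁻¹) := by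
    intro ξ
    rw [← ENNReal.ofReal_prod_of_nonneg fun l _ => by positivity]
    refine ENNReal.ofReal_le_ofReal ?_
    unfold prodWeight
    rw [← Finset.prod_pow, ← Finset.prod_mul_distrib]
    exact Finset.prod_le_prod (fun l _ => by positivity) fun l _ => h1 _
  refine (lintegral_mono h2).trans (le_of_eq ?_)
  rw [lintegral_euclideanSpace_prod (f := fun x => ENNReal.ofReal
    ((16 * ((h ^ α / r ^ α) ^ γ) ^ 2) * ((1 + r ^ α * |x|) ^ 2)⁻¹)) (by fun_prop)]
  simp_rw [fun x : ℝ => ENNReal.ofReal_mul (p := 16 * ((h ^ α / r ^ α) ^ γ) ^ 2)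
    (q := ((1 + r ^ α * |x|) ^ 2)⁻¹) (by positivity)]
  rw [lintegral_const_mul _ (by fun_prop), lintegral_one_add_mul_abs hra, ← hJ,
    ← ENNReal.ofReal_mul (by positivity), ← ENNReal.ofReal_pow (by positivity)]
  congr 1
  have e1 : ((h ^ α / r ^ α) ^ γ) ^ 2 = h ^ (2 * α * γ) * r ^ (-(2 * α * γ)) := by
    rw [Real.div_rpow hha.le hra.le, div_pow, ← Real.rpow_mul hh.le, ← Real.rpow_mul hr.le,
      ← Real.rpow_natCast, ← Real.rpow_natCast, ← Real.rpow_mul hh.le, ← Real.rpow_mul hr.le,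
      div_eq_mul_inv, ← Real.rpow_neg hr.le]
    push_cast
    congr 2 <;> ring
  rw [e1, ← Real.rpow_neg hr.le]
  have e2 : 16 * (h ^ (2 * α * γ) * r ^ (-(2 * α * γ))) * (r ^ (-α) * J) =
      (16 * J) * h ^ (2 * α * γ) * r ^ (-(α * (1 + 2 * γ))) := by
    rw [show -(α * (1 + 2 * γ)) = -(2 * α * γ) + -α by ring, Real.rpow_add hr]; ring
  rw [e2, mul_pow, mul_pow (16 * J), ← Real.rpow_natCast (h ^ _), ← Real.rpow_natCast (r ^ _),
    ← Real.rpow_mul hh.le, ← Real.rpow_mul hr.le]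
  congr 2
  ring

end Fourier

/-! ### Moments of smoothed occupation densities -/

section Moments

variable {d : ℕ}

lemma tailSum_smul {V : Type*} [AddCommGroup V] [Module ℝ V] {n : ℕ} (c : ℝ) (u : Fin n → V)
    (j : ℕ) : tailSum (fun i => c • u i) j = c • tailSum u j := by
  simp [tailSum, Finset.smul_sum]

/-- `G` is an integrable kernel on `ℝᵈ` with Fourier transform `ψ`, and `ψ` is bounded by `A` times
the weight `∏ₗ (1 + c |uₗ|) ^ γ`. Both the heat kernel (`γ = 0`) and differences of heat kernels
(`γ > 0`, with small `A`) are of this form. -/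
structure FourierKernel (ψ G : EuclideanSpace ℝ (Fin d) → ℝ) (A c γ : ℝ) : Prop where
  integrable_fourier : Integrable ψ
  eq_integral : ∀ z, (G z : ℂ) = ∫ u : EuclideanSpace ℝ (Fin d), (ψ u : ℂ) *
      Complex.exp (2 * Real.pi * Complex.I * (inner ℝ z u : ℝ))
  bound : ∀ u, |ψ u| ≤ A * prodWeight c γ u
  continuous : Continuous G
  integrable : Integrable G
  lintegral_le : ∫⁻ z, ‖G z‖ₑ ≤ 2

lemma FourierKernel.abs_le {ψ G : EuclideanSpace ℝ (Fin d) → ℝ} {A c γ : ℝ}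
    (hG : FourierKernel ψ G A c γ) (z : EuclideanSpace ℝ (Fin d)) : |G z| ≤ ∫ u, |ψ u| := by
  rw [← Real.norm_eq_abs, ← Complex.norm_real, hG.eq_integral]
  refine (norm_integral_le_integral_norm _).trans (le_of_eq ?_)
  refine integral_congr_ae (ae_of_all _ fun u => ?_)
  simp only
  rw [norm_mul, show (2 * Real.pi * Complex.I * (inner ℝ z u : ℝ) : ℂ) =
    ((2 * Real.pi * inner ℝ z u : ℝ) : ℂ) * Complex.I by push_cast; ring,
    Complex.norm_exp_ofReal_mul_I, mul_one, Complex.norm_real, Real.norm_eq_abs]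

variable {Ω : Type*} [MeasurableSpace Ω] {P : Measure Ω} [IsProbabilityMeasure P]
  {T : ℝ} {Y : ℝ → Ω → EuclideanSpace ℝ (Fin d)} {α θ : ℝ}

/-- The constant in the bound `lintegral_prodWeight_sq_mul_le` on one frequency integral. -/
noncomputable def freqConst (d : ℕ) : ℝ := (16 * ∫ v : ℝ, ((1 + |v|) ^ 2)⁻¹) ^ d

lemma freqConst_nonneg (d : ℕ) : 0 ≤ freqConst d := by
  have : 0 ≤ ∫ v : ℝ, ((1 + |v|) ^ 2)⁻¹ := integral_nonneg fun v => by positivity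
  unfold freqConst; positivity

/-- The expectation of a product of kernels along the path at ordered times, seen from its position
at the first time: the substitution to tail sums of frequencies turns the joint characteristic
function into one of consecutive increments, and the frequency integrals factorise. -/
lemma enorm_integral_prod_increments_le {C h A γ : ℝ} {ψ G : EuclideanSpace ℝ (Fin d) → ℝ}
    (hα : 0 < α) (hC : 0 < C) (hY : IncrementBound P T Y α θ C) (hYm : ∀ t, Measurable (Y t))
    (hA : 0 ≤ A) (hγ : 0 ≤ γ) (hγ1 : γ ≤ 1) (hG : FourierKernel ψ G A (h ^ α) γ)
    {n : ℕ} {s : Fin (n + 1) → ℝ} (hs : StrictMono s) (hs0 : 0 < s 0) (hsT : s (Fin.last n) < T)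
    (hsh : s (Fin.last n) - s 0 ≤ h) (z : EuclideanSpace ℝ (Fin d)) :
    ‖∫ ω, ∏ i : Fin n, G (z - (Y (s i.succ) ω - Y (s 0) ω)) ∂P‖ₑ ≤
      ENNReal.ofReal (C ^ (n + 1) * ((n + 1 : ℕ) : ℝ) ^ (α * θ * (n + 1 : ℕ)) * A ^ n) *
        ∏ j : Fin n, ENNReal.ofReal (freqConst d * h ^ (2 * α * γ * d) *
          (s j.succ - s j.castSucc) ^ (-(α * d * (1 + 2 * γ)))) := by
  have hpos : ∀ j : Fin n, 0 < s j.succ - s j.castSucc := fun j =>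
    sub_pos.2 (hs Fin.castSucc_lt_succ)
  have hle : ∀ j : Fin n, s j.succ - s j.castSucc ≤ h := fun j => by
    have h1 := hs.monotone (Fin.le_last j.succ)
    have h2 := hs.monotone (Fin.zero_le j.castSucc)
    linarith
  have hh : 0 ≤ h := (sub_nonneg.2 (hs.monotone (Fin.zero_le _))).trans hsh
  set D := C ^ (n + 1) * ((n + 1 : ℕ) : ℝ) ^ (α * θ * (n + 1 : ℕ)) with hD
  have hD0 : 0 ≤ D := by positivity
  set w := prodWeight (d := d) (h ^ α) γ with hw
  have hw0 : ∀ u, 0 ≤ w u := fun u => zero_le_one.trans (one_le_prodWeight (by positivity) hγ u)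
  set F : Fin n → EuclideanSpace ℝ (Fin d) → ℝ≥0∞ := fun j ξ => ENNReal.ofReal (w ξ ^ 2 *
    ∏ l, (16 * ((1 + |ξ l| * (s j.succ - s j.castSucc) ^ α) ^ 4)⁻¹)) with hF
  have hFm : ∀ j, Measurable (F j) := by
    intro j
    simp only [hF, hw, prodWeight]
    have : ∀ l, Measurable fun ξ : EuclideanSpace ℝ (Fin d) => ξ l := fun l => by fun_prop
    fun_prop
  refine (enorm_integral_prod_le_of_fourier hG.integrable_fourier hG.eq_integral
    (fun i ω => Y (s i.succ) ω - Y (s 0) ω) (fun i => (hYm _).sub (hYm _)) z).trans ?_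
  have key : ∀ u : Fin n → EuclideanSpace ℝ (Fin d),
      (∏ i, ‖ψ (u i)‖ₑ) * ‖∫ ω, Complex.exp (Complex.I *
        ((∑ i, inner ℝ (-(2 * Real.pi) • u i) (Y (s i.succ) ω - Y (s 0) ω) : ℝ) : ℂ)) ∂P‖ₑ ≤
      ENNReal.ofReal (D * A ^ n) * ∏ j : Fin n, F j (tailSum u j) := by
    intro u
    have h1 : (∏ i, ‖ψ (u i)‖ₑ) ≤ ENNReal.ofReal (A ^ n * ∏ j : Fin n, w (tailSum u j) ^ 2) := by
      simp_rw [← ofReal_norm]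
      rw [← ENNReal.ofReal_prod_of_nonneg fun _ _ => norm_nonneg _]
      refine ENNReal.ofReal_le_ofReal ?_
      calc ∏ i, ‖ψ (u i)‖ ≤ ∏ i, (A * w (u i)) :=
            Finset.prod_le_prod (fun _ _ => norm_nonneg _) fun i _ => hG.bound _
        _ = A ^ n * ∏ i, w (u i) := by
            rw [Finset.prod_mul_distrib, Finset.prod_const, Finset.card_univ, Fintype.card_fin]
        _ ≤ _ := mul_le_mul_of_nonneg_left (prod_prodWeight_le (by positivity) hγ u) (by positivity)
    have h2 : ‖∫ ω, Complex.exp (Complex.I * ((∑ i, inner ℝ (-(2 * Real.pi) • u i)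
        (Y (s i.succ) ω - Y (s 0) ω) : ℝ) : ℂ)) ∂P‖ₑ ≤ ENNReal.ofReal (D * ∏ j : Fin n, ∏ l : Fin d,
          (16 * ((1 + |tailSum u j l| * (s j.succ - s j.castSucc) ^ α) ^ 4)⁻¹)) := by
      rw [← ofReal_norm]
      refine ENNReal.ofReal_le_ofReal ?_
      -- Summation by parts: the increments from time `s 0` become consecutive increments.
      have h3 : ∀ ω, ∑ i, inner ℝ (-(2 * Real.pi) • u i) (Y (s i.succ) ω - Y (s 0) ω) =
          ∑ j : Fin n, inner ℝ (-(2 * Real.pi) • tailSum u j)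
            (Y (s j.succ) ω - Y (s j.castSucc) ω) := by
        intro ω
        rw [sum_inner_sub_zero (fun i => -(2 * Real.pi) • u i) (fun i => Y (s i) ω)]
        simp_rw [tailSum_smul]
      simp_rw [h3]
      refine (hY n s hs hs0 hsT _).trans (mul_le_mul_of_nonneg_left ?_ hD0)
      refine Finset.prod_le_prod (fun j _ => Finset.prod_nonneg fun l _ => ?_) fun j _ =>
        Finset.prod_le_prod (fun l _ => ?_) fun l _ => ?_
      · have := hpos j; positivity
      · have := hpos j; positivity
      · have h4 := Real.rpow_pos_of_pos (hpos j) α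
        have h5 : |tailSum u j l| ≤ |(-(2 * Real.pi) • tailSum u j) l| := by
          rw [PiLp.smul_apply, smul_eq_mul, abs_mul, abs_neg, abs_of_pos Real.two_pi_pos]
          have h6 := Real.pi_gt_three
          have h7 := abs_nonneg (tailSum u j l)
          nlinarith
        gcongr
    refine (mul_le_mul' h1 h2).trans (le_of_eq ?_)
    rw [← ENNReal.ofReal_mul (by positivity)]
    simp only [hF]
    rw [← ENNReal.ofReal_prod_of_nonneg, ← ENNReal.ofReal_mul (by positivity),
      Finset.prod_mul_distrib]
    · congr 1; ring
    · intro j _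
      have := hpos j
      have := hw0 (tailSum u j)
      positivity
  refine (lintegral_mono key).trans ?_
  have hm : Measurable fun u : Fin n → EuclideanSpace ℝ (Fin d) => ∏ j : Fin n, F j (tailSum u j) :=
    Finset.measurable_prod _ fun j _ => (hFm j).comp (measurable_tailSum _)
  rw [lintegral_const_mul _ hm, volume_pi, lintegral_prod_tailSum _ F hFm]
  refine mul_le_mul' le_rfl (Finset.prod_le_prod' fun j _ => ?_)
  exact lintegral_prodWeight_sq_mul_le hα (hpos j) (hle j) hγ hγ1

/-- Integrating over the space variable removes the position of the path at the first time. -/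
lemma enorm_integral_integral_prod_le {C h A γ : ℝ} {ψ G : EuclideanSpace ℝ (Fin d) → ℝ}
    (hα : 0 < α) (hC : 0 < C) (hY : IncrementBound P T Y α θ C) (hYm : ∀ t, Measurable (Y t))
    (hA : 0 ≤ A) (hγ : 0 ≤ γ) (hγ1 : γ ≤ 1) (hG : FourierKernel ψ G A (h ^ α) γ)
    {n : ℕ} {s : Fin (n + 1) → ℝ} (hs : StrictMono s) (hs0 : 0 < s 0) (hsT : s (Fin.last n) < T)
    (hsh : s (Fin.last n) - s 0 ≤ h) :
    ‖∫ ω, (∫ x, ∏ i : Fin (n + 1), G (x - Y (s i) ω)) ∂P‖ₑ ≤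
      2 * (ENNReal.ofReal (C ^ (n + 1) * ((n + 1 : ℕ) : ℝ) ^ (α * θ * (n + 1 : ℕ)) * A ^ n) *
        ∏ j : Fin n, ENNReal.ofReal (freqConst d * h ^ (2 * α * γ * d) *
          (s j.succ - s j.castSucc) ^ (-(α * d * (1 + 2 * γ))))) := by
  have h1 : ∀ ω, ∫ x, ∏ i : Fin (n + 1), G (x - Y (s i) ω) =
      ∫ x, G x * ∏ i : Fin n, G (x - (Y (s i.succ) ω - Y (s 0) ω)) := by
    intro ω
    rw [← integral_add_right_eq_self _ (Y (s 0) ω)]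
    refine integral_congr_ae (ae_of_all _ fun x => ?_)
    simp only [Fin.prod_univ_succ, add_sub_cancel_right]
    congr 1
    refine Finset.prod_congr rfl fun i _ => ?_
    congr 1; abel
  simp_rw [h1]
  have hint : Integrable (Function.uncurry fun ω x => G x * ∏ i : Fin n,
      G (x - (Y (s i.succ) ω - Y (s 0) ω))) (P.prod volume) := by
    refine Integrable.mul_bdd (c := (∫ u, |ψ u|) ^ n) (hG.integrable.comp_snd P) ?_ ?_
    · have : Measurable fun q : Ω × EuclideanSpace ℝ (Fin d) =>
          ∏ i : Fin n, G (q.2 - (Y (s i.succ) q.1 - Y (s 0) q.1)) :=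
        Finset.measurable_prod _ fun i _ => hG.continuous.measurable.comp
          (measurable_snd.sub (((hYm _).comp measurable_fst).sub ((hYm _).comp measurable_fst)))
      exact this.aestronglyMeasurable
    · refine ae_of_all _ fun q => ?_
      rw [norm_prod]
      refine (Finset.prod_le_prod (fun _ _ => norm_nonneg _) fun i _ => hG.abs_le _).trans ?_
      simp
  rw [integral_integral_swap hint]
  refine (enorm_integral_le_lintegral_enorm _).trans ?_
  simp_rw [integral_const_mul, enorm_mul]
  refine (lintegral_mono fun x => mul_le_mul' le_rfl (enorm_integral_prod_increments_le
    hα hC hY hYm hA hγ hγ1 hG hs hs0 hsT hsh x)).trans ?_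
  rw [lintegral_mul_const _ hG.continuous.measurable.enorm]
  exact mul_le_mul' hG.lintegral_le le_rfl

end Moments

section TimeIntegrals

/-- The one-dimensional kernel of the time integral, tilted by `exp (-r t)`. -/
noncomputable def tiltedKernel (κ r t : ℝ) : ℝ≥0∞ :=
  (Ioi (0 : ℝ)).indicator (fun t => ENNReal.ofReal (t ^ (-κ) * Real.exp (-(r * t)))) t

lemma measurable_tiltedKernel (κ r : ℝ) : Measurable (tiltedKernel κ r) := by
  unfold tiltedKernel
  exact Measurable.indicator (by fun_prop) measurableSet_Ioi

lemma lintegral_tiltedKernel {κ r : ℝ} (hκ : κ < 1) (hr : 0 < r) :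
    ∫⁻ t, tiltedKernel κ r t = ENNReal.ofReal (Real.Gamma (1 - κ) * r ^ (κ - 1)) := by
  unfold tiltedKernel
  rw [lintegral_indicator measurableSet_Ioi, lintegral_rpow_mul_exp hκ hr]

lemma sum_succ_sub_castSucc {n : ℕ} (s : Fin (n + 1) → ℝ) :
    ∑ j : Fin n, (s j.succ - s j.castSucc) = s (Fin.last n) - s 0 := by
  induction n with
  | zero => simp
  | succ n ih =>
    have h := ih fun i => s i.castSucc
    rw [Fin.sum_univ_castSucc]
    simp only [← Fin.castSucc_succ, Fin.succ_last, Fin.castSucc_zero] at h ⊢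
    rw [h]; ring

lemma ae_injective_pi (m : ℕ) :
    ∀ᵐ s : Fin m → ℝ ∂(Measure.pi fun _ => (volume : Measure ℝ)), Function.Injective s := by
  have h : ∀ i j : Fin m, i ≠ j →
      ∀ᵐ s : Fin m → ℝ ∂(Measure.pi fun _ => (volume : Measure ℝ)), s i ≠ s j := by
    intro i j hij
    let S : Submodule ℝ (Fin m → ℝ) := LinearMap.ker
      ((LinearMap.proj i : (Fin m → ℝ) →ₗ[ℝ] ℝ) - LinearMap.proj j)
    have hS : S ≠ ⊤ := by
      intro h
      have h1 : (Pi.single i 1 : Fin m → ℝ) ∈ S := by rw [h]; trivial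
      simp [S, LinearMap.mem_ker, hij.symm] at h1
    have h0 := Measure.addHaar_submodule (volume : Measure (Fin m → ℝ)) S hS
    rw [volume_pi] at h0
    refine measure_mono_null (fun s hs => ?_) h0
    simp only [mem_compl_iff, mem_ofPred_eq, not_not] at hs
    simp [S, LinearMap.mem_ker, hs]
  have h' := eventually_all.2 fun i => eventually_all.2 fun j =>
    eventually_imp_distrib_left.2 (h i j)
  filter_upwards [h'] with s hs i j hij
  by_contra hne
  exact hs i j hne hij

lemma lintegral_comp_perm {m : ℕ} (σ : Equiv.Perm (Fin m)) (f : (Fin m → ℝ) → ℝ≥0∞) :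
    ∫⁻ s, f (s ∘ σ) ∂(Measure.pi fun _ => (volume : Measure ℝ)) =
      ∫⁻ s, f s ∂(Measure.pi fun _ => (volume : Measure ℝ)) := by
  have h := volume_measurePreserving_piCongrLeft (fun _ : Fin m => ℝ) σ
  rw [← volume_pi, ← h.lintegral_comp_emb (MeasurableEquiv.measurableEmbedding _)]
  refine lintegral_congr fun s => ?_
  congr 1
  funext i
  have := MeasurableEquiv.piCongrLeft_apply_apply (β := fun _ : Fin m => ℝ) σ s i
  exact this

/-- If `Φ` is symmetric and bounded by `c ∏ (sⱼ₊₁ - sⱼ) ^ (-κ)` on increasing tuples of times, then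
its integral over `[a, b] ^ m` is bounded by `m!` times the integral over increasing tuples. Instead
of evaluating the latter, the restriction of the total length to `h` is relaxed to the factor
`exp (r (h - ∑ (sⱼ₊₁ - sⱼ)))`, after which the time increments decouple. -/
lemma lintegral_symmetric_le {T a b h κ r : ℝ} (ha : 0 ≤ a) (hbT : b ≤ T)
    (hh : b - a ≤ h)
    (hκ : κ < 1) (hr : 0 < r) {n : ℕ} (Φ : (Fin (n + 1) → ℝ) → ℝ≥0∞) (c : ℝ≥0∞)
    (hsymm : ∀ (s : Fin (n + 1) → ℝ) (σ : Equiv.Perm (Fin (n + 1))), Φ (s ∘ σ) = Φ s)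
    (hbound : ∀ s : Fin (n + 1) → ℝ, StrictMono s → 0 < s 0 → s (Fin.last n) < T →
      s (Fin.last n) - s 0 ≤ h →
      Φ s ≤ c * ∏ j : Fin n, ENNReal.ofReal ((s j.succ - s j.castSucc) ^ (-κ))) :
    ∫⁻ s, Φ s ∂(Measure.pi fun _ => volume.restrict (Icc a b)) ≤
      c * ENNReal.ofReal (Real.exp (r * h)) * ((n + 1).factorial *
        (ENNReal.ofReal h * ENNReal.ofReal (Real.Gamma (1 - κ) * r ^ (κ - 1)) ^ n)) := by
  set R : (Fin (n + 1) → ℝ) → ℝ≥0∞ := fun s => (Icc a b).indicator 1 (s 0) *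
    ∏ j : Fin n, tiltedKernel κ r (s j.succ - s j.castSucc) with hR
  have hRm : Measurable R := by
    refine Measurable.mul ?_ (Finset.measurable_prod _ fun j _ => ?_)
    · exact (measurable_one.indicator measurableSet_Icc).comp (measurable_pi_apply 0)
    · exact (measurable_tiltedKernel κ r).comp
        ((measurable_pi_apply _).sub (measurable_pi_apply _))
  have hRint : ∫⁻ s, R s ∂(Measure.pi fun _ => volume) ≤
      ENNReal.ofReal h * ENNReal.ofReal (Real.Gamma (1 - κ) * r ^ (κ - 1)) ^ n := by
    rw [hR, lintegral_prod_sub (measurable_tiltedKernel κ r)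
      (measurable_one.indicator measurableSet_Icc), lintegral_tiltedKernel hκ hr,
      lintegral_indicator_one measurableSet_Icc, Real.volume_Icc]
    exact mul_le_mul' (ENNReal.ofReal_le_ofReal hh) le_rfl
  have hmono : ∀ s : Fin (n + 1) → ℝ, StrictMono s → (∀ i, s i ∈ Icc a b) → (∀ i, s i ≠ 0) →
      (∀ i, s i ≠ T) → Φ s ≤ c * ENNReal.ofReal (Real.exp (r * h)) * R s := by
    intro s hs hI h0 hT
    have hlen : s (Fin.last n) - s 0 ≤ h := by
      have := (hI (Fin.last n)).2; have := (hI 0).1; linarith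
    refine (hbound s hs (lt_of_le_of_ne (ha.trans (hI 0).1) (h0 0).symm)
      (lt_of_le_of_ne ((hI _).2.trans hbT) (hT _)) hlen).trans ?_
    rw [mul_assoc]
    refine mul_le_mul' le_rfl ?_
    have hpos : ∀ j : Fin n, 0 < s j.succ - s j.castSucc := fun j =>
      sub_pos.2 (hs Fin.castSucc_lt_succ)
    have htel : ∑ j : Fin n, (s j.succ - s j.castSucc) = s (Fin.last n) - s 0 :=
      sum_succ_sub_castSucc s
    simp only [hR]
    rw [indicator_of_mem (hI 0), Pi.one_apply, one_mul]
    have h2 : ∀ j : Fin n, tiltedKernel κ r (s j.succ - s j.castSucc) =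
        ENNReal.ofReal ((s j.succ - s j.castSucc) ^ (-κ) *
          Real.exp (-(r * (s j.succ - s j.castSucc)))) := fun j => by
      rw [tiltedKernel, indicator_of_mem (show s j.succ - s j.castSucc ∈ Ioi (0 : ℝ) from hpos j)]
    simp_rw [h2]
    rw [← ENNReal.ofReal_prod_of_nonneg fun j _ => by have := hpos j; positivity,
      ← ENNReal.ofReal_prod_of_nonneg fun j _ => by have := hpos j; positivity,
      ← ENNReal.ofReal_mul (by positivity)]
    refine ENNReal.ofReal_le_ofReal ?_
    rw [Finset.prod_mul_distrib, ← Real.exp_sum, Finset.sum_neg_distrib, ← Finset.mul_sum, htel,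
      mul_left_comm, ← Real.exp_add]
    refine le_mul_of_one_le_right (Finset.prod_nonneg fun j _ => ?_) ?_
    · have := hpos j; positivity
    · rw [Real.one_le_exp_iff]; nlinarith
  have hae : ∀ᵐ s : Fin (n + 1) → ℝ ∂(Measure.pi fun _ => volume.restrict (Icc a b)),
      Φ s ≤ ∑ σ : Equiv.Perm (Fin (n + 1)),
        c * ENNReal.ofReal (Real.exp (r * h)) * R (s ∘ σ) := by
    rw [← Measure.restrict_pi_pi]
    have h0 : ∀ᵐ s : Fin (n + 1) → ℝ ∂(Measure.pi fun _ => volume), ∀ i, s i ≠ 0 :=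
      eventually_all.2 fun i => Measure.ae_eval_ne (α := fun _ => ℝ) (fun _ => volume) i 0
    have hT : ∀ᵐ s : Fin (n + 1) → ℝ ∂(Measure.pi fun _ => volume), ∀ i, s i ≠ T :=
      eventually_all.2 fun i => Measure.ae_eval_ne (α := fun _ => ℝ) (fun _ => volume) i T
    filter_upwards [ae_restrict_mem (MeasurableSet.univ_pi fun _ => measurableSet_Icc),
      ae_restrict_of_ae h0, ae_restrict_of_ae hT, ae_restrict_of_ae (ae_injective_pi (n + 1))]
      with s hI h0 hT hinj
    set σ := Tuple.sort s
    have hsm : StrictMono (s ∘ σ) :=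
      (Tuple.monotone_sort s).strictMono_of_injective (hinj.comp σ.injective)
    rw [← hsymm s σ]
    refine (hmono (s ∘ σ) hsm (fun i => hI _ (mem_univ _)) (fun i => h0 _) (fun i => hT _)).trans ?_
    exact Finset.single_le_sum (f := fun σ : Equiv.Perm (Fin (n + 1)) =>
      c * ENNReal.ofReal (Real.exp (r * h)) * R (s ∘ σ)) (fun _ _ => zero_le) (Finset.mem_univ σ)
  have hRσ : ∀ σ : Equiv.Perm (Fin (n + 1)), Measurable fun s : Fin (n + 1) → ℝ => R (s ∘ σ) :=
    fun σ => hRm.comp (measurable_pi_lambda _ fun i => measurable_pi_apply (σ i))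
  refine (lintegral_mono_ae hae).trans ?_
  rw [← Measure.restrict_pi_pi]
  refine (setLIntegral_le_lintegral _ _).trans ?_
  rw [lintegral_finsetSum _ fun σ _ => (hRσ σ).const_mul _]
  have hperm : ∀ σ : Equiv.Perm (Fin (n + 1)), ∫⁻ s : Fin (n + 1) → ℝ,
      c * ENNReal.ofReal (Real.exp (r * h)) * R (s ∘ σ) ∂(Measure.pi fun _ => volume) =
      c * ENNReal.ofReal (Real.exp (r * h)) * ∫⁻ s, R s ∂(Measure.pi fun _ => volume) := fun σ => by
    rw [lintegral_const_mul _ (hRσ σ), lintegral_comp_perm σ R]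
  simp_rw [hperm]
  rw [Finset.sum_const, Finset.card_univ, Fintype.card_perm, Fintype.card_fin, nsmul_eq_mul,
    mul_left_comm]
  exact mul_le_mul' le_rfl (mul_le_mul' le_rfl hRint)

end TimeIntegrals

section MomentBound

variable {d : ℕ}

/-- The convolution of the kernel `G` with the occupation measure of the path `y` on `[a, b]`. -/
noncomputable def occupationConv {V : Type*} [AddGroup V] (G : V → ℝ) (y : ℝ → V) (a b : ℝ)
    (x : V) : ℝ :=
  ∫ s in Icc a b, G (x - y s)

variable {Ω : Type*} [MeasurableSpace Ω] {P : Measure Ω} [IsProbabilityMeasure P]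
  {T : ℝ} {Y : ℝ → Ω → EuclideanSpace ℝ (Fin d)} {α θ : ℝ}

/-- The moment bound with a free tilt parameter `r`. The `m`-th power of the occupation integral is
an integral over `m`-tuples of times, symmetric in the times. -/
lemma lintegral_occupationConv_pow_le_of_tilt {C h A γ a b r : ℝ}
    {ψ G : EuclideanSpace ℝ (Fin d) → ℝ}
    (hα : 0 < α) (hC : 0 < C) (hY : IncrementBound P T Y α θ C)
    (hYm : Measurable (Function.uncurry Y))
    (hA : 0 ≤ A) (hγ : 0 ≤ γ) (hγ1 : γ ≤ 1) (hκ : α * d * (1 + 2 * γ) < 1)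
    (hG : FourierKernel ψ G A (h ^ α) γ) (ha : 0 ≤ a) (hbT : b ≤ T) (hh : b - a ≤ h)
    (hh0 : 0 < h) (hr : 0 < r) {n : ℕ} (hn : Even (n + 1)) :
    ∫⁻ ω, ∫⁻ x, ENNReal.ofReal (occupationConv G (fun s => Y s ω) a b x ^ (n + 1)) ∂volume ∂P ≤
      ENNReal.ofReal (2 * (C ^ (n + 1) * ((n + 1 : ℕ) : ℝ) ^ (α * θ * (n + 1 : ℕ)) * A ^ n) *
        (freqConst d * h ^ (2 * α * γ * d)) ^ n * Real.exp (r * h) * ((n + 1).factorial *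
        (h * (Real.Gamma (1 - α * d * (1 + 2 * γ)) * r ^ (α * d * (1 + 2 * γ) - 1)) ^ n))) := by
  set μ := volume.restrict (Icc a b) with hμ
  set κ := α * d * (1 + 2 * γ) with hκd
  have hYt : ∀ t, Measurable (Y t) := fun t => hYm.comp (measurable_const.prodMk measurable_id)
  set B := ∫ u, |ψ u| with hB
  have hGm := hG.continuous.measurable
  set Ψ : (Ω × EuclideanSpace ℝ (Fin d)) → (Fin (n + 1) → ℝ) → ℝ := fun q s =>
    ∏ j : Fin (n + 1), G (q.2 - Y (s j) q.1) with hΨ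
  have hYj : ∀ j : Fin (n + 1), Measurable fun q : (Ω × EuclideanSpace ℝ (Fin d)) ×
      (Fin (n + 1) → ℝ) => G (q.1.2 - Y (q.2 j) q.1.1) := by
    intro j
    have h1 : Measurable fun q : (Ω × EuclideanSpace ℝ (Fin d)) × (Fin (n + 1) → ℝ) =>
        (q.2 j, q.1.1) :=
      ((measurable_pi_apply j).comp measurable_snd).prodMk (measurable_fst.comp measurable_fst)
    exact hGm.comp ((measurable_snd.comp measurable_fst).sub (hYm.comp h1))
  have hΨm : Measurable (Function.uncurry Ψ) := Finset.measurable_prod _ fun j _ => hYj j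
  -- The first factor is integrable in all variables and the other factors are bounded.
  have hfirst_ω : ∀ s : Fin (n + 1) → ℝ, ∫⁻ q : Ω × EuclideanSpace ℝ (Fin d),
      ‖G (q.2 - Y (s 0) q.1)‖ₑ ∂(P.prod volume) = ∫⁻ z, ‖G z‖ₑ := by
    intro s
    rw [lintegral_prod]
    · simp_rw [fun ω => lintegral_sub_right_eq_self
        (μ := (volume : Measure (EuclideanSpace ℝ (Fin d)))) (fun z => ‖G z‖ₑ) (Y (s 0) ω)]
      simp
    · exact (hGm.comp (measurable_snd.sub ((hYt _).comp measurable_fst))).enorm.aemeasurable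
  have hΨ_eq : ∀ q s, Ψ q s = G (q.2 - Y (s 0) q.1) * ∏ j : Fin n, G (q.2 - Y (s j.succ) q.1) :=
    fun q s => Fin.prod_univ_succ _
  have hbdd : ∀ (q : Ω × EuclideanSpace ℝ (Fin d)) (s : Fin (n + 1) → ℝ),
      ‖∏ j : Fin n, G (q.2 - Y (s j.succ) q.1)‖ ≤ B ^ n := by
    intro q s
    rw [norm_prod]
    refine (Finset.prod_le_prod (fun _ _ => norm_nonneg _) fun i _ => hG.abs_le _).trans ?_
    simp [hB]
  have hint_s : ∀ s, Integrable (fun q => Ψ q s) (P.prod volume) := by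
    intro s
    simp_rw [hΨ_eq]
    refine Integrable.mul_bdd (c := B ^ n) ⟨?_, ?_⟩ ?_ (ae_of_all _ fun q => hbdd q s)
    · exact (hGm.comp (measurable_snd.sub ((hYt _).comp measurable_fst))).aestronglyMeasurable
    · rw [HasFiniteIntegral, hfirst_ω]
      exact hG.lintegral_le.trans_lt (by simp)
    · exact (Finset.measurable_prod _ fun j _ =>
        hGm.comp (measurable_snd.sub ((hYt _).comp measurable_fst))).aestronglyMeasurable
  have hint : Integrable (Function.uncurry Ψ) ((P.prod volume).prod (Measure.pi fun _ => μ)) := by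
    have h1 : Function.uncurry Ψ = fun q => G (q.1.2 - Y (q.2 0) q.1.1) *
        ∏ j : Fin n, G (q.1.2 - Y (q.2 j.succ) q.1.1) := funext fun q => hΨ_eq _ _
    rw [h1]
    refine Integrable.mul_bdd (c := B ^ n) ⟨(hYj 0).aestronglyMeasurable, ?_⟩
      (Finset.measurable_prod _ fun j _ => hYj j.succ).aestronglyMeasurable
      (ae_of_all _ fun q => hbdd q.1 q.2)
    rw [HasFiniteIntegral, lintegral_prod_symm' _ (hYj 0).enorm]
    simp only
    simp_rw [hfirst_ω]
    rw [lintegral_const]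
    refine ENNReal.mul_lt_top (hG.lintegral_le.trans_lt (by simp)) ?_
    exact measure_lt_top _ _
  have hpow : ∀ q : Ω × EuclideanSpace ℝ (Fin d),
      occupationConv G (fun s => Y s q.1) a b q.2 ^ (n + 1) =
        ∫ s, Ψ q s ∂(Measure.pi fun _ => μ) := by
    intro q
    have := integral_fintype_prod_eq_pow (ι := Fin (n + 1)) (μ := μ)
      (fun s : ℝ => G (q.2 - Y s q.1))
    rw [Fintype.card_fin] at this
    exact this.symm
  have hint_pow : Integrable (fun q : Ω × EuclideanSpace ℝ (Fin d) =>
      occupationConv G (fun s => Y s q.1) a b q.2 ^ (n + 1)) (P.prod volume) := by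
    simp_rw [hpow]
    exact hint.integral_prod_left
  have hmeas : AEMeasurable (fun q : Ω × EuclideanSpace ℝ (Fin d) =>
      ENNReal.ofReal (occupationConv G (fun s => Y s q.1) a b q.2 ^ (n + 1))) (P.prod volume) :=
    hint_pow.aemeasurable.ennreal_ofReal
  rw [← lintegral_prod _ hmeas, ← ofReal_integral_eq_lintegral_ofReal hint_pow
    (ae_of_all _ fun q => hn.pow_nonneg _)]
  have hswap : ∫ q, occupationConv G (fun s => Y s q.1) a b q.2 ^ (n + 1) ∂(P.prod volume) =
      ∫ s, (∫ ω, (∫ x, ∏ i : Fin (n + 1), G (x - Y (s i) ω)) ∂P) ∂(Measure.pi fun _ => μ) := by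
    simp_rw [hpow]
    rw [integral_integral_swap hint]
    refine integral_congr_ae (ae_of_all _ fun s => ?_)
    exact integral_prod _ (hint_s s)
  have hstep : ENNReal.ofReal (∫ q, occupationConv G (fun s => Y s q.1) a b q.2 ^ (n + 1)
        ∂(P.prod volume)) ≤
      ∫⁻ s, ‖∫ ω, (∫ x, ∏ i : Fin (n + 1), G (x - Y (s i) ω)) ∂P‖ₑ ∂(Measure.pi fun _ => μ) := by
    rw [hswap]
    refine le_trans ?_ (enorm_integral_le_lintegral_enorm _)
    rw [← ofReal_norm]
    exact ENNReal.ofReal_le_ofReal (le_abs_self _)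
  refine hstep.trans ?_
  set D := C ^ (n + 1) * ((n + 1 : ℕ) : ℝ) ^ (α * θ * (n + 1 : ℕ)) * A ^ n with hD
  have hD0 : 0 ≤ D := by positivity
  clear_value D
  have hQ0 := freqConst_nonneg d
  have hΓ : 0 < Real.Gamma (1 - κ) := Real.Gamma_pos_of_pos (by linarith)
  refine (lintegral_symmetric_le (κ := κ) ha hbT hh hκ hr _
    (ENNReal.ofReal (2 * D * (freqConst d * h ^ (2 * α * γ * d)) ^ n)) (fun s σ => ?_)
    (fun s hs hs0 hsT hsh => ?_)).trans (le_of_eq ?_)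
  · congr 2
    funext ω
    congr 1
    funext x
    exact Equiv.prod_comp σ fun i => G (x - Y (s i) ω)
  · refine (enorm_integral_integral_prod_le hα hC hY hYt hA hγ hγ1 hG hs hs0 hsT hsh).trans
      (le_of_eq ?_)
    rw [← hD]
    simp_rw [fun x : ℝ => ENNReal.ofReal_mul (p := freqConst d * h ^ (2 * α * γ * d)) (q := x)
      (by positivity)]
    rw [Finset.prod_mul_distrib, Finset.prod_const, Finset.card_univ, Fintype.card_fin,
      ENNReal.ofReal_mul (p := 2 * D) (by positivity), ENNReal.ofReal_mul (p := 2) (by positivity),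
      ENNReal.ofReal_pow (by positivity), ENNReal.ofReal_ofNat]
    simp only [hκd]
    ring
  · rw [← ENNReal.ofReal_mul (by positivity), ← ENNReal.ofReal_pow (by positivity),
      ← ENNReal.ofReal_mul (by positivity), ← ENNReal.ofReal_natCast,
      ← ENNReal.ofReal_mul (by positivity), ← ENNReal.ofReal_mul (by positivity)]

/-- The moment bound: up to `K ^ m`, the `m`-th moment of a smoothed occupation density on an
interval of length `h`, integrated over space, is `m ^ ((α θ + κ) m) h ^ (α d + (1 - α d) m)`. -/
theorem lintegral_occupationConv_pow_le {C γ : ℝ}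
    (hα : 0 < α) (hC : 0 < C) (hY : IncrementBound P T Y α θ C)
    (hYm : Measurable (Function.uncurry Y))
    (hγ : 0 ≤ γ) (hγ1 : γ ≤ 1) (hκ : α * d * (1 + 2 * γ) < 1) :
    ∃ K : ℝ, 1 ≤ K ∧ ∀ (A h a b : ℝ) (ψ G : EuclideanSpace ℝ (Fin d) → ℝ), 0 ≤ A → 0 < h → 0 ≤ a →
      b ≤ T → b - a ≤ h → FourierKernel ψ G A (h ^ α) γ → ∀ m : ℕ, 1 ≤ m → Even m →
      ∫⁻ ω, ∫⁻ x, ENNReal.ofReal (occupationConv G (fun s => Y s ω) a b x ^ m) ∂volume ∂P ≤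
        ENNReal.ofReal (K ^ m * (m : ℝ) ^ ((α * θ + α * d * (1 + 2 * γ)) * m) *
          h ^ (α * d + (1 - α * d) * m) * A ^ (m - 1)) := by
  set κ := α * d * (1 + 2 * γ) with hκd
  have hΓ : 0 < Real.Gamma (1 - κ) := Real.Gamma_pos_of_pos (by linarith)
  set Q := max (freqConst d) 1 with hQ
  set Γ' := max (Real.Gamma (1 - κ)) 1 with hΓ'
  have hQ0 := freqConst_nonneg d
  have hκ0 : 0 ≤ κ := by positivity
  have hQ1 : 1 ≤ Q := le_max_right _ _
  have hΓ1 : 1 ≤ Γ' := le_max_right _ _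
  refine ⟨max 1 (2 * C * Q * Γ' * Real.exp 1 ^ 2), le_max_left _ _, ?_⟩
  intro A h a b ψ G hA hh0 ha hbT hh hG m hm hmeven
  obtain ⟨n, rfl⟩ : ∃ n, m = n + 1 := ⟨m - 1, by omega⟩
  set M : ℝ := ((n + 1 : ℕ) : ℝ) with hM
  have hM1 : 1 ≤ M := by rw [hM]; exact_mod_cast hm
  have hM0 : 0 < M := by linarith
  -- The tilt is `r = m / h`, which balances `exp (r h)` against `r ^ ((κ - 1) (m - 1))`.
  have h1 := lintegral_occupationConv_pow_le_of_tilt (r := M / h) hα hC hY hYm hA hγ hγ1 hκ hG ha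
    hbT hh hh0 (by positivity) hmeven
  refine h1.trans (ENNReal.ofReal_le_ofReal ?_)
  rw [← hM, ← hκd, show M / h * h = M by field_simp, Nat.add_sub_cancel]
  have e1 : ((n + 1).factorial : ℝ) ≤ M ^ (n + 1) := by
    rw [hM]; exact_mod_cast Nat.factorial_le_pow (n + 1)
  have e2 : freqConst d ^ n ≤ Q ^ (n + 1) :=
    (pow_le_pow_left₀ hQ0 (le_max_left _ _) n).trans (pow_le_pow_right₀ hQ1 (by omega))
  have e3 : Real.Gamma (1 - κ) ^ n ≤ Γ' ^ (n + 1) :=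
    (pow_le_pow_left₀ hΓ.le (le_max_left _ _) n).trans (pow_le_pow_right₀ hΓ1 (by omega))
  have e4 : Real.exp M = Real.exp 1 ^ (n + 1) := by rw [hM, ← Real.exp_nat_mul, mul_one]
  have e5 : M ≤ Real.exp 1 ^ (n + 1) := by rw [← e4]; linarith [Real.add_one_le_exp M]
  have e6 : (2 : ℝ) ≤ 2 ^ (n + 1) := by
    rw [pow_succ]; linarith [one_le_pow₀ (show (1 : ℝ) ≤ 2 by norm_num) (n := n)]
  have hnM : (n : ℝ) = M - 1 := by rw [hM]; push_cast; ring
  have e7 : (M / h) ^ (κ - 1) = M ^ (κ - 1) * h ^ (1 - κ) := by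
    rw [Real.div_rpow hM0.le hh0.le, div_eq_mul_inv, ← Real.rpow_neg hh0.le, neg_sub]
  have e8 : (h ^ (2 * α * γ * d)) ^ n * (h * (h ^ (1 - κ)) ^ n) =
      h ^ (α * d + (1 - α * d) * M) := by
    rw [← Real.rpow_natCast, ← Real.rpow_natCast, ← Real.rpow_mul hh0.le, ← Real.rpow_mul hh0.le]
    nth_rewrite 2 [← Real.rpow_one h]
    rw [← Real.rpow_add hh0, ← Real.rpow_add hh0, hnM, hκd]
    congr 1; ring
  have e9 : M ^ (n + 1) * (M ^ (κ - 1)) ^ n ≤ M ^ (κ * M) * Real.exp 1 ^ (n + 1) := by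
    have : M ^ (n + 1) * (M ^ (κ - 1)) ^ n = M ^ (κ * M) * M ^ (1 - κ) := by
      rw [← Real.rpow_natCast, ← Real.rpow_natCast, ← Real.rpow_mul hM0.le, ← Real.rpow_add hM0,
        ← Real.rpow_add hM0, hnM, ← hM]
      congr 1; ring
    rw [this]
    refine mul_le_mul_of_nonneg_left (le_trans ?_ e5) (by positivity)
    calc M ^ (1 - κ) ≤ M ^ (1 : ℝ) := Real.rpow_le_rpow_of_exponent_le hM1 (by linarith)
      _ = M := Real.rpow_one M
  calc 2 * (C ^ (n + 1) * M ^ (α * θ * M) * A ^ n) * (freqConst d * h ^ (2 * α * γ * d)) ^ n *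
        Real.exp M * ((n + 1).factorial * (h * (Real.Gamma (1 - κ) * (M / h) ^ (κ - 1)) ^ n))
      = (2 * C ^ (n + 1) * Real.exp M * M ^ (α * θ * M) * A ^ n) *
          ((h ^ (2 * α * γ * d)) ^ n * (h * (h ^ (1 - κ)) ^ n)) *
          (freqConst d ^ n * Real.Gamma (1 - κ) ^ n) *
          (((n + 1).factorial : ℝ) * (M ^ (κ - 1)) ^ n) := by rw [e7]; ring
    _ ≤ (2 ^ (n + 1) * C ^ (n + 1) * Real.exp 1 ^ (n + 1) * M ^ (α * θ * M) * A ^ n) *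
          (h ^ (α * d + (1 - α * d) * M)) * (Q ^ (n + 1) * Γ' ^ (n + 1)) *
          (M ^ (κ * M) * Real.exp 1 ^ (n + 1)) := by
        rw [e8, e4]
        have e10 : ((n + 1).factorial : ℝ) * (M ^ (κ - 1)) ^ n ≤
            M ^ (κ * M) * Real.exp 1 ^ (n + 1) :=
          (mul_le_mul_of_nonneg_right e1 (by positivity)).trans e9
        gcongr
    _ = (2 * C * Q * Γ' * Real.exp 1 ^ 2) ^ (n + 1) * M ^ ((α * θ + κ) * M) *
          h ^ (α * d + (1 - α * d) * M) * A ^ n := by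
        rw [add_mul, Real.rpow_add hM0]; ring
    _ ≤ _ := by
        have : 2 * C * Q * Γ' * Real.exp 1 ^ 2 ≤ max 1 (2 * C * Q * Γ' * Real.exp 1 ^ 2) :=
          le_max_right _ _
        gcongr

end MomentBound

/-! ### Heat kernels as smoothing kernels of occupation measures -/

section HeatFourier

variable {d : ℕ}

lemma fourierKernel_heatKernel {ε : ℝ} (hε : 0 < ε) (c : ℝ) :
    FourierKernel (d := d) (fun u => Real.exp (-(Real.pi * ε) * ‖u‖ ^ 2)) (heatKernel ε) 1 c 0 where
  integrable_fourier := integrable_exp_neg_mul_sq_norm (by positivity)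
  eq_integral z := heatKernel_eq_integral hε z
  bound u := by
    simp only [prodWeight, Real.rpow_zero, Finset.prod_const_one, mul_one]
    rw [abs_of_pos (Real.exp_pos _), Real.exp_le_one_iff]
    have : 0 ≤ Real.pi * ε * ‖u‖ ^ 2 := by positivity
    linarith
  continuous := continuous_heatKernel ε
  integrable := integrable_heatKernel hε
  lintegral_le := by
    have h := lintegral_heatKernel hε (0 : EuclideanSpace ℝ (Fin d))
    simp only [zero_sub, heatKernel_neg] at h
    simp_rw [Real.enorm_eq_ofReal (heatKernel_nonneg hε _)]
    rw [h]; norm_num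

lemma abs_exp_sub_exp_le {γ t : ℝ} (hγ : 0 < γ) (hγ1 : γ ≤ 1) (ht : 0 ≤ t) :
    |Real.exp (-(3 / 2) * t ^ 2) - Real.exp (-(1 / 2) * t ^ 2)| ≤ t ^ γ := by
  have h1 : Real.exp (-(3 / 2) * t ^ 2) = Real.exp (-(1 / 2) * t ^ 2) * Real.exp (-t ^ 2) := by
    rw [← Real.exp_add]; congr 1; ring
  have h2 : Real.exp (-(1 / 2) * t ^ 2) ≤ 1 := Real.exp_le_one_iff.2 (by nlinarith [sq_nonneg t])
  have h3 : Real.exp (-t ^ 2) ≤ 1 := Real.exp_le_one_iff.2 (by nlinarith [sq_nonneg t])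
  have h4 := Real.add_one_le_exp (-t ^ 2)
  have h5 := Real.exp_pos (-t ^ 2)
  have h6 := Real.exp_pos (-(1 / 2) * t ^ 2)
  rw [h1, abs_sub_comm, abs_of_nonneg (by nlinarith)]
  rcases le_total t 1 with ht1 | ht1
  · rcases ht.eq_or_lt with rfl | ht0
    · simp [Real.zero_rpow hγ.ne']
    · have : t ^ (2 : ℝ) ≤ t ^ γ := Real.rpow_le_rpow_of_exponent_ge ht0 ht1 (by linarith)
      rw [Real.rpow_two] at this
      nlinarith
  · have : 1 ≤ t ^ γ := Real.one_le_rpow ht1 hγ.le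
    nlinarith

/-- The difference of two heat kernels at comparable scales `b` has a small constant `A` when `√b`
is small compared to `c`. -/
lemma fourierKernel_heatKernel_sub {b c γ : ℝ} (hb : 0 < b) (hc : 0 < c) (hγ : 0 < γ)
    (hγ1 : γ ≤ 1) :
    FourierKernel (d := d) (fun u => Real.exp (-(Real.pi * (3 * b)) * ‖u‖ ^ 2) -
        Real.exp (-(Real.pi * b) * ‖u‖ ^ 2))
      (fun z => heatKernel (3 * b) z - heatKernel b z) ((√(2 * Real.pi * b) / c) ^ γ) c γ where
  integrable_fourier := (integrable_exp_neg_mul_sq_norm (by positivity)).sub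
    (integrable_exp_neg_mul_sq_norm (by positivity))
  eq_integral z := by
    have h1 := fourierKernel_heatKernel (d := d) (ε := 3 * b) (by positivity) 0
    have h2 := fourierKernel_heatKernel (d := d) hb 0
    have hint : ∀ ε : ℝ, 0 < ε → Integrable fun u : EuclideanSpace ℝ (Fin d) =>
        (Real.exp (-(Real.pi * ε) * ‖u‖ ^ 2) : ℂ) *
        Complex.exp (2 * Real.pi * Complex.I * (inner ℝ z u : ℝ)) := by
      intro ε hε
      refine Integrable.mul_bdd (c := 1)
        (integrable_exp_neg_mul_sq_norm (b := Real.pi * ε) (by positivity)).ofReal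
        (by fun_prop) (ae_of_all _ fun u => ?_)
      rw [show (2 * Real.pi * Complex.I * (inner ℝ z u : ℝ) : ℂ) =
        ((2 * Real.pi * inner ℝ z u : ℝ) : ℂ) * Complex.I by push_cast; ring,
        Complex.norm_exp_ofReal_mul_I]
    rw [Complex.ofReal_sub, h1.eq_integral, h2.eq_integral,
      ← integral_sub (hint _ (by positivity)) (hint _ hb)]
    refine integral_congr_ae (ae_of_all _ fun u => ?_)
    simp only
    rw [Complex.ofReal_sub]; ring
  bound u := by
    have ht : 0 ≤ √(2 * Real.pi * b) * ‖u‖ := by positivity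
    have h1 := abs_exp_sub_exp_le hγ hγ1 ht
    rw [mul_pow, Real.sq_sqrt (by positivity)] at h1
    rw [show -(Real.pi * (3 * b)) * ‖u‖ ^ 2 = -(3 / 2) * (2 * Real.pi * b * ‖u‖ ^ 2) by ring,
      show -(Real.pi * b) * ‖u‖ ^ 2 = -(1 / 2) * (2 * Real.pi * b * ‖u‖ ^ 2) by ring]
    refine h1.trans ?_
    rw [show √(2 * Real.pi * b) * ‖u‖ = √(2 * Real.pi * b) / c * (c * ‖u‖) by field_simp,
      Real.mul_rpow (by positivity) (by positivity)]
    refine mul_le_mul_of_nonneg_left ?_ (by positivity)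
    unfold prodWeight
    rw [Real.finsetProd_rpow _ _ fun l _ => by positivity]
    exact Real.rpow_le_rpow (by positivity) (mul_norm_le_prod_one_add hc.le u) hγ.le
  continuous := (continuous_heatKernel _).sub (continuous_heatKernel _)
  integrable := (integrable_heatKernel (by positivity)).sub (integrable_heatKernel hb)
  lintegral_le := by
    have h : ∀ ε : ℝ, 0 < ε →
        ∫⁻ z : EuclideanSpace ℝ (Fin d), ‖heatKernel ε z‖ₑ = 1 := by
      intro ε hε
      have h := lintegral_heatKernel hε (0 : EuclideanSpace ℝ (Fin d))
      simp only [zero_sub, heatKernel_neg] at h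
      simp_rw [Real.enorm_eq_ofReal (heatKernel_nonneg hε _)]
      rw [h]
    refine (lintegral_mono fun z => enorm_sub_le).trans ?_
    rw [lintegral_add_left (continuous_heatKernel _).measurable.enorm, h _ (by positivity), h _ hb]
    norm_num

end HeatFourier

section Smoothing

variable {V : Type*} [NormedAddCommGroup V] [InnerProductSpace ℝ V] {y : ℝ → V}

lemma occupationConv_heatKernel_nonneg {ε : ℝ} (hε : 0 < ε) (a b : ℝ) (x : V) :
    0 ≤ occupationConv (heatKernel ε) y a b x :=
  integral_nonneg fun _ => heatKernel_nonneg hε _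

variable [FiniteDimensional ℝ V] [MeasurableSpace V] [BorelSpace V]

lemma integrableOn_heatKernel_comp (hy : Measurable y) {ε : ℝ} (hε : 0 < ε) (a b : ℝ) (x : V) :
    IntegrableOn (fun s => heatKernel ε (x - y s)) (Icc a b) := by
  refine Measure.integrableOn_of_bounded (M := ε ^ (-(Module.finrank ℝ V / 2 : ℝ)))
    measure_Icc_lt_top.ne ?_ (ae_of_all _ fun s => ?_)
  · exact ((continuous_heatKernel ε).measurable.comp
      (measurable_const.sub hy)).aestronglyMeasurable
  · rw [Real.norm_of_nonneg (heatKernel_nonneg hε _)]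
    exact heatKernel_le hε _

lemma occupationConv_heatKernel_le_const (hy : Measurable y) {ε : ℝ} (hε : 0 < ε) (a b : ℝ)
    (x : V) :
    occupationConv (heatKernel ε) y a b x ≤
      (volume (Icc a b)).toReal * ε ^ (-(Module.finrank ℝ V / 2 : ℝ)) := by
  have h := setIntegral_mono_on (integrableOn_heatKernel_comp hy hε a b x)
    (integrableOn_const measure_Icc_lt_top.ne) measurableSet_Icc
    (fun s _ => heatKernel_le hε (x - y s))
  refine h.trans (le_of_eq ?_)
  simp [Measure.real]

lemma continuous_occupationConv_heatKernel (hy : Measurable y) {ε : ℝ} (hε : 0 < ε) (a b : ℝ) :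
    Continuous (occupationConv (heatKernel ε) y a b) := by
  refine continuous_of_dominated (bound := fun _ => ε ^ (-(Module.finrank ℝ V / 2 : ℝ)))
    (fun x => (integrableOn_heatKernel_comp hy hε a b x).aestronglyMeasurable)
    (fun x => ae_of_all _ fun s => ?_) (integrable_const _) (ae_of_all _ fun s => ?_)
  · rw [Real.norm_of_nonneg (heatKernel_nonneg hε _)]
    exact heatKernel_le hε _
  · exact (continuous_heatKernel ε).comp (continuous_id.sub continuous_const)

/-- The semigroup property, for smoothed occupation densities. -/
lemma occupationConv_heatKernel_add (hy : Measurable y) {ε δ : ℝ} (hε : 0 < ε) (hδ : 0 < δ)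
    (a b : ℝ) (x : V) :
    occupationConv (heatKernel (ε + δ)) y a b x =
      ∫ z, heatKernel δ (x - z) * occupationConv (heatKernel ε) y a b z := by
  unfold occupationConv
  simp_rw [← integral_const_mul]
  rw [integral_integral_swap]
  · refine integral_congr_ae (ae_of_all _ fun s => ?_)
    exact (integral_heatKernel_mul_heatKernel hε hδ x (y s)).symm
  · refine Integrable.mul_bdd (c := ε ^ (-(Module.finrank ℝ V / 2 : ℝ)))
      (((integrable_heatKernel hδ).comp_sub_left x).comp_fst _) ?_ (ae_of_all _ fun q => ?_)
    · exact ((continuous_heatKernel ε).measurable.comp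
        (measurable_fst.sub (hy.comp measurable_snd))).aestronglyMeasurable
    · rw [Real.norm_of_nonneg (heatKernel_nonneg hε _)]
      exact heatKernel_le hε _

lemma integrable_heatKernel_mul_occupationConv (hy : Measurable y) {ε δ : ℝ} (hε : 0 < ε)
    (hδ : 0 < δ) (a b : ℝ) (x : V) :
    Integrable fun z => heatKernel δ (x - z) * occupationConv (heatKernel ε) y a b z := by
  refine Integrable.mul_bdd (c := (volume (Icc a b)).toReal *
    ε ^ (-(Module.finrank ℝ V / 2 : ℝ))) ((integrable_heatKernel hδ).comp_sub_left x)
    (continuous_occupationConv_heatKernel hy hε a b).aestronglyMeasurable (ae_of_all _ fun z => ?_)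
  rw [Real.norm_of_nonneg (occupationConv_heatKernel_nonneg hε _ _ _)]
  exact occupationConv_heatKernel_le_const hy hε a b z

/-- Further smoothing does not increase the supremum. -/
lemma occupationConv_heatKernel_add_le (hy : Measurable y) {ε δ : ℝ} (hε : 0 < ε) (hδ : 0 < δ)
    (a b : ℝ) {c : ℝ} (hc : ∀ z, occupationConv (heatKernel ε) y a b z ≤ c) (x : V) :
    occupationConv (heatKernel (ε + δ)) y a b x ≤ c := by
  rw [occupationConv_heatKernel_add hy hε hδ]
  have h1 : Integrable fun z : V => heatKernel δ (x - z) :=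
    (integrable_heatKernel hδ).comp_sub_left x
  calc ∫ z, heatKernel δ (x - z) * occupationConv (heatKernel ε) y a b z
      ≤ ∫ z, heatKernel δ (x - z) * c :=
        integral_mono (integrable_heatKernel_mul_occupationConv hy hε hδ a b x) (h1.mul_const c)
          fun z => mul_le_mul_of_nonneg_left (hc z) (heatKernel_nonneg hδ _)
    _ = c := by
        rw [integral_mul_const, integral_sub_left_eq_self (fun z => heatKernel δ z),
          integral_heatKernel hδ, one_mul]

lemma occupationConv_heatKernel_sub (hy : Measurable y) {ε δ : ℝ} (hε : 0 < ε) (hδ : 0 < δ)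
    (a b : ℝ) (x : V) :
    occupationConv (fun z => heatKernel ε z - heatKernel δ z) y a b x =
      occupationConv (heatKernel ε) y a b x - occupationConv (heatKernel δ) y a b x :=
  integral_sub (integrableOn_heatKernel_comp hy hε a b x)
    (integrableOn_heatKernel_comp hy hδ a b x)

/-- Averaging against a heat kernel turns an `L^m` norm into a supremum norm. -/
lemma enorm_integral_heatKernel_mul_pow_le {δ : ℝ} (hδ : 0 < δ) {g : V → ℝ} (hg : Measurable g)
    {m : ℕ} (hm : 1 ≤ m) (hme : Even m) (x : V) :
    ‖∫ z, heatKernel δ (x - z) * g z‖ₑ ^ m ≤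
      ENNReal.ofReal (δ ^ (-(Module.finrank ℝ V / 2 : ℝ))) * ∫⁻ z, ENNReal.ofReal (g z ^ m) := by
  set w : V → ℝ≥0∞ := fun z => ENNReal.ofReal (heatKernel δ (x - z)) with hw
  have hwm : Measurable w :=
    ((continuous_heatKernel δ).measurable.comp (measurable_const.sub measurable_id)).ennreal_ofReal
  set ν : Measure V := volume.withDensity w with hν
  have hprob : IsProbabilityMeasure ν := ⟨by
    rw [hν, withDensity_apply _ MeasurableSet.univ, Measure.restrict_univ]
    exact lintegral_heatKernel hδ x⟩
  have h1 : ‖∫ z, heatKernel δ (x - z) * g z‖ₑ ≤ ∫⁻ z, ‖g z‖ₑ ∂ν := by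
    rw [hν, lintegral_withDensity_eq_lintegral_mul _ hwm hg.enorm]
    refine (enorm_integral_le_lintegral_enorm _).trans (le_of_eq ?_)
    refine lintegral_congr fun z => ?_
    rw [enorm_mul, Real.enorm_eq_ofReal (heatKernel_nonneg hδ _), Pi.mul_apply]
  have hm1 : (1 : ℝ) ≤ m := by exact_mod_cast hm
  have h2 : (∫⁻ z, ‖g z‖ₑ ∂ν) ^ m ≤ ∫⁻ z, ‖g z‖ₑ ^ m ∂ν := by
    have h3 := eLpNorm'_le_eLpNorm'_of_exponent_le (p := 1) (q := m) one_pos hm1 ν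
      hg.aestronglyMeasurable
    simp only [eLpNorm', ENNReal.rpow_one, div_one, ENNReal.rpow_natCast] at h3
    have h4 := pow_le_pow_left' h3 m
    rwa [← ENNReal.rpow_natCast (_ ^ _), ← ENNReal.rpow_mul, one_div,
      inv_mul_cancel₀ (by positivity), ENNReal.rpow_one] at h4
  refine (pow_le_pow_left' h1 m).trans (h2.trans ?_)
  rw [hν, lintegral_withDensity_eq_lintegral_mul _ hwm (hg.enorm.pow_const m),
    ← lintegral_const_mul _ (hg.pow_const m).ennreal_ofReal]
  refine lintegral_mono fun z => ?_
  rw [Pi.mul_apply, ← ofReal_norm, ← ENNReal.ofReal_pow (norm_nonneg _), Real.norm_eq_abs,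
    hme.pow_abs]
  exact mul_le_mul' (ENNReal.ofReal_le_ofReal (heatKernel_le hδ _)) le_rfl

end Smoothing

/-! ### Supremum bounds for smoothed occupation densities -/

section SupBounds

/-- The supremum over space, and over the dyadic smoothing scales `2 ^ (-k)`, of the smoothed
occupation densities of the path `y` on `[a, b]`. It bounds the supremum of the local time on
`[a, b]`. -/
noncomputable def densitySup {V : Type*} [NormedAddCommGroup V] [InnerProductSpace ℝ V] (y : ℝ → V)
    (a b : ℝ) : ℝ≥0∞ :=
  ⨆ k : ℕ, ⨆ x, ENNReal.ofReal (occupationConv (heatKernel ((1 / 2) ^ k)) y a b x)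

variable {V : Type*} [NormedAddCommGroup V] [InnerProductSpace ℝ V] [FiniteDimensional ℝ V]
  [MeasurableSpace V] [BorelSpace V] {y : ℝ → V}

lemma ENNReal.le_rpow_inv_of_pow_le {m : ℕ} (hm : 1 ≤ m) {x c : ℝ≥0∞} (h : x ^ m ≤ c) :
    x ≤ c ^ ((m : ℝ)⁻¹) := by
  rw [← ENNReal.pow_le_pow_left_iff (n := m) (by omega), ENNReal.rpow_inv_natCast_pow (by omega)]
  exact h

lemma ENNReal.add_pow_le_two_pow_mul (p q : ℝ≥0∞) (m : ℕ) :
    (p + q) ^ m ≤ 2 ^ m * (p ^ m + q ^ m) := by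
  rcases le_total p q with h | h
  · refine (pow_le_pow_left' (add_le_add_left h q) m).trans ?_
    rw [← two_mul, mul_pow]
    exact mul_le_mul' le_rfl le_add_self
  · refine (pow_le_pow_left' (add_le_add_right h p) m).trans ?_
    rw [← two_mul, mul_pow]
    exact mul_le_mul' le_rfl le_self_add

/-- Half of the smoothing turns the supremum into an `L^m` norm of the density at half the scale. -/
lemma ofReal_occupationConv_pow_le (hy : Measurable y) (a b : ℝ) {m : ℕ} (hm : 1 ≤ m) (hme : Even m)
    (k : ℕ) (x : V) :
    ENNReal.ofReal (occupationConv (heatKernel ((1 / 2) ^ k)) y a b x) ^ m ≤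
      ENNReal.ofReal (((1 / 2) ^ (k + 1)) ^ (-(Module.finrank ℝ V / 2 : ℝ))) *
        ∫⁻ z, ENNReal.ofReal (occupationConv (heatKernel ((1 / 2) ^ (k + 1))) y a b z ^ m) := by
  have hε : (0 : ℝ) < (1 / 2) ^ (k + 1) := by positivity
  rw [show ((1 : ℝ) / 2) ^ k = (1 / 2) ^ (k + 1) + (1 / 2) ^ (k + 1) by rw [pow_succ]; ring]
  rw [← Real.enorm_eq_ofReal (occupationConv_heatKernel_nonneg (by positivity) _ _ _),
    occupationConv_heatKernel_add hy hε hε]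
  exact enorm_integral_heatKernel_mul_pow_le hε
    (continuous_occupationConv_heatKernel hy hε a b).measurable hm hme x

/-- The increment between two consecutive scales is a smoothed difference of heat kernels. -/
lemma enorm_occupationConv_sub_pow_le (hy : Measurable y) (a b : ℝ) {m : ℕ} (hm : 1 ≤ m)
    (hme : Even m) (k : ℕ) (x : V) :
    ‖occupationConv (heatKernel ((1 / 2) ^ k)) y a b x -
        occupationConv (heatKernel ((1 / 2) ^ (k + 1))) y a b x‖ₑ ^ m ≤
      ENNReal.ofReal (((1 / 2) ^ (k + 2)) ^ (-(Module.finrank ℝ V / 2 : ℝ))) *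
        ∫⁻ z, ENNReal.ofReal (occupationConv (fun z => heatKernel (3 * (1 / 2) ^ (k + 2)) z -
          heatKernel ((1 / 2) ^ (k + 2)) z) y a b z ^ m) := by
  have hε : (0 : ℝ) < (1 / 2) ^ (k + 2) := by positivity
  have h3 : (0 : ℝ) < 3 * (1 / 2) ^ (k + 2) := by positivity
  have hg : occupationConv (fun z => heatKernel (3 * (1 / 2) ^ (k + 2)) z -
      heatKernel ((1 / 2) ^ (k + 2)) z) y a b = fun z =>
      occupationConv (heatKernel (3 * (1 / 2) ^ (k + 2))) y a b z -
      occupationConv (heatKernel ((1 / 2) ^ (k + 2))) y a b z :=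
    funext fun z => occupationConv_heatKernel_sub hy h3 hε a b z
  rw [show ((1 : ℝ) / 2) ^ k = 3 * (1 / 2) ^ (k + 2) + (1 / 2) ^ (k + 2) by rw [pow_add]; ring,
    show ((1 : ℝ) / 2) ^ (k + 1) = (1 / 2) ^ (k + 2) + (1 / 2) ^ (k + 2) by
      rw [pow_add, pow_add]; ring,
    occupationConv_heatKernel_add hy h3 hε, occupationConv_heatKernel_add hy hε hε,
    ← integral_sub (integrable_heatKernel_mul_occupationConv hy h3 hε a b x)
      (integrable_heatKernel_mul_occupationConv hy hε hε a b x), hg]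
  simp_rw [← mul_sub]
  exact enorm_integral_heatKernel_mul_pow_le hε
    ((continuous_occupationConv_heatKernel hy h3 a b).sub
      (continuous_occupationConv_heatKernel hy hε a b)).measurable hm hme x

/-- Weighted form of the bounds on the increments between consecutive scales. -/
lemma enorm_occupationConv_sub_le (hy : Measurable y) (a b : ℝ) {m : ℕ} (hm : 1 ≤ m)
    (hme : Even m) (k₀ : ℕ) {ρ : ℕ → ℝ≥0∞} (hρ0 : ∀ i, ρ i ≠ 0) (hρt : ∀ i, ρ i ≠ ∞) (i : ℕ)
    (x : V) :
    ‖occupationConv (heatKernel ((1 / 2) ^ (k₀ + i))) y a b x -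
        occupationConv (heatKernel ((1 / 2) ^ (k₀ + i + 1))) y a b x‖ₑ ≤
      ρ i * (∑' i, (ρ i ^ m)⁻¹ *
          (ENNReal.ofReal (((1 / 2) ^ (k₀ + i + 2)) ^ (-(Module.finrank ℝ V / 2 : ℝ))) *
          (∫⁻ z, ENNReal.ofReal (occupationConv
            (fun z => heatKernel (3 * (1 / 2) ^ (k₀ + i + 2)) z -
              heatKernel ((1 / 2) ^ (k₀ + i + 2)) z) y a b z ^ m)))) ^ ((m : ℝ)⁻¹) := by
  have h1 := enorm_occupationConv_sub_pow_le hy a b hm hme (k₀ + i) x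
  rw [← ENNReal.pow_le_pow_left_iff (n := m) (by omega), mul_pow,
    ENNReal.rpow_inv_natCast_pow (by omega)]
  refine h1.trans ?_
  rw [mul_comm (ρ i ^ m), ← ENNReal.div_le_iff (pow_ne_zero _ (hρ0 i)) (ENNReal.pow_ne_top (hρt i)),
    div_eq_mul_inv, mul_comm _ (ρ i ^ m)⁻¹]
  exact ENNReal.le_tsum (f := fun i => (ρ i ^ m)⁻¹ *
          (ENNReal.ofReal (((1 / 2) ^ (k₀ + i + 2)) ^ (-(Module.finrank ℝ V / 2 : ℝ))) *
          (∫⁻ z, ENNReal.ofReal (occupationConv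
            (fun z => heatKernel (3 * (1 / 2) ^ (k₀ + i + 2)) z -
              heatKernel ((1 / 2) ^ (k₀ + i + 2)) z) y a b z ^ m)))) i

/-- The pathwise bound behind the chaining: the scale `k₀` and the increments between consecutive
smaller scales are controlled by `m`-th powers of `L^m` norms. -/
lemma densitySup_pow_le (hy : Measurable y) (a b : ℝ) {m : ℕ} (hm : 1 ≤ m) (hme : Even m) (k₀ : ℕ)
    {ρ : ℕ → ℝ≥0∞} (hρ0 : ∀ i, ρ i ≠ 0) (hρt : ∀ i, ρ i ≠ ∞) :
    densitySup y a b ^ m ≤ 2 ^ m *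
      (ENNReal.ofReal (((1 / 2) ^ (k₀ + 1)) ^ (-(Module.finrank ℝ V / 2 : ℝ))) *
          (∫⁻ z, ENNReal.ofReal (occupationConv (heatKernel ((1 / 2) ^ (k₀ + 1))) y a b z ^ m)) +
        (∑' i, ρ i) ^ m * ∑' i, (ρ i ^ m)⁻¹ *
          (ENNReal.ofReal (((1 / 2) ^ (k₀ + i + 2)) ^ (-(Module.finrank ℝ V / 2 : ℝ))) *
          (∫⁻ z, ENNReal.ofReal (occupationConv
            (fun z => heatKernel (3 * (1 / 2) ^ (k₀ + i + 2)) z -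
              heatKernel ((1 / 2) ^ (k₀ + i + 2)) z) y a b z ^ m)))) := by
  have hstep := fun i x => enorm_occupationConv_sub_le hy a b hm hme k₀ hρ0 hρt i x
  have hbase := fun x => ofReal_occupationConv_pow_le hy a b hm hme k₀ x
  set B := ENNReal.ofReal (((1 / 2) ^ (k₀ + 1)) ^ (-(Module.finrank ℝ V / 2 : ℝ))) *
    (∫⁻ z, ENNReal.ofReal (occupationConv (heatKernel ((1 / 2) ^ (k₀ + 1))) y a b z ^ m))
  set S := ∑' i, (ρ i ^ m)⁻¹ *
          (ENNReal.ofReal (((1 / 2) ^ (k₀ + i + 2)) ^ (-(Module.finrank ℝ V / 2 : ℝ))) *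
          (∫⁻ z, ENNReal.ofReal (occupationConv
            (fun z => heatKernel (3 * (1 / 2) ^ (k₀ + i + 2)) z -
              heatKernel ((1 / 2) ^ (k₀ + i + 2)) z) y a b z ^ m)))
  by_cases hB : B = ∞
  · rw [hB, top_add, ENNReal.mul_top (by simp)]; exact le_top
  have hbase' : ∀ x, ENNReal.ofReal (occupationConv (heatKernel ((1 / 2) ^ k₀)) y a b x) ≤
      B ^ ((m : ℝ)⁻¹) := fun x => ENNReal.le_rpow_inv_of_pow_le hm (hbase x)
  have hBt : B ^ ((m : ℝ)⁻¹) ≠ ∞ := ENNReal.rpow_ne_top_of_nonneg (by positivity) hB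
  have hfine : ∀ i x, ENNReal.ofReal (occupationConv (heatKernel ((1 / 2) ^ (k₀ + i))) y a b x) ≤
      B ^ ((m : ℝ)⁻¹) + (∑ j ∈ Finset.range i, ρ j) * S ^ ((m : ℝ)⁻¹) := by
    intro i x
    induction i with
    | zero => simpa using hbase' x
    | succ i ih =>
      have h1 : ENNReal.ofReal (occupationConv (heatKernel ((1 / 2) ^ (k₀ + i + 1))) y a b x) ≤
          ENNReal.ofReal (occupationConv (heatKernel ((1 / 2) ^ (k₀ + i))) y a b x) +
          ‖occupationConv (heatKernel ((1 / 2) ^ (k₀ + i))) y a b x -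
            occupationConv (heatKernel ((1 / 2) ^ (k₀ + i + 1))) y a b x‖ₑ := by
        rw [← ofReal_norm, ← ENNReal.ofReal_add
          (occupationConv_heatKernel_nonneg (by positivity) _ _ _) (norm_nonneg _)]
        refine ENNReal.ofReal_le_ofReal ?_
        rw [Real.norm_eq_abs]
        linarith [neg_abs_le (occupationConv (heatKernel ((1 / 2) ^ (k₀ + i))) y a b x -
            occupationConv (heatKernel ((1 / 2) ^ (k₀ + i + 1))) y a b x)]
      rw [← add_assoc k₀ i 1]
      refine h1.trans ((add_le_add ih (hstep i x)).trans (le_of_eq ?_))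
      rw [Finset.sum_range_succ, add_mul, add_assoc]
  have hsup : densitySup y a b ≤ B ^ ((m : ℝ)⁻¹) + (∑' i, ρ i) * S ^ ((m : ℝ)⁻¹) := by
    refine iSup_le fun k => iSup_le fun x => ?_
    rcases le_or_gt k₀ k with h | h
    · obtain ⟨i, rfl⟩ := Nat.exists_eq_add_of_le h
      exact (hfine i x).trans (add_le_add le_rfl (mul_le_mul' (ENNReal.sum_le_tsum _) le_rfl))
    · refine le_trans ?_ le_self_add
      rw [← ENNReal.ofReal_toReal hBt]
      refine ENNReal.ofReal_le_ofReal ?_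
      -- Scales coarser than `k₀` are dominated by the scale `k₀`.
      have hlt : ((1 : ℝ) / 2) ^ k₀ < (1 / 2) ^ k :=
        pow_lt_pow_right_of_lt_one₀ (by norm_num) (by norm_num) h
      have h2 := occupationConv_heatKernel_add_le hy (ε := (1 / 2) ^ k₀)
        (δ := (1 / 2) ^ k - (1 / 2) ^ k₀) (by positivity) (sub_pos.2 hlt) a b
        (c := (B ^ ((m : ℝ)⁻¹)).toReal)
        (fun z => (ENNReal.ofReal_le_iff_le_toReal hBt).1 (hbase' z)) x
      rwa [add_sub_cancel] at h2
  refine (pow_le_pow_left' hsup m).trans ((ENNReal.add_pow_le_two_pow_mul _ _ m).trans ?_)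
  rw [mul_pow, ENNReal.rpow_inv_natCast_pow (by omega), ENNReal.rpow_inv_natCast_pow (by omega)]

end SupBounds

section ScaleEstimates

/-- The contribution of one scale: with `√b ≤ h ^ α M ^ (-4αD) x`, the gain `x ^ (γ M / 2)` is left,
and the power of `M` drops from the exponent `αθ + αD (1 + 2γ)` to `α (D + θ)`. -/
lemma fine_scale_bound {α θ γ h b x D K : ℝ} {m : ℕ} (hα : 0 < α) (hγ : 0 < γ) (hγ1 : γ ≤ 1)
    (hD : 0 ≤ D) (hh : 0 < h) (hb : 0 < b) (hK : 0 ≤ K) (hm : 1 ≤ m) (hx : 0 < x) (hx1 : x ≤ 1)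
    (hbx : √b ≤ h ^ α * (m : ℝ) ^ (-(4 * α * D)) * x) (hmγ : γ * m / 2 ≤ γ * (m - 1) - D) :
    b ^ (-(D / 2)) * (K ^ m * (m : ℝ) ^ ((α * θ + α * D * (1 + 2 * γ)) * m) *
        h ^ (α * D + (1 - α * D) * m) * ((√(2 * Real.pi * b) / h ^ α) ^ γ) ^ (m - 1)) ≤
      (2 * Real.pi * K * ((m : ℝ) ^ (α * (D + θ)) * h ^ (1 - α * D))) ^ m * x ^ (γ * m / 2) := by
  obtain ⟨n, rfl⟩ : ∃ n, m = n + 1 := ⟨m - 1, by omega⟩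
  set M : ℝ := ((n + 1 : ℕ) : ℝ) with hM
  have hM1 : 1 ≤ M := by rw [hM]; exact_mod_cast hm
  have hM0 : 0 < M := by linarith
  have hnM : (n : ℝ) = M - 1 := by rw [hM]; push_cast; ring
  have hha : 0 < h ^ α := Real.rpow_pos_of_pos hh α
  set δ := √b / h ^ α with hδ
  have hδ0 : 0 < δ := by positivity
  have hδx : δ ≤ M ^ (-(4 * α * D)) * x := by
    rw [hδ, div_le_iff₀ hha]; linarith
  have hMQ : M ^ (-(4 * α * D)) ≤ 1 := by
    rw [← Real.rpow_zero M]
    exact Real.rpow_le_rpow_of_exponent_le hM1 (by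
      have : 0 ≤ 4 * α * D := by positivity
      linarith)
  have hδ1 : δ ≤ 1 := hδx.trans (mul_le_one₀ hMQ hx.le hx1)
  have e1 : b ^ (-(D / 2)) = δ ^ (-D) * h ^ (-(α * D)) := by
    have : b = (δ * h ^ α) ^ 2 := by rw [hδ, div_mul_cancel₀ _ hha.ne', Real.sq_sqrt hb.le]
    rw [this, ← Real.rpow_natCast, ← Real.rpow_mul (by positivity), Real.mul_rpow hδ0.le hha.le,
      ← Real.rpow_mul hh.le]
    congr 2 <;> push_cast <;> ring
  have e2 : ((√(2 * Real.pi * b) / h ^ α) ^ γ) ^ n ≤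
      (2 * Real.pi) ^ (n + 1) * δ ^ (γ * (M - 1)) := by
    rw [Real.sqrt_mul (by positivity), mul_div_assoc, ← hδ, ← Real.rpow_natCast,
      ← Real.rpow_mul (by positivity), Real.mul_rpow (by positivity) hδ0.le, hnM]
    refine mul_le_mul_of_nonneg_right ?_ (by positivity)
    have h2π : (1 : ℝ) ≤ 2 * Real.pi := by linarith [Real.pi_gt_three]
    rw [Real.sqrt_eq_rpow, ← Real.rpow_mul (by positivity), ← Real.rpow_natCast]
    refine Real.rpow_le_rpow_of_exponent_le h2π ?_
    rw [← hM]
    nlinarith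
  have e3 : δ ^ (-D) * δ ^ (γ * (M - 1)) ≤ M ^ (-(2 * α * D * γ * M)) * x ^ (γ * M / 2) := by
    rw [← Real.rpow_add hδ0]
    calc δ ^ (-D + γ * (M - 1)) ≤ δ ^ (γ * M / 2) :=
          Real.rpow_le_rpow_of_exponent_ge hδ0 hδ1 (by linarith)
      _ ≤ (M ^ (-(4 * α * D)) * x) ^ (γ * M / 2) :=
          Real.rpow_le_rpow hδ0.le hδx (by positivity)
      _ = _ := by
          rw [Real.mul_rpow (by positivity) hx.le, ← Real.rpow_mul hM0.le]
          congr 2; ring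
  have e4 : M ^ ((α * θ + α * D * (1 + 2 * γ)) * M) * M ^ (-(2 * α * D * γ * M)) =
      (M ^ (α * (D + θ))) ^ (n + 1) := by
    rw [← Real.rpow_natCast, ← Real.rpow_mul hM0.le, ← Real.rpow_add hM0, ← hM]
    congr 1; ring
  have e5 : h ^ (-(α * D)) * h ^ (α * D + (1 - α * D) * M) = (h ^ (1 - α * D)) ^ (n + 1) := by
    rw [← Real.rpow_natCast, ← Real.rpow_mul hh.le, ← Real.rpow_add hh, ← hM]
    congr 1; ring
  rw [Nat.add_sub_cancel, e1]
  calc δ ^ (-D) * h ^ (-(α * D)) * (K ^ (n + 1) * M ^ ((α * θ + α * D * (1 + 2 * γ)) * M) *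
        h ^ (α * D + (1 - α * D) * M) * ((√(2 * Real.pi * b) / h ^ α) ^ γ) ^ n)
      ≤ δ ^ (-D) * h ^ (-(α * D)) * (K ^ (n + 1) * M ^ ((α * θ + α * D * (1 + 2 * γ)) * M) *
        h ^ (α * D + (1 - α * D) * M) * ((2 * Real.pi) ^ (n + 1) * δ ^ (γ * (M - 1)))) := by gcongr
    _ = (2 * Real.pi) ^ (n + 1) * K ^ (n + 1) * (h ^ (-(α * D)) * h ^ (α * D + (1 - α * D) * M)) *
        M ^ ((α * θ + α * D * (1 + 2 * γ)) * M) * (δ ^ (-D) * δ ^ (γ * (M - 1))) := by ring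
    _ ≤ (2 * Real.pi) ^ (n + 1) * K ^ (n + 1) * (h ^ (-(α * D)) * h ^ (α * D + (1 - α * D) * M)) *
        M ^ ((α * θ + α * D * (1 + 2 * γ)) * M) *
        (M ^ (-(2 * α * D * γ * M)) * x ^ (γ * M / 2)) := by gcongr
    _ = (2 * Real.pi) ^ (n + 1) * K ^ (n + 1) * (h ^ (-(α * D)) * h ^ (α * D + (1 - α * D) * M)) *
        (M ^ ((α * θ + α * D * (1 + 2 * γ)) * M) * M ^ (-(2 * α * D * γ * M))) *
        x ^ (γ * M / 2) := by ring
    _ = _ := by rw [e4, e5, mul_pow, mul_pow, mul_pow]; ring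

/-- The contribution of the coarsest scale. -/
lemma coarse_scale_bound {α θ h H b D K : ℝ} {m : ℕ} (hα : 0 < α)
    (hD : 0 ≤ D) (hh : 0 < h) (hH : 1 ≤ H) (hK : 0 ≤ K) (hm : 1 ≤ m)
    (hbx : (h / H) ^ (2 * α) * (m : ℝ) ^ (-(8 * α * D)) / 4 ≤ b) :
    b ^ (-(D / 2)) * (K ^ m * (m : ℝ) ^ ((α * θ + α * D) * m) * h ^ (α * D + (1 - α * D) * m)) ≤
      (2 ^ D * H ^ (α * D) * Real.exp (4 * α * D * D) * K *
        ((m : ℝ) ^ (α * (D + θ)) * h ^ (1 - α * D))) ^ m := by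
  set M : ℝ := (m : ℝ) with hM
  have hM1 : 1 ≤ M := by rw [hM]; exact_mod_cast hm
  have hM0 : 0 < M := by linarith
  have hH0 : 0 < H := by linarith
  have e1 : b ^ (-(D / 2)) ≤ 2 ^ D * H ^ (α * D) * h ^ (-(α * D)) * M ^ (4 * α * D * D) := by
    refine (Real.rpow_le_rpow_of_nonpos (by positivity) hbx (by linarith)).trans (le_of_eq ?_)
    rw [div_eq_mul_inv, Real.mul_rpow (by positivity) (by positivity),
      Real.mul_rpow (by positivity) (by positivity), ← Real.rpow_mul (by positivity),
      ← Real.rpow_mul (by positivity), Real.div_rpow hh.le hH0.le,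
      show (4 : ℝ)⁻¹ = 2 ^ (-2 : ℝ) by rw [Real.rpow_neg (by norm_num)]; norm_num,
      ← Real.rpow_mul (by norm_num), div_eq_mul_inv, ← Real.rpow_neg hH0.le]
    rw [show -(2 * α * -(D / 2)) = α * D by ring, show 2 * α * -(D / 2) = -(α * D) by ring,
      show -2 * -(D / 2) = D by ring, show -(8 * α * D) * -(D / 2) = 4 * α * D * D by ring]
    ring
  have e2 : M ^ (4 * α * D * D) ≤ Real.exp (4 * α * D * D) ^ m := by
    rw [← Real.exp_nat_mul, mul_comm (m : ℝ), Real.exp_mul, ← Real.exp_one_rpow (4 * α * D * D),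
      ← Real.rpow_mul (Real.exp_pos _).le, mul_comm (4 * α * D * D) (m : ℝ),
      Real.rpow_mul (Real.exp_pos _).le, Real.exp_one_rpow, ← hM]
    exact Real.rpow_le_rpow hM0.le (by linarith [Real.add_one_le_exp M]) (by positivity)
  have e3 : 2 ^ D * H ^ (α * D) ≤ (2 ^ D * H ^ (α * D)) ^ m := by
    refine le_self_pow₀ ?_ (by omega)
    exact one_le_mul_of_one_le_of_one_le (Real.one_le_rpow (by norm_num) hD)
      (Real.one_le_rpow hH (by positivity))
  have e4 : M ^ ((α * θ + α * D) * M) = (M ^ (α * (D + θ))) ^ m := by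
    rw [← Real.rpow_natCast, ← Real.rpow_mul hM0.le, ← hM]
    congr 1; ring
  have e5 : h ^ (-(α * D)) * h ^ (α * D + (1 - α * D) * M) = (h ^ (1 - α * D)) ^ m := by
    rw [← Real.rpow_natCast, ← Real.rpow_mul hh.le, ← Real.rpow_add hh, ← hM]
    congr 1; ring
  calc b ^ (-(D / 2)) * (K ^ m * M ^ ((α * θ + α * D) * M) * h ^ (α * D + (1 - α * D) * M))
      ≤ (2 ^ D * H ^ (α * D) * h ^ (-(α * D)) * M ^ (4 * α * D * D)) *
        (K ^ m * M ^ ((α * θ + α * D) * M) * h ^ (α * D + (1 - α * D) * M)) := by gcongr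
    _ = (2 ^ D * H ^ (α * D)) * M ^ (4 * α * D * D) * K ^ m * M ^ ((α * θ + α * D) * M) *
        (h ^ (-(α * D)) * h ^ (α * D + (1 - α * D) * M)) := by ring
    _ ≤ (2 ^ D * H ^ (α * D)) ^ m * Real.exp (4 * α * D * D) ^ m * K ^ m *
        (M ^ (α * (D + θ))) ^ m * (h ^ (1 - α * D)) ^ m := by
        rw [e4, e5]; gcongr
    _ = _ := by simp only [mul_pow]; ring

end ScaleEstimates

section MomentSup

variable {d : ℕ} {Ω : Type*} [MeasurableSpace Ω] {P : Measure Ω} [IsProbabilityMeasure P]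
  {T : ℝ} {Y : ℝ → Ω → EuclideanSpace ℝ (Fin d)} {α θ : ℝ}

lemma measurable_lintegral_occupationConv_pow (hYm : Measurable (Function.uncurry Y))
    {G : EuclideanSpace ℝ (Fin d) → ℝ} (hG : Measurable G) (a b : ℝ) (m : ℕ) :
    Measurable fun ω => ∫⁻ z, ENNReal.ofReal (occupationConv G (fun s => Y s ω) a b z ^ m) := by
  have h1 : Measurable fun q : (Ω × EuclideanSpace ℝ (Fin d)) × ℝ => (q.2, q.1.1) :=
    measurable_snd.prodMk (measurable_fst.comp measurable_fst)
  have h2 : StronglyMeasurable fun q : (Ω × EuclideanSpace ℝ (Fin d)) × ℝ =>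
      G (q.1.2 - Y q.2 q.1.1) :=
    (hG.comp ((measurable_snd.comp measurable_fst).sub (hYm.comp h1))).stronglyMeasurable
  have h3 : Measurable fun q : Ω × EuclideanSpace ℝ (Fin d) =>
      occupationConv G (fun s => Y s q.1) a b q.2 :=
    (h2.integral_prod_right' (ν := volume.restrict (Icc a b))).measurable
  exact (h3.pow_const m).ennreal_ofReal.lintegral_prod_right'

/-- The `m`-th moment of the supremum of the smoothed occupation densities on an interval of length
at most `h` is at most `(K m ^ (α (d + θ)) h ^ (1 - α d)) ^ m`. The supremum itself is replaced by a
measurable majorant `Z`, which also controls the increments between the dyadic smoothing scales. -/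
theorem exists_moment_densitySup_le {C H : ℝ} (hd : 1 ≤ d) (hα : 0 < α) (hαd : α * d < 1)
    (hC : 0 < C) (hY : IncrementBound P T Y α θ C)
    (hYm : Measurable (Function.uncurry Y)) (hH : 1 ≤ H) :
    ∃ K : ℝ, 1 ≤ K ∧ ∃ m₀ : ℕ, 1 ≤ m₀ ∧ ∀ a b h : ℝ, 0 ≤ a → b ≤ T → b - a ≤ h → 0 < h → h ≤ H →
      ∀ m : ℕ, m₀ ≤ m → Even m → ∃ Z : Ω → ℝ≥0∞, Measurable Z ∧
        ∫⁻ ω, Z ω ∂P ≤ ENNReal.ofReal (K * ((m : ℝ) ^ (α * (d + θ)) * h ^ (1 - α * d))) ^ m ∧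
        (∀ ω, densitySup (fun s => Y s ω) a b ^ m ≤ Z ω) ∧
        ∀ ω, Z ω ≠ ∞ → ∃ (k₀ : ℕ) (B : ℕ → ℝ), Summable B ∧ ∀ i x,
          |occupationConv (heatKernel ((1 / 2) ^ (k₀ + i))) (fun s => Y s ω) a b x -
            occupationConv (heatKernel ((1 / 2) ^ (k₀ + i + 1))) (fun s => Y s ω) a b x| ≤ B i := by
  have hd0 : (0 : ℝ) < d := by exact_mod_cast hd
  have hαd0 : 0 < α * d := by positivity
  set γ := min 1 ((1 - α * d) / (4 * (α * d))) with hγd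
  have hγ : 0 < γ := lt_min one_pos (div_pos (by linarith) (by positivity))
  have hγ1 : γ ≤ 1 := min_le_left _ _
  have hκ : α * d * (1 + 2 * γ) < 1 := by
    have h1 : γ ≤ (1 - α * d) / (4 * (α * d)) := min_le_right _ _
    rw [le_div_iff₀ (by positivity)] at h1
    nlinarith
  obtain ⟨K₁, hK₁, hmom₁⟩ := lintegral_occupationConv_pow_le hα hC hY hYm hγ.le hγ1 hκ
  obtain ⟨K₀, hK₀, hmom₀⟩ := lintegral_occupationConv_pow_le (γ := 0) hα hC hY hYm le_rfl
    zero_le_one (by simpa using hαd)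
  -- The increment at scale `k₀ + i` is allotted the share `q ^ i` of the total. Since the moments
  -- decay like `q ^ (2 i m)`, half of the decay pays for this share and the rest makes the series
  -- converge.
  set q : ℝ := (1 / 2) ^ (γ / 8) with hq
  have hq0 : 0 < q := by positivity
  have hq1 : q < 1 := Real.rpow_lt_one (by norm_num) (by norm_num) (by positivity)
  set R : ℝ := (1 - q)⁻¹ with hR
  have hR1 : 1 ≤ R := (one_le_inv₀ (by linarith)).2 (by linarith)
  set c₀ : ℝ := 2 ^ (d : ℝ) * H ^ (α * d) * Real.exp (4 * α * d * d) * K₀ with hc₀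
  set c₁ : ℝ := 2 * Real.pi * K₁ with hc₁
  have hc₀0 : 0 ≤ c₀ := by positivity
  have hc₁0 : 0 ≤ c₁ := by positivity
  refine ⟨max 1 (2 * (c₀ + R ^ 2 * c₁)), le_max_left _ _, max 1 ⌈2 + 2 * d / γ⌉₊, le_max_left _ _,
    ?_⟩
  intro a b h ha hbT hbh hh hhH m hm₀ hme
  have hm : 1 ≤ m := (le_max_left _ _).trans hm₀
  have hmγ : γ * m / 2 ≤ γ * (m - 1) - d := by
    have h1 : 2 + 2 * d / γ ≤ m := Nat.ceil_le.1 ((le_max_right _ _).trans hm₀)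
    have h2 : γ * (2 + 2 * d / γ) ≤ γ * m := mul_le_mul_of_nonneg_left h1 hγ.le
    have h3 : γ * (2 + 2 * d / γ) = 2 * γ + 2 * d := by field_simp
    linarith
  have hH0 : 0 < H := by linarith
  have hm0 : (0 : ℝ) < m := by exact_mod_cast hm
  have hm1 : (1 : ℝ) ≤ m := by exact_mod_cast hm
  -- The coarsest scale `(1 / 2) ^ k₀` is comparable to `h ^ (2α) m ^ (-8αd)`.
  set y₀ : ℝ := (h / H) ^ (2 * α) * (m : ℝ) ^ (-(8 * α * d)) with hy₀
  have hy₀0 : 0 < y₀ := by positivity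
  have hy₀1 : y₀ ≤ 1 := by
    refine mul_le_one₀ (Real.rpow_le_one (by positivity) ((div_le_one hH0).2 hhH) (by positivity))
      (by positivity) ?_
    rw [← Real.rpow_zero (m : ℝ)]
    exact Real.rpow_le_rpow_of_exponent_le hm1 (by
      have : 0 ≤ 8 * α * d := by positivity
      linarith)
  obtain ⟨k, hk1, hk2⟩ := exists_nat_pow_near_of_lt_one hy₀0 hy₀1 (show (0 : ℝ) < 1 / 2 by norm_num)
    (by norm_num)
  set k₀ := k + 1 with hk₀
  have hfin : (Module.finrank ℝ (EuclideanSpace ℝ (Fin d)) : ℝ) = d := by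
    rw [finrank_euclideanSpace_fin]
  set X : ℝ := (m : ℝ) ^ (α * (d + θ)) * h ^ (1 - α * d) with hX
  have hX0 : 0 < X := by positivity
  set ρ : ℕ → ℝ≥0∞ := fun i => ENNReal.ofReal (q ^ i) with hρ
  have hρ0 : ∀ i, ρ i ≠ 0 := fun i => by simp only [hρ]; positivity
  have hρt : ∀ i, ρ i ≠ ∞ := fun i => ENNReal.ofReal_ne_top
  have hρsum : ∑' i, ρ i = ENNReal.ofReal R := by
    rw [← ENNReal.ofReal_tsum_of_nonneg (fun i => by positivity)
      (summable_geometric_of_lt_one hq0.le hq1), tsum_geometric_of_lt_one hq0.le hq1]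
  set V : Ω → ℝ≥0∞ := fun ω =>
    ENNReal.ofReal (((1 / 2) ^ (k₀ + 1)) ^
      (-((Module.finrank ℝ (EuclideanSpace ℝ (Fin d)) : ℝ) / 2))) * ∫⁻ z, ENNReal.ofReal
        (occupationConv (heatKernel ((1 / 2) ^ (k₀ + 1))) (fun s => Y s ω) a b z ^ m) with hV
  set W : ℕ → Ω → ℝ≥0∞ := fun i ω => (ρ i ^ m)⁻¹ * (ENNReal.ofReal (((1 / 2) ^ (k₀ + i + 2)) ^
      (-((Module.finrank ℝ (EuclideanSpace ℝ (Fin d)) : ℝ) / 2))) * ∫⁻ z, ENNReal.ofReal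
        (occupationConv (fun z => heatKernel (3 * (1 / 2) ^ (k₀ + i + 2)) z -
          heatKernel ((1 / 2) ^ (k₀ + i + 2)) z) (fun s => Y s ω) a b z ^ m)) with hW
  have hVm : Measurable V := (measurable_lintegral_occupationConv_pow hYm
    (continuous_heatKernel _).measurable a b m).const_mul _
  have hWm : ∀ i, Measurable (W i) := fun i => ((measurable_lintegral_occupationConv_pow hYm
    ((continuous_heatKernel _).sub (continuous_heatKernel _)).measurable a b
      m).const_mul _).const_mul _
  have hVint : ∫⁻ ω, V ω ∂P ≤ ENNReal.ofReal ((c₀ * X) ^ m) := by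
    simp only [hV, hfin]
    rw [lintegral_const_mul _ (measurable_lintegral_occupationConv_pow hYm
      (continuous_heatKernel _).measurable a b m)]
    refine (mul_le_mul' le_rfl (hmom₀ 1 h a b _ _ zero_le_one hh ha hbT hbh
      (fourierKernel_heatKernel (by positivity) (h ^ α)) m hm hme)).trans ?_
    rw [← ENNReal.ofReal_mul (by positivity)]
    refine ENNReal.ofReal_le_ofReal ?_
    simp only [mul_zero, add_zero, mul_one, one_pow]
    refine coarse_scale_bound hα hd0.le hh hH (by linarith) hm ?_
    rw [← hy₀]
    rw [hk₀, pow_succ, pow_succ]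
    linarith
  have hWint : ∀ i, ∫⁻ ω, W i ω ∂P ≤ ENNReal.ofReal ((c₁ * X) ^ m * q ^ i) := by
    intro i
    simp only [hW, hfin]
    have hmeas : Measurable fun ω => ∫⁻ z, ENNReal.ofReal (occupationConv
        (fun z => heatKernel (3 * (1 / 2) ^ (k₀ + i + 2)) z -
          heatKernel ((1 / 2) ^ (k₀ + i + 2)) z) (fun s => Y s ω) a b z ^ m) :=
      measurable_lintegral_occupationConv_pow hYm
        ((continuous_heatKernel (3 * (1 / 2) ^ (k₀ + i + 2))).sub
          (continuous_heatKernel ((1 / 2) ^ (k₀ + i + 2)))).measurable a b m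
    rw [lintegral_const_mul _ (hmeas.const_mul _), lintegral_const_mul _ hmeas]
    have hb : (0 : ℝ) < (1 / 2) ^ (k₀ + i + 2) := by positivity
    have hha : 0 < h ^ α := by positivity
    refine (mul_le_mul' le_rfl (mul_le_mul' le_rfl (hmom₁ _ h a b _ _ (by positivity) hh ha hbT hbh
      (fourierKernel_heatKernel_sub hb hha hγ hγ1) m hm hme))).trans ?_
    rw [← ENNReal.ofReal_mul (by positivity)]
    have hx : (0 : ℝ) < √((1 / 2) ^ i) := by positivity
    have h1 := fine_scale_bound (α := α) (θ := θ) (K := K₁) hα hγ hγ1 hd0.le hh hb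
      (by linarith) hm hx
      (Real.sqrt_le_one.2 (pow_le_one₀ (by norm_num) (by norm_num))) (by
        have h2 : ((1 : ℝ) / 2) ^ (k₀ + i + 2) ≤ y₀ * (1 / 2) ^ i := by
          have h3 : (0 : ℝ) < (1 / 2) ^ k₀ := by positivity
          have h4 : (0 : ℝ) < (1 / 2) ^ i := by positivity
          rw [pow_add, pow_add]
          nlinarith
        refine (Real.sqrt_le_sqrt h2).trans ?_
        rw [Real.sqrt_mul hy₀0.le]
        refine mul_le_mul_of_nonneg_right ?_ hx.le
        rw [hy₀, Real.sqrt_mul (by positivity), Real.sqrt_eq_rpow, Real.sqrt_eq_rpow,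
          ← Real.rpow_mul (by positivity), ← Real.rpow_mul hm0.le]
        rw [show 2 * α * (1 / 2) = α by ring, show -(8 * α * d) * (1 / 2) = -(4 * α * d) by ring]
        refine mul_le_mul_of_nonneg_right ?_ (by positivity)
        exact Real.rpow_le_rpow (by positivity) (div_le_self hh.le hH) hα.le) hmγ
    have h5 : √((1 / 2 : ℝ) ^ i) ^ (γ * m / 2) = (q ^ i) ^ m * (q ^ i) ^ m := by
      rw [← pow_mul, ← pow_add, hq, Real.sqrt_eq_rpow, ← Real.rpow_natCast, ← Real.rpow_natCast,
        ← Real.rpow_mul (by norm_num), ← Real.rpow_mul (by norm_num), ← Real.rpow_mul (by norm_num)]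
      congr 1; push_cast; ring
    rw [h5] at h1
    have hqi : 0 < q ^ i := by positivity
    rw [← ENNReal.ofReal_pow hqi.le, ← ENNReal.ofReal_inv_of_pos (by positivity),
      ← ENNReal.ofReal_mul (by positivity)]
    refine ENNReal.ofReal_le_ofReal ?_
    rw [inv_mul_le_iff₀ (by positivity)]
    refine h1.trans ?_
    have h6 : (q ^ i) ^ m ≤ q ^ i :=
      pow_le_of_le_one hqi.le (pow_le_one₀ hq0.le hq1.le) (by omega)
    rw [← mul_assoc, mul_comm ((q ^ i) ^ m), mul_right_comm]
    gcongr
  have hSint : ∫⁻ ω, ∑' i, W i ω ∂P ≤ ENNReal.ofReal ((c₁ * X) ^ m * R) := by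
    rw [lintegral_tsum fun i => (hWm i).aemeasurable]
    refine (ENNReal.tsum_le_tsum hWint).trans (le_of_eq ?_)
    rw [← ENNReal.ofReal_tsum_of_nonneg (fun i => by positivity)
      ((summable_geometric_of_lt_one hq0.le hq1).mul_left _), tsum_mul_left,
      tsum_geometric_of_lt_one hq0.le hq1]
  have hSm : Measurable fun ω => ∑' i, W i ω := Measurable.tsum hWm
  have hVSm : Measurable fun ω => V ω + (∑' i, ρ i) ^ m * ∑' i, W i ω :=
    hVm.add (hSm.const_mul _)
  refine ⟨fun ω => 2 ^ m * (V ω + (∑' i, ρ i) ^ m * ∑' i, W i ω),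
    hVSm.const_mul _, ?_, fun ω => ?_, fun ω hω => ?_⟩
  · rw [lintegral_const_mul _ hVSm, lintegral_add_left hVm,
      lintegral_const_mul _ hSm, hρsum, ← ENNReal.ofReal_pow (by positivity),
      ← ENNReal.ofReal_pow (by positivity)]
    refine (mul_le_mul' le_rfl (add_le_add hVint (mul_le_mul' le_rfl hSint))).trans ?_
    rw [← ENNReal.ofReal_mul (by positivity), ← ENNReal.ofReal_add (by positivity) (by positivity),
      show (2 : ℝ≥0∞) ^ m = ENNReal.ofReal (2 ^ m) by
        rw [ENNReal.ofReal_pow (by norm_num), ENNReal.ofReal_ofNat],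
      ← ENNReal.ofReal_mul (by positivity)]
    refine ENNReal.ofReal_le_ofReal ?_
    have h1 : R ≤ R ^ m := le_self_pow₀ hR1 (by omega)
    calc 2 ^ m * ((c₀ * X) ^ m + R ^ m * ((c₁ * X) ^ m * R))
        ≤ 2 ^ m * ((c₀ * X) ^ m + R ^ m * ((c₁ * X) ^ m * R ^ m)) := by gcongr
      _ = 2 ^ m * ((c₀ * X) ^ m + (R ^ 2 * c₁ * X) ^ m) := by simp only [mul_pow]; ring
      _ ≤ 2 ^ m * (c₀ * X + R ^ 2 * c₁ * X) ^ m := by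
          gcongr
          exact pow_add_pow_le (by positivity) (by positivity) (by omega)
      _ = (2 * (c₀ + R ^ 2 * c₁) * X) ^ m := by rw [← mul_pow]; ring
      _ ≤ _ := by
          have := le_max_right 1 (2 * (c₀ + R ^ 2 * c₁))
          gcongr
  · exact densitySup_pow_le (hYm.comp measurable_prodMk_right) a b hm hme k₀ hρ0 hρt
  · have hS : ∑' i, W i ω ≠ ∞ := by
      intro hS
      refine hω ?_
      simp only
      rw [hS, hρsum, ENNReal.mul_top (by positivity), add_top, ENNReal.mul_top (by positivity)]
    set s := (∑' i, W i ω) ^ ((m : ℝ)⁻¹) with hs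
    have hst : s ≠ ∞ := ENNReal.rpow_ne_top_of_nonneg (by positivity) hS
    refine ⟨k₀, fun i => q ^ i * s.toReal,
      (summable_geometric_of_lt_one hq0.le hq1).mul_right _, fun i x => ?_⟩
    have h1 := enorm_occupationConv_sub_le (hYm.comp measurable_prodMk_right) (y := fun s => Y s ω)
      a b hm hme k₀ hρ0 hρt i x
    rw [← ofReal_norm, Real.norm_eq_abs, ENNReal.ofReal_le_iff_le_toReal
      (ENNReal.mul_ne_top (hρt i) hst), ENNReal.toReal_mul,
      ENNReal.toReal_ofReal (by positivity)] at h1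
    exact h1

end MomentSup

/-! ### From smoothed occupation densities to a local time -/

section Deterministic

variable {V : Type*} [NormedAddCommGroup V] [InnerProductSpace ℝ V] {y : ℝ → V} {T : ℝ}

lemma ofReal_occupationConv_le_densitySup (a b : ℝ) (k : ℕ) (x : V) :
    ENNReal.ofReal (occupationConv (heatKernel ((1 / 2) ^ k)) y a b x) ≤ densitySup y a b :=
  le_iSup₂_of_le (f := fun (k : ℕ) (x : V) =>
    ENNReal.ofReal (occupationConv (heatKernel ((1 / 2) ^ k)) y a b x)) k x le_rfl

lemma continuousOn_occupationConv_prod (hy : Continuous y) {ε : ℝ} :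
    ContinuousOn (fun q : V × ℝ => occupationConv (heatKernel ε) y 0 q.2 q.1)
      (univ ×ˢ Icc 0 T) := by
  have h1 : Continuous fun q : V × ℝ => ∫ s in (0 : ℝ)..q.2, heatKernel ε (q.1 - y s) := by
    refine intervalIntegral.continuous_parametric_intervalIntegral_of_continuous
      (f := fun (q : V × ℝ) s => heatKernel ε (q.1 - y s)) ?_ continuous_snd
    exact (continuous_heatKernel ε).comp
      ((continuous_fst.comp continuous_fst).sub (hy.comp continuous_snd))
  refine h1.continuousOn.congr fun q hq => ?_
  simp only [occupationConv]
  rw [intervalIntegral.integral_of_le hq.2.1, integral_Icc_eq_integral_Ioc]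

variable [FiniteDimensional ℝ V] [MeasurableSpace V] [BorelSpace V]

/-- Heat kernels are an approximate identity. -/
lemma tendsto_integral_mul_heatKernel {φ : V → ℝ} (hφ : Continuous φ) (hφi : Integrable φ) (c : V) :
    Tendsto (fun k : ℕ => ∫ x, φ x * heatKernel ((1 / 2) ^ k) (x - c)) atTop (𝓝 (φ c)) := by
  have h := Real.tendsto_integral_gaussian_smul' (f := fun x => (φ x : ℂ)) hφi.ofReal (v := c)
    (Complex.continuous_ofReal.comp hφ).continuousAt
  have hc : Tendsto (fun k : ℕ => (2 : ℝ) ^ k / Real.pi) atTop atTop :=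
    (tendsto_pow_atTop_atTop_of_one_lt one_lt_two).atTop_div_const Real.pi_pos
  have h2 := (Complex.continuous_re.tendsto _).comp (h.comp hc)
  simp only [Complex.ofReal_re] at h2
  refine h2.congr fun k => ?_
  simp only [Function.comp_apply]
  rw [← RCLike.re_eq_complex_re, ← Complex.ofReal_re (∫ x, φ x * heatKernel ((1 / 2) ^ k) (x - c)),
    ← integral_complex_ofReal, RCLike.re_eq_complex_re]
  congr 2
  funext x
  have hpi : (Real.pi : ℂ) ≠ 0 := by exact_mod_cast Real.pi_ne_zero
  have e1 : ((Real.pi : ℂ) * ((2 ^ k / Real.pi : ℝ) : ℂ)) = (((2 : ℝ) ^ k : ℝ) : ℂ) := by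
    push_cast; field_simp
  have e2 : (-(Real.pi : ℂ) ^ 2 * ((2 ^ k / Real.pi : ℝ) : ℂ) * (‖c - x‖ : ℂ) ^ 2) =
      ((-(Real.pi / (1 / 2) ^ k) * ‖x - c‖ ^ 2 : ℝ) : ℂ) := by
    have h2k : (2 : ℂ) ^ k ≠ 0 := pow_ne_zero _ two_ne_zero
    rw [norm_sub_rev]; push_cast; rw [one_div, inv_pow]; field_simp
  have e3 : ((1 : ℝ) / 2) ^ k = ((2 : ℝ) ^ k)⁻¹ := by rw [one_div, inv_pow]
  rw [e1, e2, heatKernel, smul_eq_mul]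
  rw [show (Module.finrank ℝ V / 2 : ℂ) = ((Module.finrank ℝ V / 2 : ℝ) : ℂ) by push_cast; rfl,
    ← Complex.ofReal_cpow (by positivity), ← Complex.ofReal_exp, ← Complex.ofReal_mul,
    ← Complex.ofReal_mul, Complex.ofReal_inj]
  rw [show (((1 : ℝ) / 2) ^ k) ^ (-(Module.finrank ℝ V / 2 : ℝ)) =
    ((2 : ℝ) ^ k) ^ (Module.finrank ℝ V / 2 : ℝ) by
      rw [e3, Real.inv_rpow (by positivity), Real.rpow_neg (by positivity), inv_inv]]
  ring

lemma occupationConv_sub_of_le (hy : Measurable y) {ε : ℝ} (hε : 0 < ε) {a s t : ℝ} (has : a ≤ s)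
    (hst : s ≤ t) (x : V) :
    occupationConv (heatKernel ε) y a t x =
      occupationConv (heatKernel ε) y a s x + occupationConv (heatKernel ε) y s t x := by
  unfold occupationConv
  have hint := fun u v => integrableOn_heatKernel_comp hy hε u v x
  rw [← Icc_union_Ioc_eq_Icc has hst, setIntegral_union
    (disjoint_left.2 fun z hz hz' => not_lt.2 hz.2 hz'.1) measurableSet_Ioc (hint a s)
    ((hint s t).mono_set Ioc_subset_Icc_self), integral_Icc_eq_integral_Ioc (x := s)]

/-- Uniform convergence in space at the times of a fine grid, together with a modulus of continuity
in time that is uniform in the smoothing scale, gives uniform convergence in space and time. -/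
lemma uniformCauchySeqOn_occupationConv (hy : Continuous y) (hT : 0 < T)
    (hgrid : ∀ N i : ℕ, i ≤ N → UniformCauchySeqOn
      (fun (k : ℕ) x => occupationConv (heatKernel ((1 / 2) ^ k)) y 0 (T * i / N) x) atTop univ)
    (hmod : ∀ ε : ℝ, 0 < ε → ∃ δ : ℝ, 0 < δ ∧ ∀ s t : ℝ, 0 ≤ s → s ≤ t → t ≤ T → t - s ≤ δ →
      densitySup y s t ≤ ENNReal.ofReal ε) :
    UniformCauchySeqOn (fun (k : ℕ) (q : V × ℝ) =>
      occupationConv (heatKernel ((1 / 2) ^ k)) y 0 q.2 q.1) atTop (univ ×ˢ Icc 0 T) := by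
  rw [Metric.uniformCauchySeqOn_iff]
  intro ε hε
  obtain ⟨δ, hδ, hmodδ⟩ := hmod (ε / 4) (by positivity)
  obtain ⟨N, hN⟩ := exists_nat_gt (T / δ)
  have hN0 : (0 : ℝ) < N := (div_pos hT hδ).trans hN
  have hev : ∀ i ∈ Finset.range (N + 1), ∃ K : ℕ, ∀ k ≥ K, ∀ l ≥ K, ∀ x,
      dist (occupationConv (heatKernel ((1 / 2) ^ k)) y 0 (T * i / N) x)
        (occupationConv (heatKernel ((1 / 2) ^ l)) y 0 (T * i / N) x) < ε / 2 := by
    intro i hi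
    obtain ⟨K, hK⟩ := Metric.uniformCauchySeqOn_iff.1
      (hgrid N i (Nat.lt_succ_iff.1 (Finset.mem_range.1 hi))) (ε / 2) (by positivity)
    exact ⟨K, fun k hk l hl x => hK k hk l hl x (mem_univ x)⟩
  choose! K hK using hev
  refine ⟨(Finset.range (N + 1)).sup K, fun k hk l hl q hq => ?_⟩
  obtain ⟨x, t⟩ := q
  obtain ⟨-, ht0, htT⟩ := hq
  simp only at ht0 htT ⊢
  -- The largest grid time that is at most `t`.
  set i := ⌊t * N / T⌋₊ with hi
  have hi1 : (i : ℝ) ≤ t * N / T := Nat.floor_le (by positivity)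
  have hi2 : t * N / T < i + 1 := Nat.lt_floor_add_one _
  set s := T * i / N with hs
  have hs0 : 0 ≤ s := by positivity
  have hst : s ≤ t := by
    rw [hs, div_le_iff₀ hN0]
    rw [le_div_iff₀ hT] at hi1
    linarith
  have hts : t - s ≤ δ := by
    rw [div_lt_iff₀ hT] at hi2
    rw [div_lt_iff₀ hδ] at hN
    have h1 : t < T * (i + 1) / N := by rw [lt_div_iff₀ hN0]; linarith
    have h2 : T * (i + 1) / N = s + T / N := by rw [hs]; ring
    have h3 : T / N ≤ δ := by rw [div_le_iff₀ hN0]; linarith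
    linarith
  have hiN : i ∈ Finset.range (N + 1) := by
    rw [Finset.mem_range, Nat.lt_succ_iff, ← Nat.cast_le (α := ℝ)]
    refine hi1.trans ?_
    rw [div_le_iff₀ hT, mul_comm]
    exact mul_le_mul_of_nonneg_left htT hN0.le
  have hinc : ∀ k : ℕ, |occupationConv (heatKernel ((1 / 2) ^ k)) y 0 t x -
      occupationConv (heatKernel ((1 / 2) ^ k)) y 0 s x| ≤ ε / 4 := by
    intro k
    have hk0 : (0 : ℝ) < (1 / 2) ^ k := by positivity
    rw [occupationConv_sub_of_le hy.measurable hk0 hs0 hst, add_sub_cancel_left,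
      abs_of_nonneg (occupationConv_heatKernel_nonneg hk0 _ _ _)]
    exact (ENNReal.ofReal_le_ofReal_iff (by positivity)).1
      ((ofReal_occupationConv_le_densitySup s t k x).trans (hmodδ s t hs0 hst htT hts))
  have h1 := hinc k
  have h2 := hinc l
  have hKi : K i ≤ (Finset.range (N + 1)).sup K := Finset.le_sup hiN
  have h3 := hK i hiN k (hKi.trans hk) l (hKi.trans hl) x
  rw [Real.dist_eq] at h3 ⊢
  rw [abs_le] at h1 h2
  rw [abs_lt] at h3 ⊢
  constructor <;> linarith [h1.1, h1.2, h2.1, h2.2, h3.1, h3.2]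

end Deterministic

section StieltjesKernel

variable {E : Type*} [TopologicalSpace E] [MeasurableSpace E] [BorelSpace E] {F : E → ℝ → ℝ} {T : ℝ}

/-- A jointly continuous family of distribution functions on `[0, T]` is a kernel of finite
measures. -/
lemma exists_kernel_of_monotoneOn (hT : 0 ≤ T) (hF0 : ∀ x, F x 0 = 0)
    (hmono : ∀ x, MonotoneOn (F x) (Icc 0 T))
    (hcont : ContinuousOn (Function.uncurry F) (univ ×ˢ Icc 0 T)) :
    ∃ L : Kernel E ℝ, (∀ x, IsFiniteMeasure (L x)) ∧
      (∀ x t, L x (Iic t) = ENNReal.ofReal (F x (projIcc 0 T hT t))) ∧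
      ∀ x, ∀ s ∈ Icc 0 T, ∀ t ∈ Icc 0 T, L x (Icc s t) = ENNReal.ofReal (F x t - F x s) := by
  have hc : Continuous fun q : E × ℝ => F q.1 (projIcc 0 T hT q.2) := by
    refine hcont.comp_continuous (f := fun q : E × ℝ => (q.1, (projIcc 0 T hT q.2 : ℝ))) ?_
      fun q => ⟨mem_univ _, (projIcc 0 T hT q.2).2⟩
    exact continuous_fst.prodMk
      (continuous_subtype_val.comp (continuous_projIcc.comp continuous_snd))
  have hc1 : ∀ x, Continuous fun t => F x (projIcc 0 T hT t) := fun x =>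
    hc.comp (Continuous.prodMk_right x)
  let f : E → StieltjesFunction ℝ := fun x =>
    { toFun := fun t => F x (projIcc 0 T hT t)
      mono' := fun s t hst => hmono x (projIcc 0 T hT s).2 (projIcc 0 T hT t).2
        (monotone_projIcc hT hst)
      right_continuous' := fun t => (hc1 x).continuousWithinAt }
  have hf : ∀ x t, f x t = F x (projIcc 0 T hT t) := fun _ _ => rfl
  have hbound : ∀ x t, |f x t| ≤ F x T := by
    intro x t
    have h0 := hmono x (left_mem_Icc.2 hT) (projIcc 0 T hT t).2 (projIcc 0 T hT t).2.1
    rw [hF0] at h0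
    rw [hf, abs_of_nonneg h0]
    exact hmono x (projIcc 0 T hT t).2 (right_mem_Icc.2 hT) (projIcc 0 T hT t).2.2
  have hfin : ∀ x, IsFiniteMeasure (f x).measure := fun x =>
    (f x).isFiniteMeasure_of_forall_abs_le (hbound x)
  have hbot : ∀ x, Tendsto (f x) atBot (𝓝 0) := by
    intro x
    refine tendsto_const_nhds.congr' ?_
    filter_upwards [eventually_le_atBot 0] with t ht
    rw [hf, projIcc_of_le_left hT ht, hF0]
  have hIic : ∀ x t, (f x).measure (Iic t) = ENNReal.ofReal (F x (projIcc 0 T hT t)) := by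
    intro x t
    rw [(f x).measure_Iic (hbot x), sub_zero, hf]
  have htop : ∀ x, Tendsto (f x) atTop (𝓝 (F x T)) := by
    intro x
    refine tendsto_const_nhds.congr' ?_
    filter_upwards [eventually_ge_atTop T] with t ht
    rw [hf, projIcc_of_right_le hT ht]
  have hFm : ∀ t, Measurable fun x => F x (projIcc 0 T hT t) := fun t =>
    (hc.comp (Continuous.prodMk_left t)).measurable
  have hmeas : Measurable fun x => (f x).measure := by
    refine Measurable.measure_of_isPiSystem (borel_eq_generateFrom_Iic ℝ ▸ BorelSpace.measurable_eq)
      isPiSystem_Iic ?_ ?_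
    · rintro _ ⟨t, rfl⟩
      simp_rw [hIic]
      exact (hFm t).ennreal_ofReal
    · simp_rw [fun x => (f x).measure_univ (hbot x) (htop x), sub_zero]
      have := hFm T
      simp only [projIcc_right] at this
      exact this.ennreal_ofReal
  refine ⟨⟨fun x => (f x).measure, hmeas⟩, hfin, hIic, fun x s hs t ht => ?_⟩
  change (f x).measure (Icc s t) = _
  have hl : Function.leftLim (f x) s = f x s :=
    ContinuousWithinAt.leftLim_eq (hc1 x).continuousWithinAt
  rw [(f x).measure_Icc, hl, hf, hf, projIcc_of_mem hT hs, projIcc_of_mem hT ht]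

end StieltjesKernel

section Limit

variable {V : Type*} [NormedAddCommGroup V] [InnerProductSpace ℝ V] [FiniteDimensional ℝ V]
  [MeasurableSpace V] [BorelSpace V] {y : ℝ → V} {T : ℝ}

/-- A uniform limit of the smoothed occupation densities is an occupation density. -/
lemma map_restrict_eq_withDensity (hy : Measurable y) {a b : ℝ} {g : V → ℝ} (hg0 : ∀ x, 0 ≤ g x)
    (hg : Continuous g) (hlim : TendstoUniformlyOn (fun (k : ℕ) x =>
      occupationConv (heatKernel ((1 / 2) ^ k)) y a b x) g atTop univ) :
    (volume.restrict (Icc a b)).map y = volume.withDensity fun x => ENNReal.ofReal (g x) := by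
  have : IsLocallyFiniteMeasure ((volume : Measure V).withDensity fun x => ENNReal.ofReal (g x)) :=
    IsLocallyFiniteMeasure.withDensity_ofReal hg
  refine Measure.ext_of_integral_eq_on_compactlySupported fun φ => ?_
  have hφc : Continuous φ := φ.continuous
  have hφi : Integrable (φ : V → ℝ) := hφc.integrable_of_hasCompactSupport φ.hasCompactSupport
  obtain ⟨M, hM⟩ := hφc.bounded_above_of_compact_support φ.hasCompactSupport
  have hM0 : 0 ≤ M := (norm_nonneg _).trans (hM 0)
  rw [integral_map hy.aemeasurable hφc.aestronglyMeasurable,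
    integral_withDensity_eq_integral_toReal_smul hg.measurable.ennreal_ofReal
      (ae_of_all _ fun _ => ENNReal.ofReal_lt_top)]
  simp_rw [ENNReal.toReal_ofReal (hg0 _), smul_eq_mul]
  have hpos : ∀ k : ℕ, (0 : ℝ) < (1 / 2) ^ k := fun k => by positivity
  -- Fubini's theorem moves the smoothing from the occupation density to the test function.
  have hfub : ∀ k : ℕ, ∫ x, occupationConv (heatKernel ((1 / 2) ^ k)) y a b x * φ x =
      ∫ s in Icc a b, ∫ x, φ x * heatKernel ((1 / 2) ^ k) (x - y s) := by
    intro k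
    unfold occupationConv
    simp_rw [← integral_mul_const]
    rw [integral_integral_swap]
    · simp_rw [mul_comm]
    · refine Integrable.bdd_mul (c := ((1 / 2) ^ k) ^ (-(Module.finrank ℝ V / 2 : ℝ)))
        (hφi.comp_fst _) ?_ (ae_of_all _ fun q => ?_)
      · exact ((continuous_heatKernel _).measurable.comp
          (measurable_fst.sub (hy.comp measurable_snd))).aestronglyMeasurable
      · rw [Real.norm_of_nonneg (heatKernel_nonneg (hpos k) _)]
        exact heatKernel_le (hpos k) _
  have h1 : Tendsto (fun k : ℕ => ∫ x, occupationConv (heatKernel ((1 / 2) ^ k)) y a b x * φ x)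
      atTop (𝓝 (∫ x, g x * φ x)) := by
    rw [Metric.tendsto_atTop]
    intro ε hε
    set I := ∫ x, ‖φ x‖ with hI
    have hI0 : 0 ≤ I := integral_nonneg fun _ => norm_nonneg _
    obtain ⟨K, hK⟩ := eventually_atTop.1
      (Metric.tendstoUniformlyOn_iff.1 hlim (ε / (I + 1)) (by positivity))
    refine ⟨K, fun k hk => ?_⟩
    have hgi : Integrable fun x => g x * φ x := by
      refine (hg.mul hφc).integrable_of_hasCompactSupport ?_
      exact φ.hasCompactSupport.mul_left
    have hoi : Integrable fun x => occupationConv (heatKernel ((1 / 2) ^ k)) y a b x * φ x := by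
      refine ((continuous_occupationConv_heatKernel hy (hpos k) a b).mul
        hφc).integrable_of_hasCompactSupport ?_
      exact φ.hasCompactSupport.mul_left
    rw [dist_eq_norm, ← integral_sub hoi hgi]
    calc ‖∫ x, (occupationConv (heatKernel ((1 / 2) ^ k)) y a b x * φ x - g x * φ x)‖
        ≤ ∫ x, ε / (I + 1) * ‖φ x‖ := by
          refine norm_integral_le_of_norm_le (hφi.norm.const_mul _) (ae_of_all _ fun x => ?_)
          rw [← sub_mul, norm_mul, ← dist_eq_norm, dist_comm]
          exact mul_le_mul_of_nonneg_right (hK k hk x (mem_univ x)).le (norm_nonneg _)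
      _ = ε * (I / (I + 1)) := by rw [integral_const_mul]; ring
      _ < ε * 1 := by
          refine mul_lt_mul_of_pos_left ?_ hε
          rw [div_lt_one (by positivity)]
          linarith
      _ = ε := mul_one _
  have h2 : Tendsto (fun k : ℕ => ∫ s in Icc a b, ∫ x, φ x * heatKernel ((1 / 2) ^ k) (x - y s))
      atTop (𝓝 (∫ s in Icc a b, φ (y s))) := by
    refine tendsto_integral_of_dominated_convergence (fun _ => M) (fun k => ?_)
      (integrable_const M) (fun k => ae_of_all _ fun s => ?_)
      (ae_of_all _ fun s => tendsto_integral_mul_heatKernel hφc hφi (y s))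
    · refine (StronglyMeasurable.integral_prod_right (f := fun s x =>
        φ x * heatKernel ((1 / 2) ^ k) (x - y s)) ?_).aestronglyMeasurable
      exact ((hφc.measurable.comp measurable_snd).mul ((continuous_heatKernel _).measurable.comp
        (measurable_snd.sub (hy.comp measurable_fst)))).stronglyMeasurable
    · calc ‖∫ x, φ x * heatKernel ((1 / 2) ^ k) (x - y s)‖
          ≤ ∫ x, M * heatKernel ((1 / 2) ^ k) (x - y s) := by
            refine norm_integral_le_of_norm_le
              (((integrable_heatKernel (hpos k)).comp_sub_right (y s)).const_mul M)
              (ae_of_all _ fun x => ?_)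
            rw [norm_mul, Real.norm_of_nonneg (heatKernel_nonneg (hpos k) _)]
            exact mul_le_mul_of_nonneg_right (hM x) (heatKernel_nonneg (hpos k) _)
        _ = M := by
            rw [integral_const_mul, integral_sub_right_eq_self (fun z => heatKernel _ z),
              integral_heatKernel (hpos k), mul_one]
  exact tendsto_nhds_unique h2 (h1.congr hfub)

/-- Uniform convergence in space and time of the smoothed occupation densities yields a jointly
continuous local time, which is dominated by the suprema of the smoothed densities. -/
theorem exists_isLocalTime (hy : Continuous y) (hT : 0 < T)
    (hgrid : ∀ N i : ℕ, i ≤ N → UniformCauchySeqOn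
      (fun (k : ℕ) x => occupationConv (heatKernel ((1 / 2) ^ k)) y 0 (T * i / N) x) atTop univ)
    (hmod : ∀ ε : ℝ, 0 < ε → ∃ δ : ℝ, 0 < δ ∧ ∀ s t : ℝ, 0 ≤ s → s ≤ t → t ≤ T → t - s ≤ δ →
      densitySup y s t ≤ ENNReal.ofReal ε) :
    ∃ L : Kernel V ℝ,
      IsLocalTime T y L ∧ IsJointlyContinuousLocalTime T L ∧
      ∀ x, ∀ s t : ℝ, 0 ≤ s → s ≤ t → t ≤ T → L x (Icc s t) ≤ densitySup y s t := by
  have hpos : ∀ k : ℕ, (0 : ℝ) < (1 / 2) ^ k := fun k => by positivity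
  have hcau := uniformCauchySeqOn_occupationConv hy hT hgrid hmod
  have hex : ∀ x t, ∃ l : ℝ, t ∈ Icc 0 T →
      Tendsto (fun k : ℕ => occupationConv (heatKernel ((1 / 2) ^ k)) y 0 t x) atTop (𝓝 l) := by
    intro x t
    by_cases ht : t ∈ Icc 0 T
    · obtain ⟨l, hl⟩ := cauchySeq_tendsto_of_complete
        (hcau.cauchySeq (x := (x, t)) ⟨mem_univ x, ht⟩)
      exact ⟨l, fun _ => hl⟩
    · exact ⟨0, fun h => absurd h ht⟩
  choose F hF using hex
  have hunif : TendstoUniformlyOn (fun (k : ℕ) (q : V × ℝ) =>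
      occupationConv (heatKernel ((1 / 2) ^ k)) y 0 q.2 q.1) (Function.uncurry F) atTop
      (univ ×ˢ Icc 0 T) :=
    hcau.tendstoUniformlyOn_of_tendsto fun q hq => hF q.1 q.2 hq.2
  have hcont : ContinuousOn (Function.uncurry F) (univ ×ˢ Icc 0 T) :=
    hunif.continuousOn (Frequently.of_forall fun k => continuousOn_occupationConv_prod hy)
  have hF0 : ∀ x, F x 0 = 0 := by
    intro x
    refine tendsto_nhds_unique (hF x 0 (left_mem_Icc.2 hT.le)) ?_
    simp [occupationConv]
  have hinc : ∀ x, ∀ s t : ℝ, 0 ≤ s → s ≤ t → t ≤ T →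
      Tendsto (fun k : ℕ => occupationConv (heatKernel ((1 / 2) ^ k)) y s t x) atTop
        (𝓝 (F x t - F x s)) := by
    intro x s t hs hst ht
    refine ((hF x t ⟨hs.trans hst, ht⟩).sub (hF x s ⟨hs, hst.trans ht⟩)).congr fun k => ?_
    rw [occupationConv_sub_of_le hy.measurable (hpos k) hs hst, add_sub_cancel_left]
  have hmono : ∀ x, MonotoneOn (F x) (Icc 0 T) := fun x s hs t ht hst =>
    sub_nonneg.1 (ge_of_tendsto' (hinc x s t hs.1 hst ht.2) fun k =>
      occupationConv_heatKernel_nonneg (hpos k) _ _ _)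
  obtain ⟨L, hLfin, hLIic, hLIcc⟩ := exists_kernel_of_monotoneOn hT.le hF0 hmono hcont
  have hFnn : ∀ x, ∀ t ∈ Icc 0 T, 0 ≤ F x t := fun x t ht => by
    have := hmono x (left_mem_Icc.2 hT.le) ht ht.1
    rwa [hF0] at this
  have hdens : ∀ t ∈ Icc 0 T, ∀ A : Set V, MeasurableSet A →
      volume (Icc 0 t ∩ y ⁻¹' A) = ∫⁻ x in A, ENNReal.ofReal (F x t) := by
    intro t ht A hA
    have hct : Continuous fun x => F x t := by
      rw [← continuousOn_univ]
      exact hcont.comp (f := fun x : V => (x, t)) (Continuous.prodMk_left t).continuousOn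
        fun x _ => ⟨mem_univ _, ht⟩
    have hm := map_restrict_eq_withDensity (g := fun x => F x t) hy.measurable
      (fun x => hFnn x t ht) hct
      (a := 0) (b := t) (by
        rw [Metric.tendstoUniformlyOn_iff] at hunif ⊢
        intro ε hε
        filter_upwards [hunif ε hε] with k hk x _
        exact hk (x, t) ⟨mem_univ _, ht⟩)
    have h1 := congrArg (fun μ : Measure V => μ A) hm
    simp only [Measure.map_apply hy.measurable hA, withDensity_apply _ hA] at h1
    rwa [Measure.restrict_apply (hy.measurable hA), inter_comm] at h1
  refine ⟨L, fun B hB hBT A hA => ?_, ⟨fun x => measure_lt_top _ _, ?_⟩, ?_⟩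
  · -- Both sides are finite measures in `B`; it is enough to compare them on the sets `Iic t`.
    have hmeq : (volume : Measure ℝ).restrict (Icc 0 T ∩ y ⁻¹' A) =
        (volume.restrict A).bind L := by
      have : IsFiniteMeasure ((volume : Measure ℝ).restrict (Icc 0 T ∩ y ⁻¹' A)) :=
        ⟨by rw [Measure.restrict_apply_univ]
            exact (measure_mono inter_subset_left).trans_lt measure_Icc_lt_top⟩
      refine Measure.ext_of_Iic _ _ fun t => ?_
      rw [Measure.restrict_apply measurableSet_Iic,
        Measure.bind_apply measurableSet_Iic L.aemeasurable]
      simp_rw [hLIic]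
      rw [← hdens _ (projIcc 0 T hT.le t).2 A hA, ← inter_assoc]
      rcases lt_or_ge t 0 with h0 | h0
      · rw [projIcc_of_le_left hT.le h0.le, Icc_self,
          show Iic t ∩ Icc 0 T = ∅ from
            disjoint_iff_inter_eq_empty.1 (disjoint_left.2 fun z hz hz' => by
              have h1 : z ≤ t := hz
              linarith [hz'.1])]
        rw [empty_inter, measure_empty]
        exact (measure_mono_null inter_subset_left (by simp)).symm
      · congr 2
        ext z
        simp only [mem_inter_iff, mem_Iic, mem_Icc, coe_projIcc, le_max_iff, le_min_iff]
        constructor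
        · rintro ⟨h1, h2, h3⟩
          exact ⟨h2, Or.inr ⟨h3, h1⟩⟩
        · rintro ⟨h1, h2 | ⟨h2, h3⟩⟩
          · exact ⟨h2.trans h0, h1, h2.trans hT.le⟩
          · exact ⟨h3, h1, h2⟩
    have h1 := congrArg (fun μ : Measure ℝ => μ B) hmeq
    simp only [Measure.restrict_apply hB, Measure.bind_apply hB L.aemeasurable] at h1
    rw [← h1, occupationTime, ← inter_assoc, inter_eq_left.2 hBT]
  · refine hcont.congr fun q hq => ?_
    rw [hLIcc q.1 0 (left_mem_Icc.2 hT.le) q.2 hq.2, hF0, sub_zero,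
      ENNReal.toReal_ofReal (hFnn _ _ hq.2)]
    rfl
  · intro x s t hs hst ht
    rw [hLIcc x s ⟨hs, hst.trans ht⟩ t ⟨hs.trans hst, ht⟩]
    exact le_of_tendsto' (ENNReal.tendsto_ofReal (hinc x s t hs hst ht)) fun k =>
      ofReal_occupationConv_le_densitySup s t k x

end Limit

/-! ### Almost sure moduli of the smoothed occupation densities -/

section DensitySup

variable {V : Type*} [NormedAddCommGroup V] [InnerProductSpace ℝ V] [FiniteDimensional ℝ V]
  [MeasurableSpace V] [BorelSpace V] {y : ℝ → V}

lemma densitySup_mono (hy : Measurable y) {a b a' b' : ℝ} (ha : a' ≤ a) (hb : b ≤ b') :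
    densitySup y a b ≤ densitySup y a' b' := by
  refine iSup₂_mono fun k x => ENNReal.ofReal_le_ofReal ?_
  have hk : (0 : ℝ) < (1 / 2) ^ k := by positivity
  exact setIntegral_mono_set (integrableOn_heatKernel_comp hy hk a' b' x)
    (ae_of_all _ fun s => heatKernel_nonneg hk _) (Icc_subset_Icc ha hb).eventuallyLE

end DensitySup

lemma uniformCauchySeqOn_of_summable_bound {X : Type*} {f : ℕ → X → ℝ} {k₀ : ℕ} {B : ℕ → ℝ}
    (hB : Summable B) (h : ∀ i x, |f (k₀ + i) x - f (k₀ + i + 1) x| ≤ B i) :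
    UniformCauchySeqOn f atTop univ := by
  rw [Metric.uniformCauchySeqOn_iff]
  intro ε hε
  obtain ⟨N, hN⟩ := Metric.cauchySeq_iff.1 hB.hasSum.tendsto_sum_nat.cauchySeq ε hε
  have key : ∀ i j : ℕ, N ≤ i → i ≤ j → ∀ x, dist (f (k₀ + i) x) (f (k₀ + j) x) < ε := by
    intro i j hi hij x
    have h1 : dist (f (k₀ + i) x) (f (k₀ + j) x) ≤ ∑ l ∈ Finset.Ico i j, B l :=
      dist_le_Ico_sum_of_dist_le (f := fun l => f (k₀ + l) x) hij fun _ _ => h _ x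
    rw [Finset.sum_Ico_eq_sub _ hij] at h1
    exact h1.trans_lt ((le_abs_self _).trans_lt (hN j (hi.trans hij) i hi))
  refine ⟨k₀ + N, fun k hk l hl x _ => ?_⟩
  obtain ⟨i, rfl⟩ := Nat.exists_eq_add_of_le ((Nat.le_add_right k₀ N).trans hk)
  obtain ⟨j, rfl⟩ := Nat.exists_eq_add_of_le ((Nat.le_add_right k₀ N).trans hl)
  have hi : N ≤ i := by omega
  have hj : N ≤ j := by omega
  rcases le_total i j with hij | hij
  · exact key i j hi hij x
  · rw [dist_comm]
    exact key j i hj hij x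

/-- A property of all small `r > 0` may be verified on dyadic blocks. -/
lemma eventually_nhdsGT_zero_of_dyadic {Q : ℝ → Prop}
    (h : ∀ᶠ n : ℕ in atTop, ∀ r : ℝ, (1 / 2) ^ (n + 1) < r → r ≤ (1 / 2) ^ n → Q r) :
    ∀ᶠ r in 𝓝[>] (0 : ℝ), Q r := by
  obtain ⟨n₀, hn₀⟩ := eventually_atTop.1 h
  have h1 : ∀ᶠ r in 𝓝[>] (0 : ℝ), r < (1 / 2) ^ n₀ :=
    (eventually_lt_nhds (by positivity)).filter_mono nhdsWithin_le_nhds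
  filter_upwards [self_mem_nhdsWithin, h1] with r hr0 hr
  obtain ⟨n, hn1, hn2⟩ := exists_nat_pow_near_of_lt_one hr0
    (hr.le.trans (pow_le_one₀ (by norm_num) (by norm_num))) (by norm_num : (0 : ℝ) < 1 / 2)
    (by norm_num)
  refine hn₀ n ?_ r hn1 hn2
  have := (pow_lt_pow_iff_right_of_lt_one₀ (by norm_num : (0 : ℝ) < 1 / 2) (by norm_num)).1
    (hn1.trans hr)
  omega

lemma natCast_le_two_mul_log_inv {n : ℕ} {r : ℝ} (hr : 0 < r) (h : r ≤ (1 / 2) ^ n) :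
    (n : ℝ) ≤ 2 * Real.log r⁻¹ := by
  have h1 := Real.log_le_log hr h
  rw [Real.log_pow, one_div, Real.log_inv] at h1
  rw [Real.log_inv]
  have h2 := Real.log_two_gt_d9
  have h3 : (0 : ℝ) ≤ n := n.cast_nonneg
  nlinarith

section BorelCantelli

variable {d : ℕ} {Ω : Type*} [MeasurableSpace Ω] {P : Measure Ω} [IsProbabilityMeasure P]
  {T : ℝ} {Y : ℝ → Ω → EuclideanSpace ℝ (Fin d)} {α θ C H : ℝ}

/-- Exponential tails of the smoothed occupation densities, from the moments of order
proportional to `p`. -/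
theorem exists_tail_densitySup_le (hd : 1 ≤ d) (hα : 0 < α) (hαd : α * d < 1) (hθ : 0 ≤ θ)
    (hC : 0 < C) (hY : IncrementBound P T Y α θ C) (hYm : Measurable (Function.uncurry Y))
    (hH : 1 ≤ H) :
    ∃ K : ℝ, 0 < K ∧ ∀ a b h p : ℝ, 0 ≤ a → b ≤ T → b - a ≤ h → 0 < h → h ≤ H → 1 ≤ p →
      ∃ S : Set Ω, P S ≤ ENNReal.ofReal (Real.exp (-p)) ∧ ∀ ω ∉ S,
        densitySup (fun s => Y s ω) a b ≤
          ENNReal.ofReal (K * (p ^ (α * (d + θ)) * h ^ (1 - α * d))) := by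
  obtain ⟨K, hK, m₀, hm₀, hmom⟩ := exists_moment_densitySup_le (H := H) hd hα hαd hC hY hYm hH
  set β := α * (d + θ) with hβ
  have hβ0 : 0 ≤ β := by positivity
  have hm₀' : (1 : ℝ) ≤ m₀ := by exact_mod_cast hm₀
  refine ⟨Real.exp 1 * K * (4 * m₀) ^ β, by positivity, fun a b h p ha hb hab h0 hhH hp => ?_⟩
  -- An admissible even exponent between `p` and a multiple of `p`.
  set m := 2 * (m₀ * ⌈p⌉₊) with hm
  have hceil1 := Nat.le_ceil p
  have hceil2 := Nat.ceil_lt_add_one (zero_le_one.trans hp)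
  have hceil0 : 1 ≤ ⌈p⌉₊ := Nat.one_le_ceil_iff.2 (by linarith)
  have hmm₀ : m₀ ≤ m := by
    have : m₀ ≤ m₀ * ⌈p⌉₊ := Nat.le_mul_of_pos_right _ hceil0
    omega
  have hm_ge : p ≤ m := by
    rw [hm]; push_cast
    nlinarith [mul_le_mul hm₀' hceil1 (by linarith) (by linarith)]
  have hm_le : (m : ℝ) ≤ 4 * m₀ * p := by
    rw [hm]; push_cast
    nlinarith
  obtain ⟨Z, hZm, hZ, hdZ, -⟩ := hmom a b h ha hb hab h0 hhH m hmm₀ (even_two_mul _)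
  set q := K * ((m : ℝ) ^ β * h ^ (1 - α * d)) with hq
  have hmpos : (0 : ℝ) < m := by linarith
  have hq0 : 0 < q := by positivity
  set c := ENNReal.ofReal (Real.exp 1 * q) ^ m with hc
  have hm1 : m ≠ 0 := by omega
  refine ⟨{ω | c ≤ Z ω}, ?_, fun ω hω => ?_⟩
  · have hc0 : c ≠ 0 := pow_ne_zero _ (by simpa using by positivity)
    have hct : c ≠ ∞ := ENNReal.pow_ne_top ENNReal.ofReal_ne_top
    have h1 : P {ω | c ≤ Z ω} ≤ (∫⁻ ω, Z ω ∂P) / c :=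
      meas_ge_le_lintegral_div hZm.aemeasurable hc0 hct
    refine h1.trans (ENNReal.div_le_of_le_mul (hZ.trans (le_trans (le_of_eq ?_)
      (mul_le_mul_left (ENNReal.ofReal_le_ofReal
        (Real.exp_le_exp.2 (neg_le_neg hm_ge))) c))))
    rw [hc, ← ENNReal.ofReal_pow hq0.le, ← ENNReal.ofReal_pow (by positivity),
      ← ENNReal.ofReal_mul (by positivity), mul_pow (Real.exp 1), ← mul_assoc,
      ← Real.exp_nat_mul, mul_one,
      ← Real.exp_add, neg_add_cancel, Real.exp_zero, one_mul]
  · have h1 : densitySup (fun s => Y s ω) a b ^ m ≤ c := (hdZ ω).trans (not_le.1 hω).le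
    refine ((ENNReal.pow_le_pow_left_iff hm1).1 h1).trans (ENNReal.ofReal_le_ofReal ?_)
    have h2 : (m : ℝ) ^ β ≤ (4 * m₀) ^ β * p ^ β := by
      rw [← Real.mul_rpow (by positivity) (by positivity)]
      exact Real.rpow_le_rpow hmpos.le hm_le hβ0
    calc Real.exp 1 * q = Real.exp 1 * K * h ^ (1 - α * d) * (m : ℝ) ^ β := by rw [hq]; ring
      _ ≤ Real.exp 1 * K * h ^ (1 - α * d) * ((4 * m₀) ^ β * p ^ β) :=
        mul_le_mul_of_nonneg_left h2 (by positivity)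
      _ = _ := by ring

/-- The local modulus at a fixed time. -/
theorem exists_local_modulus (hd : 1 ≤ d) (hα : 0 < α) (hαd : α * d < 1) (hθ : 0 ≤ θ)
    (hC : 0 < C) (hY : IncrementBound P T Y α θ C) (hYm : Measurable (Function.uncurry Y)) :
    ∃ K : ℝ, 0 < K ∧ ∀ s : ℝ, ∀ᵐ ω ∂P, ∀ᶠ r in 𝓝[>] (0 : ℝ),
      densitySup (fun u => Y u ω) (max 0 (s - r)) (min T (s + r)) ≤
        ENNReal.ofReal (K * (r ^ (1 - α * d) * Real.log (Real.log r⁻¹) ^ (α * (d + θ)))) := by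
  obtain ⟨K, hK, htail⟩ := exists_tail_densitySup_le hd hα hαd hθ hC hY hYm one_le_two
  set β := α * (d + θ) with hβ
  set c := 1 - α * d with hc
  have hβ0 : 0 ≤ β := by positivity
  have hc0 : 0 < c := by linarith
  refine ⟨K * (5 ^ β * 4 ^ c), by positivity, fun s => ?_⟩
  have hp : ∀ n : ℕ, 1 ≤ 1 + 2 * Real.log (n + 1) := fun n => by
    have := Real.log_nonneg (by linarith [n.cast_nonneg (α := ℝ)] : (1 : ℝ) ≤ n + 1)
    linarith
  have hhalf : ∀ n : ℕ, ((1 : ℝ) / 2) ^ n ≤ 1 := fun n =>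
    pow_le_one₀ (by norm_num) (by norm_num)
  -- Tails of order `2 log n` are summable along the dyadic radii `2⁻ⁿ`.
  choose S hS hS' using fun n : ℕ => htail (max 0 (s - (1 / 2) ^ n)) (min T (s + (1 / 2) ^ n))
    (2 * (1 / 2) ^ n) (1 + 2 * Real.log (n + 1)) (le_max_left _ _) (min_le_left _ _)
    (by linarith [min_le_right T (s + (1 / 2) ^ n), le_max_right 0 (s - (1 / 2) ^ n)])
    (by positivity) (by linarith [hhalf n]) (hp n)
  have hsum : ∑' n, P (S n) ≠ ∞ := by
    have h1 : Summable fun n : ℕ => (((n + 1 : ℕ) : ℝ) ^ 2)⁻¹ :=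
      (summable_nat_add_iff (f := fun n : ℕ => ((n : ℝ) ^ 2)⁻¹) 1).2
        (Real.summable_nat_pow_inv.2 one_lt_two)
    refine ne_top_of_le_ne_top h1.tsum_ofReal_ne_top (ENNReal.tsum_le_tsum fun n => ?_)
    refine (hS n).trans (ENNReal.ofReal_le_ofReal ?_)
    have hn : (0 : ℝ) < n + 1 := by positivity
    rw [show -(1 + 2 * Real.log ((n : ℝ) + 1)) = -1 + -Real.log (((n : ℝ) + 1) ^ 2) by
      rw [Real.log_pow]; push_cast; ring, Real.exp_add, Real.exp_neg (Real.log _),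
      Real.exp_log (by positivity)]
    push_cast
    exact mul_le_of_le_one_left (by positivity) (Real.exp_le_one_iff.2 (by norm_num))
  filter_upwards [ae_eventually_notMem hsum] with ω hω
  have hlog : Tendsto (fun r : ℝ => Real.log r⁻¹) (𝓝[>] 0) atTop :=
    Real.tendsto_log_atTop.comp tendsto_inv_nhdsGT_zero
  have hmain : ∀ᶠ r in 𝓝[>] (0 : ℝ), 3 ≤ Real.log r⁻¹ → 1 ≤ Real.log (Real.log r⁻¹) →
      densitySup (fun u => Y u ω) (max 0 (s - r)) (min T (s + r)) ≤
        ENNReal.ofReal (K * (5 ^ β * 4 ^ c) *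
          (r ^ c * Real.log (Real.log r⁻¹) ^ β)) := by
    refine eventually_nhdsGT_zero_of_dyadic ?_
    filter_upwards [hω] with n hn r hr1 hr2 hl hll
    have hr0 : 0 < r := lt_trans (by positivity) hr1
    have hyω : Measurable fun u => Y u ω := hYm.comp (measurable_id.prodMk measurable_const)
    refine (densitySup_mono hyω (max_le_max le_rfl (by linarith))
      (min_le_min le_rfl (by linarith))).trans ((hS' n ω hn).trans (ENNReal.ofReal_le_ofReal ?_))
    have hn2 := natCast_le_two_mul_log_inv hr0 hr2
    set ℓ := Real.log r⁻¹ with hℓ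
    have h1 : Real.log (n + 1) ≤ 2 * Real.log ℓ := by
      rw [← Nat.cast_two, ← Real.log_pow]
      exact Real.log_le_log (by positivity) (by nlinarith)
    have h2 : (1 + 2 * Real.log (n + 1)) ^ β ≤ 5 ^ β * Real.log ℓ ^ β := by
      rw [← Real.mul_rpow (by norm_num) (by linarith)]
      exact Real.rpow_le_rpow (by linarith [hp n]) (by linarith) hβ0
    have h3 : (2 * ((1 : ℝ) / 2) ^ n) ^ c ≤ 4 ^ c * r ^ c := by
      rw [← Real.mul_rpow (by norm_num) hr0.le]
      refine Real.rpow_le_rpow (by positivity) ?_ hc0.le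
      rw [pow_succ] at hr1
      linarith
    calc K * ((1 + 2 * Real.log (n + 1)) ^ β * (2 * (1 / 2) ^ n) ^ c)
        ≤ K * ((5 ^ β * Real.log ℓ ^ β) * (4 ^ c * r ^ c)) :=
          mul_le_mul_of_nonneg_left (mul_le_mul h2 h3 (by positivity)
            (mul_nonneg (by positivity) (Real.rpow_nonneg (by linarith) _))) hK.le
      _ = _ := by ring
  filter_upwards [hmain, hlog.eventually_ge_atTop 3,
    (Real.tendsto_log_atTop.comp hlog).eventually_ge_atTop 1] with r h1 h2 h3
  exact h1 h2 h3

/-- The modulus at all times simultaneously. -/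
theorem exists_uniform_modulus (hd : 1 ≤ d) (hα : 0 < α) (hαd : α * d < 1) (hθ : 0 ≤ θ)
    (hC : 0 < C) (hY : IncrementBound P T Y α θ C) (hYm : Measurable (Function.uncurry Y)) :
    ∃ K : ℝ, 0 < K ∧ ∀ᵐ ω ∂P, ∀ᶠ r in 𝓝[>] (0 : ℝ), ∀ u v : ℝ, 0 ≤ u → u ≤ v → v ≤ T →
      v - u ≤ 2 * r → densitySup (fun s => Y s ω) u v ≤
        ENNReal.ofReal (K * (r ^ (1 - α * d) * Real.log r⁻¹ ^ (α * (d + θ)))) := by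
  obtain ⟨K, hK, htail⟩ := exists_tail_densitySup_le (H := 3) hd hα hαd hθ hC hY hYm
    (by norm_num)
  set β := α * (d + θ) with hβ
  set c := 1 - α * d with hc
  have hβ0 : 0 ≤ β := by positivity
  have hc0 : 0 < c := by linarith
  refine ⟨K * (5 ^ β * 6 ^ c), by positivity, ?_⟩
  have hhalf : ∀ n : ℕ, ((1 : ℝ) / 2) ^ n ≤ 1 := fun n =>
    pow_le_one₀ (by norm_num) (by norm_num)
  -- Every interval of length at most `2 * 2⁻ⁿ` lies in one of the intervals
  -- `[j * 2⁻ⁿ, (j + 3) * 2⁻ⁿ]`. About `2 ^ n` of these are relevant, so tails of order `2 n` are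
  -- summable.
  choose S hS hS' using fun (n j : ℕ) => htail (j * (1 / 2) ^ n) (min T ((j + 3) * (1 / 2) ^ n))
    (3 * (1 / 2) ^ n) (1 + 2 * n) (by positivity) (min_le_left _ _)
    (by linarith [min_le_right T ((j + 3) * (1 / 2) ^ n)])
    (by positivity) (by linarith [hhalf n]) (by linarith [n.cast_nonneg (α := ℝ)])
  set N := ⌈T⌉₊ + 1 with hN
  have hNT : T < N := by
    have := Nat.le_ceil T
    rw [hN]; push_cast; linarith
  have hsum : ∑' n, P (⋃ j ∈ Finset.range (2 ^ n * N), S n j) ≠ ∞ := by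
    have h1 : Summable fun n : ℕ => (N : ℝ) * Real.exp (-n) :=
      Real.summable_exp_neg_nat.mul_left _
    refine ne_top_of_le_ne_top h1.tsum_ofReal_ne_top (ENNReal.tsum_le_tsum fun n => ?_)
    calc P (⋃ j ∈ Finset.range (2 ^ n * N), S n j)
        ≤ ∑ j ∈ Finset.range (2 ^ n * N), P (S n j) := measure_biUnion_finset_le _ _
      _ ≤ ∑ j ∈ Finset.range (2 ^ n * N), ENNReal.ofReal (Real.exp (-(1 + 2 * n))) :=
          Finset.sum_le_sum fun j _ => hS n j
      _ = ENNReal.ofReal ((2 ^ n * N) * Real.exp (-(1 + 2 * n))) := by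
          rw [Finset.sum_const, Finset.card_range, ENNReal.ofReal_mul (by positivity),
            nsmul_eq_mul, ← ENNReal.ofReal_natCast]
          push_cast
          rfl
      _ ≤ _ := by
          refine ENNReal.ofReal_le_ofReal ?_
          have h2 : (2 : ℝ) ^ n ≤ Real.exp n := by
            rw [← mul_one (n : ℝ), Real.exp_nat_mul]
            exact pow_le_pow_left₀ zero_le_two (by linarith [Real.add_one_le_exp (1 : ℝ)]) n
          calc (2 : ℝ) ^ n * N * Real.exp (-(1 + 2 * n))
              ≤ Real.exp n * N * Real.exp (-(2 * n)) := by gcongr; linarith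
            _ = N * (Real.exp n * Real.exp (-(2 * n))) := by ring
            _ = N * Real.exp (-n) := by rw [← Real.exp_add]; ring_nf
  filter_upwards [ae_eventually_notMem hsum] with ω hω
  have hlog : Tendsto (fun r : ℝ => Real.log r⁻¹) (𝓝[>] 0) atTop :=
    Real.tendsto_log_atTop.comp tendsto_inv_nhdsGT_zero
  have hmain : ∀ᶠ r in 𝓝[>] (0 : ℝ), 1 ≤ Real.log r⁻¹ → ∀ u v : ℝ, 0 ≤ u → u ≤ v → v ≤ T →
      v - u ≤ 2 * r → densitySup (fun s => Y s ω) u v ≤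
        ENNReal.ofReal (K * (5 ^ β * 6 ^ c) * (r ^ c * Real.log r⁻¹ ^ β)) := by
    refine eventually_nhdsGT_zero_of_dyadic ?_
    filter_upwards [hω] with n hn r hr1 hr2 hl u v hu huv hv huvr
    have hr0 : 0 < r := lt_trans (by positivity) hr1
    have hyω : Measurable fun u => Y u ω := hYm.comp (measurable_id.prodMk measurable_const)
    have h2n : (2 : ℝ) ^ n * (1 / 2) ^ n = 1 := by rw [← mul_pow]; norm_num
    have hp2 : (0 : ℝ) < (1 / 2) ^ n := by positivity
    set j := ⌊u * 2 ^ n⌋₊ with hj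
    have hj1 : (j : ℝ) ≤ u * 2 ^ n := Nat.floor_le (by positivity)
    have hj2 : u * 2 ^ n < j + 1 := Nat.lt_floor_add_one _
    have hju : j * (1 / 2) ^ n ≤ u := by
      calc (j : ℝ) * (1 / 2) ^ n ≤ u * 2 ^ n * (1 / 2) ^ n := by gcongr
        _ = u := by rw [mul_assoc, h2n, mul_one]
    have huj : u < (j + 1) * (1 / 2) ^ n := by
      calc u = u * 2 ^ n * (1 / 2) ^ n := by rw [mul_assoc, h2n, mul_one]
        _ < _ := by gcongr
    have hjN : j ∈ Finset.range (2 ^ n * N) := by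
      rw [Finset.mem_range, ← Nat.cast_lt (α := ℝ)]
      push_cast
      calc (j : ℝ) ≤ u * 2 ^ n := hj1
        _ ≤ T * 2 ^ n := by gcongr; exact huv.trans hv
        _ < N * 2 ^ n := by gcongr
        _ = _ := mul_comm _ _
    have hnS : ω ∉ S n j := fun h => hn (mem_iUnion₂.2 ⟨j, hjN, h⟩)
    refine (densitySup_mono hyω hju (le_min hv (by linarith))).trans
      ((hS' n j ω hnS).trans (ENNReal.ofReal_le_ofReal ?_))
    have hn2 := natCast_le_two_mul_log_inv hr0 hr2
    set ℓ := Real.log r⁻¹ with hℓ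
    have h2 : (1 + 2 * n) ^ β ≤ 5 ^ β * ℓ ^ β := by
      rw [← Real.mul_rpow (by norm_num) (by linarith)]
      exact Real.rpow_le_rpow (by positivity) (by linarith) hβ0
    have h3 : (3 * ((1 : ℝ) / 2) ^ n) ^ c ≤ 6 ^ c * r ^ c := by
      rw [← Real.mul_rpow (by norm_num) hr0.le]
      refine Real.rpow_le_rpow (by positivity) ?_ hc0.le
      rw [pow_succ] at hr1
      linarith
    calc K * ((1 + 2 * n) ^ β * (3 * (1 / 2) ^ n) ^ c)
        ≤ K * ((5 ^ β * ℓ ^ β) * (6 ^ c * r ^ c)) :=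
          mul_le_mul_of_nonneg_left (mul_le_mul h2 h3 (by positivity)
            (mul_nonneg (by positivity) (Real.rpow_nonneg (by linarith) _))) hK.le
      _ = _ := by ring
  filter_upwards [hmain, hlog.eventually_ge_atTop 1] with r h1 h2
  exact h1 h2

/-- Almost surely, the smoothed occupation densities of a fixed interval converge uniformly. -/
theorem ae_uniformCauchySeqOn_occupationConv (hd : 1 ≤ d) (hα : 0 < α) (hαd : α * d < 1)
    (hC : 0 < C) (hY : IncrementBound P T Y α θ C) (hYm : Measurable (Function.uncurry Y))
    {a b : ℝ} (ha : 0 ≤ a) (hb : b ≤ T) :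
    ∀ᵐ ω ∂P, UniformCauchySeqOn (fun (k : ℕ) x =>
      occupationConv (heatKernel ((1 / 2) ^ k)) (fun s => Y s ω) a b x) atTop univ := by
  obtain ⟨K, hK, m₀, hm₀, hmom⟩ := exists_moment_densitySup_le (H := max 1 (b - a)) hd hα hαd hC hY
    hYm (le_max_left _ _)
  obtain ⟨Z, hZm, hZ, -, hZB⟩ := hmom a b (max 1 (b - a)) ha hb (le_max_right _ _) (by positivity)
    le_rfl (2 * m₀) (by omega) (even_two_mul _)
  have hZt : ∫⁻ ω, Z ω ∂P ≠ ∞ :=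
    ne_top_of_le_ne_top (ENNReal.pow_ne_top ENNReal.ofReal_ne_top) hZ
  filter_upwards [ae_lt_top hZm hZt] with ω hω
  obtain ⟨k₀, B, hB, hincr⟩ := hZB ω hω.ne
  exact uniformCauchySeqOn_of_summable_bound hB hincr

end BorelCantelli

/-! ### Local times and their moduli of continuity -/

lemma tendsto_rpow_mul_log_inv_rpow_nhdsGT_zero {c : ℝ} (hc : 0 < c) (β : ℝ) :
    Tendsto (fun r : ℝ => r ^ c * Real.log r⁻¹ ^ β) (𝓝[>] 0) (𝓝 0) := by
  have h := (isLittleO_abs_log_rpow_rpow_nhdsGT_zero β (neg_lt_zero.2 hc)).tendsto_div_nhds_zero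
  refine h.congr' ?_
  filter_upwards [Ioo_mem_nhdsGT one_pos] with r hr
  rw [abs_of_neg (Real.log_neg hr.1 hr.2), Real.log_inv, Real.rpow_neg hr.1.le, div_inv_eq_mul,
    mul_comm]

/-- Only times in `[0, T]` enter the bound on the characteristic functions. -/
lemma CharFunIncrementBound.congr_ae {d : ℕ} {Ω : Type*} [MeasurableSpace Ω] {P : Measure Ω} {T : ℝ}
    {X Y : ℝ → Ω → EuclideanSpace ℝ (Fin d)} {α θ : ℝ} (h : CharFunIncrementBound P T X α θ)
    (hXY : ∀ᵐ ω ∂P, ∀ t ∈ Icc 0 T, X t ω = Y t ω) : CharFunIncrementBound P T Y α θ := by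
  obtain ⟨C, hC, hb⟩ := h
  refine ⟨C, hC, fun m hm t ht0 htm htT ξ hξ k hk => ?_⟩
  have hmem : ∀ j, t j ∈ Icc 0 T := fun j =>
    ⟨ht0 ▸ htm.monotone (Fin.zero_le j), (htm.monotone (Fin.le_last j)).trans htT.le⟩
  refine le_of_eq_of_le (congrArg _ (integral_congr_ae ?_)) (hb m hm t ht0 htm htT ξ hξ k hk)
  filter_upwards [hXY] with ω hω
  simp_rw [hω _ (hmem _)]

/-- A process with almost surely continuous paths on `[0, T]` agrees there with a jointly measurable
process all of whose paths are continuous. -/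
lemma exists_continuous_modification {d : ℕ} {Ω : Type*} [MeasurableSpace Ω] {P : Measure Ω} {T : ℝ}
    {X : ℝ → Ω → EuclideanSpace ℝ (Fin d)} (hT : 0 < T)
    (hX_meas : ∀ t ∈ Icc (0 : ℝ) T, Measurable (X t))
    (hX_cont : ∀ᵐ ω ∂P, ContinuousOn (fun t => X t ω) (Icc 0 T)) :
    ∃ Y : ℝ → Ω → EuclideanSpace ℝ (Fin d), Measurable (Function.uncurry Y) ∧
      (∀ ω, Continuous fun t => Y t ω) ∧ ∀ᵐ ω ∂P, ∀ t ∈ Icc 0 T, X t ω = Y t ω := by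
  obtain ⟨N, hXN, hN, hPN⟩ := exists_measurable_superset_of_null (ae_iff.1 hX_cont)
  let Y : ℝ → Ω → EuclideanSpace ℝ (Fin d) := fun t => Nᶜ.indicator (X (projIcc 0 T hT.le t))
  have hYm : ∀ t, Measurable (Y t) := fun t =>
    (hX_meas _ (projIcc 0 T hT.le t).2).indicator hN.compl
  have hYc : ∀ ω, Continuous fun t => Y t ω := by
    intro ω
    by_cases hω : ω ∈ N
    · have : (fun t => Y t ω) = fun _ => 0 :=
        funext fun t => indicator_of_notMem (s := Nᶜ) (not_not_intro hω) _
      rw [this]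
      exact continuous_const
    · have : (fun t => Y t ω) = fun t => X (projIcc 0 T hT.le t) ω :=
        funext fun t => indicator_of_mem (s := Nᶜ) hω _
      rw [this]
      have hc : ContinuousOn (fun t => X t ω) (Icc 0 T) := by
        by_contra hcon
        exact hω (hXN hcon)
      exact hc.comp_continuous (continuous_subtype_val.comp continuous_projIcc)
        fun t => (projIcc 0 T hT.le t).2
  refine ⟨Y, measurable_uncurry_of_continuous_of_measurable hYc hYm, hYc, ?_⟩
  filter_upwards [measure_eq_zero_iff_ae_notMem.1 hPN] with ω hω t ht
  change X t ω = Nᶜ.indicator (X (projIcc 0 T hT.le t)) ω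
  rw [indicator_of_mem (s := Nᶜ) hω, projIcc_of_mem hT.le ht]

section ContinuousPaths

variable {d : ℕ} {Ω : Type*} [MeasurableSpace Ω] {P : Measure Ω} [IsProbabilityMeasure P]
  {T : ℝ} {Y : ℝ → Ω → EuclideanSpace ℝ (Fin d)} {α θ C : ℝ}

/-- A continuous process with the increment bound has a jointly continuous local time. -/
theorem ae_exists_isLocalTime (hd : 1 ≤ d) (hT : 0 < T) (hα : 0 < α) (hαd : α * d < 1)
    (hθ : 0 ≤ θ) (hC : 0 < C) (hY : IncrementBound P T Y α θ C)
    (hYm : Measurable (Function.uncurry Y)) (hYc : ∀ ω, Continuous fun t => Y t ω) :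
    ∀ᵐ ω ∂P, ∃ L : Kernel (EuclideanSpace ℝ (Fin d)) ℝ,
      IsLocalTime T (fun t => Y t ω) L ∧ IsJointlyContinuousLocalTime T L ∧
      ∀ x, ∀ s t : ℝ, 0 ≤ s → s ≤ t → t ≤ T → L x (Icc s t) ≤ densitySup (fun u => Y u ω) s t := by
  obtain ⟨K, hK, hmod⟩ := exists_uniform_modulus hd hα hαd hθ hC hY hYm
  have hgrid : ∀ᵐ ω ∂P, ∀ N i : ℕ, i ≤ N → UniformCauchySeqOn (fun (k : ℕ) x =>
      occupationConv (heatKernel ((1 / 2) ^ k)) (fun s => Y s ω) 0 (T * i / N) x) atTop univ := by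
    refine ae_all_iff.2 fun N => ae_all_iff.2 fun i => ?_
    by_cases hi : i ≤ N
    · have hb : T * i / N ≤ T := by
        have hi' : (i : ℝ) ≤ N := by exact_mod_cast hi
        exact div_le_of_le_mul₀ N.cast_nonneg hT.le (mul_le_mul_of_nonneg_left hi' hT.le)
      filter_upwards [ae_uniformCauchySeqOn_occupationConv hd hα hαd hC hY hYm le_rfl hb]
        with ω hω _ using hω
    · exact ae_of_all _ fun ω h => absurd h hi
  filter_upwards [hmod, hgrid] with ω hω hgridω
  refine exists_isLocalTime (hYc ω) hT hgridω fun ε hε => ?_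
  have h0 := (tendsto_rpow_mul_log_inv_rpow_nhdsGT_zero (c := 1 - α * d) (by linarith)
    (α * (d + θ))).const_mul K
  rw [mul_zero] at h0
  obtain ⟨r, ⟨h1, h2⟩, hr⟩ := ((hω.and (h0.eventually_lt_const hε)).and
    self_mem_nhdsWithin).exists
  have hr0 : (0 : ℝ) < r := hr
  exact ⟨2 * r, by positivity, fun s t hs hst ht hδ =>
    (h1 s t hs hst ht hδ).trans (ENNReal.ofReal_le_ofReal h2.le)⟩

lemma IsLocalTime.congr {E : Type*} [MeasureSpace E] {f g : ℝ → E} {L : Kernel E ℝ}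
    (h : IsLocalTime T f L) (hfg : ∀ t ∈ Icc 0 T, f t = g t) : IsLocalTime T g L := by
  intro B hB hBT A hA
  rw [← h B hB hBT A hA, occupationTime, occupationTime]
  congr 1
  ext t
  simp only [mem_inter_iff, mem_preimage]
  exact and_congr_right fun ht => by rw [hfg t (hBT ht)]

end ContinuousPaths

theorem mainTheorem1 {Ω : Type*} [MeasurableSpace Ω] (P : Measure Ω) [IsProbabilityMeasure P]
    (d : ℕ) (hd : 1 ≤ d) (T : ℝ) (hT : 0 < T)
    (X : ℝ → Ω → EuclideanSpace ℝ (Fin d))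
    (hX_meas : ∀ t ∈ Icc (0 : ℝ) T, Measurable (X t))
    (hX_cont : ∀ᵐ ω ∂P, ContinuousOn (fun t => X t ω) (Icc 0 T))
    (α θ : ℝ) (hα_pos : 0 < α) (hα_lt : α < 1 / (d : ℝ)) (hθ : 0 ≤ θ)
    (hA1 : CharFunIncrementBound P T X α θ)
    (hA2 : MomentIncrementBound P T X α) :
    ∃ L : Ω → Kernel (EuclideanSpace ℝ (Fin d)) ℝ,
      (∀ᵐ ω ∂P, IsLocalTime T (fun t => X t ω) (L ω) ∧ IsJointlyContinuousLocalTime T (L ω)) ∧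
      (∃ C₁ : ℝ≥0, ∀ s ∈ Icc (0 : ℝ) T, ∀ᵐ ω ∂P,
        limsup (fun r : ℝ =>
            (⨆ x : EuclideanSpace ℝ (Fin d), L ω x (Icc (s - r) (s + r) ∩ Icc 0 T)) /
              ENNReal.ofReal
                (r ^ (1 - α * d) * Real.log (Real.log r⁻¹) ^ (α * (d + θ))))
          (𝓝[>] 0) ≤ (C₁ : ℝ≥0∞)) ∧
      (∃ C₂ : ℝ≥0, ∀ᵐ ω ∂P,
        limsup (fun r : ℝ =>
            ⨆ s ∈ Icc (0 : ℝ) T, ⨆ x : EuclideanSpace ℝ (Fin d),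
              L ω x (Icc (s - r) (s + r) ∩ Icc 0 T) /
                ENNReal.ofReal
                  (r ^ (1 - α * d) * Real.log r⁻¹ ^ (α * (d + θ))))
          (𝓝[>] 0) ≤ (C₂ : ℝ≥0∞)) := by
  have hαd : α * d < 1 := (lt_div_iff₀ (by exact_mod_cast hd)).1 hα_lt
  obtain ⟨Y, hYm, hYc, hXY⟩ := exists_continuous_modification hT hX_meas hX_cont
  obtain ⟨C, hC, hY⟩ := (hA1.congr_ae hXY).exists_incrementBound
    fun t => hYm.comp (measurable_const.prodMk measurable_id)
  let IsGood : Ω → Kernel (EuclideanSpace ℝ (Fin d)) ℝ → Prop := fun ω L =>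
    IsLocalTime T (fun t => X t ω) L ∧ IsJointlyContinuousLocalTime T L ∧
      ∀ x, ∀ s t : ℝ, 0 ≤ s → s ≤ t → t ≤ T →
        L x (Icc s t) ≤ densitySup (fun u => Y u ω) s t
  have hex : ∀ᵐ ω ∂P, ∃ L, IsGood ω L := by
    filter_upwards [hXY, ae_exists_isLocalTime hd hT hα_pos hαd hθ hC hY hYm hYc]
      with ω hω ⟨L, h1, h2⟩
    exact ⟨L, h1.congr fun t ht => (hω t ht).symm, h2⟩
  -- Where no such kernel exists, the zero kernel is taken.
  have hall : ∀ ω, ∃ L, (∃ L, IsGood ω L) → IsGood ω L := fun ω =>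
    (em (∃ L, IsGood ω L)).elim (fun h => h.imp fun _ hL _ => hL)
      fun h => ⟨0, fun h1 => absurd h1 h⟩
  choose L hL using hall
  have hgood : ∀ᵐ ω ∂P, IsGood ω (L ω) := hex.mono fun ω h => hL ω h
  obtain ⟨K₁, hK₁, hloc⟩ := exists_local_modulus hd hα_pos hαd hθ hC hY hYm
  obtain ⟨K₂, hK₂, hunif⟩ := exists_uniform_modulus hd hα_pos hαd hθ hC hY hYm
  refine ⟨L, hgood.mono fun ω h => ⟨h.1, h.2.1⟩, ⟨K₁.toNNReal, fun s hs => ?_⟩,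
    ⟨K₂.toNNReal, ?_⟩⟩
  · filter_upwards [hgood, hloc s] with ω hω hlω
    refine limsup_le_of_le (by isBoundedDefault) ?_
    filter_upwards [hlω, self_mem_nhdsWithin] with r hr hr0
    have hr0 : (0 : ℝ) < r := hr0
    refine ENNReal.div_le_of_le_mul (iSup_le fun x => ?_)
    rw [← ENNReal.ofReal, ← ENNReal.ofReal_mul hK₁.le]
    refine le_trans ?_ hr
    rw [Icc_inter_Icc, sup_comm, inf_comm]
    exact hω.2.2 x _ _ (le_max_left _ _) (max_le (le_min hT.le (by linarith [hs.1]))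
      (le_min (by linarith [hs.2]) (by linarith))) (min_le_left _ _)
  · filter_upwards [hgood, hunif] with ω hω huω
    refine limsup_le_of_le (by isBoundedDefault) ?_
    filter_upwards [huω, self_mem_nhdsWithin] with r hr hr0
    have hr0 : (0 : ℝ) < r := hr0
    refine iSup₂_le fun s hs => iSup_le fun x => ENNReal.div_le_of_le_mul ?_
    rw [← ENNReal.ofReal, ← ENNReal.ofReal_mul hK₂.le, Icc_inter_Icc, sup_comm, inf_comm]
    have hle : 0 ⊔ (s - r) ≤ T ⊓ (s + r) := max_le (le_min hT.le (by linarith [hs.1]))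
      (le_min (by linarith [hs.2]) (by linarith))
    exact (hω.2.2 x _ _ (le_max_left _ _) hle (min_le_left _ _)).trans
      (hr _ _ (le_max_left _ _) hle (min_le_left _ _)
        (by linarith [min_le_right T (s + r), le_max_right 0 (s - r)]))
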